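/- Theorem (lazy regime of networks trained with per-parameter learning rates). Fix an input dimension $d_0\ge 1$, a depth $L\ge 2$ and a scale $\sigma_w>0$. Let $f(\theta,x)$ be the fully connected network without biases, with scalar output and with hidden layers of common width $d$: $$h^1=xW^1,\qquad h^{l+1}=\sigma(h^l)W^{l+1}\ (1\le l\le L-1),\qquad f(\theta,x)=h^L ,$$ where $\theta=(W^1,\dots,W^L)\in\mathbb R^P$ and $\sigma:\mathbb R\to\mathbb R$ is differentiable with bounded and Lipschitz derivative $\dot\sigma$. At initialization the entries of $\theta_0$ are independent centred Gaussians, of variance $\sigma_w^2/d_0$ in layer $1$ and $\sigma_w^2/d$ in the other layers. The weight terms $a_p$ of the parameters are independent of each other and of $\theta_0$; those in layer $l$ have law $\rho_l$, a probability measure on $[-a_{\max},a_{\max}]$ with mean $\mu_l$ (deterministic constants per layer are allowed). Let $(x_i,y_i)_{i=1}^n$, $x_i\in\mathbb R^{d_0}$, $y_i\in\mathbb R$, be a fixed training set with distinct $x_i$, write $\mathcal X=(x_1,\dots,x_n)$, and let $\mathcal L(f)=\frac12\sum_i (f(x_i)-y_i)^2$. Define $n\times n$ matrices by $S^{(1)}_{ij}=\frac{\sigma_w^2}{d_0}x_i^\top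 x_j$, $\mathcal A^{(1)}=0$ and, for $1\le l\le L-1$, $$S^{(l+1)}_{ij}=\sigma_w^2\,\mathbb E_{g\sim\mathcal N(0,S^{(l)})}[\sigma(g_i)\sigma(g_j)],$$ $$\mathcal A^{(l+1)}_{ij}=\sigma_w^2\,\mathcal A^{(l)}_{ij}\,\mathbb E_{g\sim\mathcal N(0,S^{(l)})}[\dot\sigma(g_i)\dot\sigma(g_j)]+\mu_{l+1}\,\mathbb E_{g\sim\mathcal N(0,S^{(l)})}[\sigma(g_i)\sigma(g_j)],$$ and assume that $\mathcal A^{(L)}$, the analytic weighted neural tangent kernel (the limit as $d\to\infty$ of $\frac1d\sum_p a_p\,\partial_{\theta_p}f(\theta_0,x_i)\,\partial_{\theta_p}f(\theta_0,x_j)$), is positive definite. Let $\eta=\eta_0/d$ with $\eta_0>0$. Let $\theta_t$ solve $\dot\theta_{t,p}=-\eta a_p\,\partial_{\theta_p}\mathcal L(f(\theta_t,\cdot))$ for $t\ge 0$, starting from $\theta_0$. Let $f^{\rm lin}(\theta,x)=f(\theta_0,x)+\nabla_\theta f(\theta_0,x)(\theta-\theta_0)$, let $\theta^{\rm lin}_t$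 solve the same equation with $f^{\rm lin}$ in place of $f$, also starting from $\theta_0$, and put $f^{\rm lin}_t(x)=f^{\rm lin}(\theta^{\rm lin}_t,x)$. Then for every $x\in\mathbb R^{d_0}$ with $\|x\|_2\le 1$ and all $\varepsilon,\delta>0$ there is an $N$ such that for every $d\ge N$, with probability at least $1-\delta$ over $(\theta_0,a)$, both flows exist for all times and, for all $t\ge 0$, $$\|f(\theta_t,\mathcal X)-f^{\rm lin}_t(\mathcal X)\|_2\le\varepsilon,\qquad |f(\theta_t,x)-f^{\rm lin}_t(x)|\le\varepsilon .$$ -/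

import Mathlib

open MeasureTheory ProbabilityTheory Filter

noncomputable section

namespace WNTK

/-- Index set of the trainable parameters of a fully connected network (no biases) of depth
`L = m + 2` with input dimension `d₀`, hidden layers of common width `d` and scalar output:
the entries `(j, i)` of the input matrix `W¹ ∈ ℝ^{d₀ × d}`, the entries `(k, j, i)` of the `m`
hidden-to-hidden matrices `W^{k+2} ∈ ℝ^{d × d}`, `k < m`, and the entries of the output vector
`W^{m+2} ∈ ℝ^{d × 1}`. -/
abbrev ParamIdx (d₀ m d : ℕ) : Type :=
  (Fin d₀ × Fin d) ⊕ (Fin m × Fin d × Fin d) ⊕ Fin d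

/-- Parameter vectors `θ ∈ ℝ^P`. -/
abbrev Params (d₀ m d : ℕ) : Type := ParamIdx d₀ m d → ℝ

variable {d₀ m d n : ℕ}

/-- The layer, in `{1, …, m + 2}`, to which a parameter belongs. -/
def layer : ParamIdx d₀ m d → ℕ
  | Sum.inl _ => 1
  | Sum.inr (Sum.inl q) => (q.1 : ℕ) + 2
  | Sum.inr (Sum.inr _) => m + 2

/-- The number of inputs of the layer to which a parameter belongs. -/
def fanIn : ParamIdx d₀ m d → ℕ
  | Sum.inl _ => d₀
  | Sum.inr _ => d

/-- Pre-activations `h^{k+1}` of hidden layer `k + 1` for `k = 0, …, m`: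
`h¹ = x W¹` and `h^{k+2} = σ(h^{k+1}) W^{k+2}`. -/
def preact (σ : ℝ → ℝ) (θ : Params d₀ m d) (x : EuclideanSpace ℝ (Fin d₀)) :
    (k : ℕ) → k ≤ m → Fin d → ℝ
  | 0, _ => fun i => ∑ j, x j * θ (Sum.inl (j, i))
  | k + 1, hk => fun i =>
      ∑ j, σ (preact σ θ x k (Nat.le_of_succ_le hk) j) * θ (Sum.inr (Sum.inl (⟨k, hk⟩, j, i)))

/-- The scalar network output `f(θ, x) = σ(h^{m+1}) W^{m+2}`. -/
def net (σ : ℝ → ℝ) (θ : Params d₀ m d) (x : EuclideanSpace ℝ (Fin d₀)) : ℝ :=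
  ∑ i, σ (preact σ θ x m le_rfl i) * θ (Sum.inr (Sum.inr i))

/-- The linearization at `θ₀`: `f(θ₀, x) + ∇_θ f(θ₀, x) (θ - θ₀)`. -/
def linNet (σ : ℝ → ℝ) (θ₀ θ : Params d₀ m d) (x : EuclideanSpace ℝ (Fin d₀)) : ℝ :=
  net σ θ₀ x + fderiv ℝ (fun θ' : Params d₀ m d => net σ θ' x) θ₀ (θ - θ₀)

/-- The vector of values of a function on the training inputs. -/
def onTrain (X : Fin n → EuclideanSpace ℝ (Fin d₀)) (f : EuclideanSpace ℝ (Fin d₀) → ℝ) :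
    EuclideanSpace ℝ (Fin n) :=
  WithLp.toLp 2 fun i => f (X i)

/-- The sum-of-squares loss `½ ∑ᵢ (f(xᵢ) - yᵢ)²`. -/
def loss (X : Fin n → EuclideanSpace ℝ (Fin d₀)) (Y : Fin n → ℝ)
    (f : EuclideanSpace ℝ (Fin d₀) → ℝ) : ℝ :=
  (1 / 2) * ∑ i, (f (X i) - Y i) ^ 2

/-- `θ` is a solution on `[0, ∞)`, started at `θ₀`, of the gradient flow of the objective `F`
with learning rate `η * a p` on the parameter `p`: `dθ_p/dt = - η a_p ∂F/∂θ_p (θ_t)`. -/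
def IsWeightedGradFlow {ι : Type} [Fintype ι] [DecidableEq ι] (η : ℝ) (a : ι → ℝ)
    (F : (ι → ℝ) → ℝ) (θ₀ : ι → ℝ) (θ : ℝ → ι → ℝ) : Prop :=
  θ 0 = θ₀ ∧ ∀ t : ℝ, 0 ≤ t → ∀ p : ι,
    HasDerivWithinAt (fun s => θ s p) (-(η * a p) * fderiv ℝ F (θ t) (Pi.single p 1))
      (Set.Ici 0) t

/-- Training the network by gradient flow with learning rates `η * a p`. -/
def IsNetTraining (σ : ℝ → ℝ) (X : Fin n → EuclideanSpace ℝ (Fin d₀)) (Y : Fin n → ℝ) (η : ℝ)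
    (a θ₀ : Params d₀ m d) (θ : ℝ → Params d₀ m d) : Prop :=
  IsWeightedGradFlow η a (fun θ' => loss X Y (net σ θ')) θ₀ θ

/-- Training the linearization at `θ₀` by gradient flow with the same learning rates, from the
same initialization. -/
def IsLinTraining (σ : ℝ → ℝ) (X : Fin n → EuclideanSpace ℝ (Fin d₀)) (Y : Fin n → ℝ) (η : ℝ)
    (a θ₀ : Params d₀ m d) (θ : ℝ → Params d₀ m d) : Prop :=
  IsWeightedGradFlow η a (fun θ' => loss X Y (linNet σ θ₀ θ')) θ₀ θ

/-- Law of the random initialization: independent Gaussian weights, centred, of variance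
`σ_w² / (number of inputs of the layer)`. -/
def initLaw (σw : ℝ) (d₀ m d : ℕ) : Measure (Params d₀ m d) :=
  Measure.pi fun p => gaussianReal 0 (Real.toNNReal (σw ^ 2 / (fanIn p : ℝ)))

/-- Law of the weight terms `a_p`: independent, with law `ρ l` for parameters in layer `l`. -/
def rateLaw (ρ : ℕ → Measure ℝ) (d₀ m d : ℕ) : Measure (Params d₀ m d) :=
  Measure.pi fun p => ρ (layer p)

/-- Joint law of `(θ₀, a)`: the weight terms are independent of the initialization. -/
def jointLaw (σw : ℝ) (ρ : ℕ → Measure ℝ) (d₀ m d : ℕ) :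
    Measure (Params d₀ m d × Params d₀ m d) :=
  (initLaw σw d₀ m d).prod (rateLaw ρ d₀ m d)

/-- The matrix `𝔼_{f ∼ 𝒩(0, S)} [φ(f(xᵢ)) φ(f(xⱼ))]`. -/
def gaussExp (φ : ℝ → ℝ) (S : Matrix (Fin n) (Fin n) ℝ) : Matrix (Fin n) (Fin n) ℝ :=
  Matrix.of fun i j => ∫ f, φ (f i) * φ (f j) ∂(multivariateGaussian 0 S)

/-- Limiting covariance, on the training inputs, of the pre-activations of layer `l + 1`. -/
def limitCov (σ : ℝ → ℝ) (σw : ℝ) (X : Fin n → EuclideanSpace ℝ (Fin d₀)) :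
    ℕ → Matrix (Fin n) (Fin n) ℝ
  | 0 => Matrix.of fun i j => σw ^ 2 / (d₀ : ℝ) * inner ℝ (X i) (X j)
  | l + 1 => σw ^ 2 • gaussExp σ (limitCov σ σw X l)

/-- The analytic WNTK of layer `l + 1` on the training inputs, where `μ l` is the mean of the
weight terms in layer `l`: the infinite-width limit at initialization of the WNTK
`(1/d) ∑_p a_p ∂_p f(xᵢ) ∂_p f(xⱼ)` of the standard parameterization, where `1/d` comes from the
learning rate `η₀/d`. The normalized contribution of a layer carries the factor
(number of its inputs)`/d`: it is `1` for layers `2, 3, …` and `d₀/d → 0` for the first layer,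
which is why the recursion starts from `0`. -/
def analyticWNTK (σ : ℝ → ℝ) (σw : ℝ) (μ : ℕ → ℝ) (X : Fin n → EuclideanSpace ℝ (Fin d₀)) :
    ℕ → Matrix (Fin n) (Fin n) ℝ
  | 0 => 0
  | l + 1 => Matrix.of fun i j =>
      analyticWNTK σ σw μ X l i j * (σw ^ 2 * gaussExp (deriv σ) (limitCov σ σw X l) i j)
        + μ (l + 2) * gaussExp σ (limitCov σ σw X l) i j

/-- Both training flows exist for all times, and along any such flows the outputs of the network
and of its linearization stay within `ε` of each other at all times `t ≥ 0`, on the training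
inputs in Euclidean norm and at the input `x`. -/
def LazyUpTo (σ : ℝ → ℝ) (X : Fin n → EuclideanSpace ℝ (Fin d₀)) (Y : Fin n → ℝ) (η : ℝ)
    (x : EuclideanSpace ℝ (Fin d₀)) (ε : ℝ) (θ₀ a : Params d₀ m d) : Prop :=
  (∃ θ, IsNetTraining σ X Y η a θ₀ θ) ∧
  (∃ θlin, IsLinTraining σ X Y η a θ₀ θlin) ∧
  ∀ θ θlin, IsNetTraining σ X Y η a θ₀ θ → IsLinTraining σ X Y η a θ₀ θlin →
    ∀ t : ℝ, 0 ≤ t →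
      ‖onTrain X (net σ (θ t)) - onTrain X (linNet σ θ₀ (θlin t))‖ ≤ ε ∧
      ‖net σ (θ t) x - linNet σ θ₀ (θlin t) x‖ ≤ ε

end WNTK

end

/-! At width `d` the gradient of the output has norm of order √d and the learning rate is `η₀ / d`,
so the tangent kernel that drives training is of order one. If this kernel is uniformly positive
definite along the flow, the residuals decay exponentially and the parameters move only by O(1/√d).
Within that distance the kernel hardly changes. The residuals then solve a linear system whose
coefficients are close to those of the linearized model, and a Grönwall estimate keeps the two
outputs together for all times. Weight terms may be negative: positivity is used only for the kernel
as a whole, and it is inherited from the positive definite limit.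

The probabilistic half supplies three facts about the initialization. The kernel converges in mean
square to `analyticWNTK` (`diagConverges_output`, `sum_grad_mul_grad`). To see this, the kernel is
followed forward through the layers as a matrix indexed by pairs of neurons: given the earlier
layers, an entry at the next hidden layer is a bilinear form in fresh Gaussian weights, plus, on the
diagonal, an average of fresh weight terms. Diagonal entries concentrate around a trace and
off-diagonal ones vanish. No independence of the forward and the backward pass is assumed;
conditioning on the earlier layers is done by `lintegral_le_of_resample`. Next, the hidden weight
matrices have bounded operator norm (`exists_opBound_initLaw`). Finally, the back-propagated
derivatives are uniformly small (`vanishInMean_sum_back_pow_four`). This is needed because the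
derivative of the activation is only Lipschitz: the pre-activations of a layer move by O(1) in
Euclidean norm, and the effect on the gradient is controlled by that times a sup norm.

The deterministic half bounds the change of the gradient near a good initialization
(`exists_nrm_grad_sub_le`), confines the flow to a ball of radius O(1/√d) (`flow_trapped`), deduces
global existence (`exists_flow`) and compares the two models (`lazy_of_kern_close`).
`exists_lazyUpTo` fixes the constants independently of the width, and a union bound concludes. -/

open MeasureTheory ProbabilityTheory Filter

noncomputable section

namespace WNTK

/-! ### Linear forms in independent Gaussians and their fourth moments -/

section GaussianVectors
open scoped NNReal

variable {ι : Type*} [Fintype ι]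

/-- The law of independent centred Gaussian coordinates with variances `v p`. -/
abbrev gaussPi (v : ι → ℝ≥0) : Measure (ι → ℝ) := Measure.pi fun p => gaussianReal 0 (v p)

/-- The covariance of the linear forms `∑ p, u p * θ p` and `∑ p, w p * θ p` under `gaussPi v`. -/
def linCov (v : ι → ℝ≥0) (u w : ι → ℝ) : ℝ := ∑ p, u p * w p * v p

theorem measurable_linForm (u : ι → ℝ) : Measurable fun θ : ι → ℝ => ∑ p, u p * θ p := by
  fun_prop

theorem hasGaussianLaw_gaussPi (v : ι → ℝ≥0) :
    HasGaussianLaw (fun (θ : ι → ℝ) p => θ p) (gaussPi v) := by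
  refine iIndepFun.hasGaussianLaw (X := fun p (θ : ι → ℝ) => θ p) (fun p => ?_) ?_
  · refine ⟨?_⟩
    rw [show (fun θ : ι → ℝ => θ p) = Function.eval p from rfl, (measurePreserving_eval _ p).map_eq]
    infer_instance
  · exact iIndepFun_pi (X := fun _ => id) (fun _ => aemeasurable_id)

theorem memLp_linForm (v : ι → ℝ≥0) (u : ι → ℝ) (r : ENNReal) (hr : r ≠ ⊤) :
    MemLp (fun θ : ι → ℝ => ∑ p, u p * θ p) r (gaussPi v) := by
  have h := (hasGaussianLaw_gaussPi v).map_fun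
    (∑ p, u p • ContinuousLinearMap.proj (R := ℝ) (φ := fun _ : ι => ℝ) p)
  simpa [sum_apply] using h.memLp hr

theorem integral_eval_gaussPi (v : ι → ℝ≥0) (p : ι) : ∫ θ : ι → ℝ, θ p ∂(gaussPi v) = 0 := by
  rw [integral_comp_eval (μ := fun p => gaussianReal 0 (v p)) (f := fun x : ℝ => x)]
  · simp
  · exact aestronglyMeasurable_id

theorem integral_linForm (v : ι → ℝ≥0) (u : ι → ℝ) :
    ∫ θ : ι → ℝ, ∑ p, u p * θ p ∂(gaussPi v) = 0 := by
  classical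
  rw [integral_finsetSum]
  · simp [integral_const_mul, integral_eval_gaussPi]
  · intro p _
    refine Integrable.const_mul ?_ _
    have := (memLp_linForm v (Pi.single p 1) 1 (by simp)).integrable le_rfl
    simpa [Pi.single_apply] using this

theorem covariance_eval_gaussPi [DecidableEq ι] (v : ι → ℝ≥0) (p q : ι) :
    cov[fun θ : ι → ℝ => θ p, fun θ => θ q; gaussPi v] = if p = q then (v p : ℝ) else 0 := by
  split_ifs with h
  · subst h
    rw [covariance_self (measurable_pi_apply p).aemeasurable]
    have := (measurePreserving_eval (fun p => gaussianReal 0 (v p)) p)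
    have h2 : Var[fun x : ℝ => x; (gaussPi v).map (Function.eval p)] = v p := by
      rw [this.map_eq]; simp
    rw [variance_map aemeasurable_id' this.measurable.aemeasurable] at h2
    exact h2
  · have hi : iIndepFun (fun p (θ : ι → ℝ) => θ p) (gaussPi v) :=
      iIndepFun_pi (X := fun _ => id) (fun _ => aemeasurable_id)
    have hm : ∀ p, MemLp (fun θ : ι → ℝ => θ p) 2 (gaussPi v) := fun p => by
      simpa [Pi.single_apply] using memLp_linForm v (Pi.single p 1) 2 (by simp)
    exact (hi.indepFun h).covariance_eq_zero (hm p) (hm q)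

theorem covariance_linForm (v : ι → ℝ≥0) (u w : ι → ℝ) :
    cov[fun θ : ι → ℝ => ∑ p, u p * θ p, fun θ => ∑ p, w p * θ p; gaussPi v] = linCov v u w := by
  classical
  have hm : ∀ p, MemLp (fun θ : ι → ℝ => θ p) 2 (gaussPi v) := fun p => by
      simpa [Pi.single_apply] using memLp_linForm v (Pi.single p 1) 2 (by simp)
  rw [covariance_fun_sum_fun_sum (fun p => (hm p).const_mul _) (fun p => (hm p).const_mul _)]
  simp only [covariance_const_mul_left, covariance_const_mul_right, covariance_eval_gaussPi]
  simp only [linCov, mul_ite, mul_zero, Finset.sum_ite_eq, Finset.mem_univ, if_true]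
  exact Finset.sum_congr rfl fun p _ => by ring

theorem linCov_gram_posSemidef {κ : Type*} [Fintype κ] (v : ι → ℝ≥0) (u : κ → ι → ℝ) :
    (Matrix.of fun a b => linCov v (u a) (u b)).PosSemidef := by
  have : (Matrix.of fun a b => linCov v (u a) (u b)) =
      (Matrix.of fun a p => u a p * √(v p : ℝ)) * (Matrix.of fun a p => u a p * √(v p : ℝ)).conjTranspose := by
    ext a b
    simp only [Matrix.of_apply, Matrix.mul_apply, Matrix.conjTranspose_apply, linCov, star_trivial]
    refine Finset.sum_congr rfl fun p _ => ?_
    calc u a p * u b p * v p = u a p * u b p * (√(v p : ℝ) * √(v p : ℝ)) := by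
          rw [Real.mul_self_sqrt (v p).coe_nonneg]
      _ = _ := by ring
  rw [this]
  exact Matrix.posSemidef_self_mul_conjTranspose _

/-- Both laws are Gaussian, so equality of means and covariances is enough. With the earlier layers
frozen, the pre-activations of a neuron at all training inputs form such a family. -/
theorem map_linForm_eq_multivariateGaussian {κ : Type*} [Fintype κ] [DecidableEq κ]
    (v : ι → ℝ≥0) (u : κ → ι → ℝ) :
    (gaussPi v).map (fun θ => WithLp.toLp 2 fun a => ∑ p, u a p * θ p) =
      multivariateGaussian 0 (Matrix.of fun a b => linCov v (u a) (u b)) := by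
  set F : (ι → ℝ) →L[ℝ] EuclideanSpace ℝ κ :=
    (EuclideanSpace.equiv κ ℝ).symm.toContinuousLinearMap.comp
      (ContinuousLinearMap.pi fun a =>
        ∑ p, u a p • ContinuousLinearMap.proj (R := ℝ) (φ := fun _ : ι => ℝ) p) with hF
  have hFe : (fun θ => WithLp.toLp 2 fun a => ∑ p, u a p * θ p) = (F : (ι → ℝ) → _) := by
    funext θ
    ext a
    simp [hF, sum_apply]
  have hG : IsGaussian ((gaussPi v).map F) := ((hasGaussianLaw_gaussPi v).map F).isGaussian_map
  have hmem : ∀ a, MemLp (fun θ : ι → ℝ => ∑ p, u a p * θ p) 2 (gaussPi v) :=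
    fun a => memLp_linForm v _ 2 (by simp)
  rw [hFe]
  apply IsGaussian.ext
  · simp only [id_eq, integral_id_multivariateGaussian]
    rw [integral_map (by fun_prop) (by fun_prop)]
    have hint : Integrable (fun θ : ι → ℝ => θ) (gaussPi v) := by
      simpa using (hasGaussianLaw_gaussPi v).integrable
    rw [ContinuousLinearMap.integral_comp_comm _ hint]
    have : ∫ θ : ι → ℝ, θ ∂(gaussPi v) = 0 := by
      funext p
      rw [Pi.zero_apply, ← integral_eval_gaussPi v p]
      exact ((ContinuousLinearMap.proj (R := ℝ) (φ := fun _ : ι => ℝ) p).integral_comp_comm hint).symm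
    rw [this, map_zero]
  · ext x y
    rw [covarianceBilin_multivariateGaussian (linCov_gram_posSemidef v u), ← hFe,
      covarianceBilin_apply_pi hmem]
    simp only [covariance_linForm, dotProduct, Matrix.mulVec, Matrix.of_apply, Finset.mul_sum]
    exact Finset.sum_congr rfl fun a _ => Finset.sum_congr rfl fun b _ => by ring

theorem map_linForm_eq_gaussianReal (v : ι → ℝ≥0) (u : ι → ℝ) :
    (gaussPi v).map (fun θ => ∑ p, u p * θ p) = gaussianReal 0 (linCov v u u).toNNReal := by
  have h := (hasGaussianLaw_gaussPi v).map_fun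
    (∑ p, u p • ContinuousLinearMap.proj (R := ℝ) (φ := fun _ : ι => ℝ) p)
  have h2 : HasGaussianLaw (fun θ : ι → ℝ => ∑ p, u p * θ p) (gaussPi v) := by
    simpa [sum_apply] using h
  rw [h2.map_eq_gaussianReal, integral_linForm, ← covariance_self h2.aemeasurable, covariance_linForm]

theorem linCov_self_nonneg (v : ι → ℝ≥0) (u : ι → ℝ) : 0 ≤ linCov v u u :=
  Finset.sum_nonneg fun p _ => mul_nonneg (mul_self_nonneg _) (v p).2

theorem integrable_pow_gaussianReal (v : ℝ≥0) (k : ℕ) :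
    Integrable (fun x : ℝ => x ^ k) (gaussianReal 0 v) := by
  rcases Nat.eq_zero_or_pos k with rfl | hk
  · simp
  have h := memLp_id_gaussianReal' (μ := 0) (v := v) (k : ENNReal) (by simp)
  have := h.integrable_norm_pow (by omega)
  refine (this.mono' (by fun_prop) ?_)
  filter_upwards with x
  simp

theorem integral_sq_gaussianReal (v : ℝ≥0) : ∫ x, x ^ 2 ∂(gaussianReal 0 v) = v := by
  have h := variance_fun_id_gaussianReal (μ := 0) (v := v)
  rw [variance_of_integral_eq_zero (by fun_prop) (by simp)] at h
  exact h

theorem gaussianReal_eq_map_std (v : ℝ≥0) :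
    gaussianReal 0 v = (gaussianReal 0 1).map (fun x => √(v : ℝ) * x) := by
  rw [gaussianReal_map_const_mul]
  congr 1
  · simp
  · ext; simp

/-- By scaling the moment is `v ^ 2 * c`, with `c` that of the standard Gaussian. Since N(0, 2) is
the convolution of N(0, 1) with itself, expanding `(x + y) ^ 4` gives `4 c = 2 c + 6`, hence `c =
3`. -/
theorem integral_pow_four_gaussianReal (v : ℝ≥0) :
    ∫ x, x ^ 4 ∂(gaussianReal 0 v) = 3 * (v : ℝ) ^ 2 := by
  have key : ∀ v : ℝ≥0, ∫ x, x ^ 4 ∂(gaussianReal 0 v) =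
      (v : ℝ) ^ 2 * ∫ x, x ^ 4 ∂(gaussianReal 0 1) := fun v => by
    rw [gaussianReal_eq_map_std v, integral_map (by fun_prop) (by fun_prop), ← integral_const_mul]
    refine integral_congr_ae (Eventually.of_forall fun x => ?_)
    have := Real.sq_sqrt v.coe_nonneg
    simp only [mul_pow]
    rw [show √(v : ℝ) ^ 4 = (√(v : ℝ) ^ 2) ^ 2 by ring, this]
  have hc : ∫ x, x ^ 4 ∂(gaussianReal 0 1) = 3 := by
    set c := ∫ x, x ^ 4 ∂(gaussianReal 0 1) with hcdef
    have h2 := key 2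
    rw [show (2 : ℝ≥0) = 1 + 1 by norm_num, show (0:ℝ) = 0 + 0 by norm_num,
      ← gaussianReal_conv_gaussianReal, Measure.conv, integral_map (by fun_prop) (by fun_prop)] at h2
    have hi : ∀ k l : ℕ, Integrable (fun z : ℝ × ℝ => z.1 ^ k * z.2 ^ l)
        ((gaussianReal 0 1).prod (gaussianReal 0 1)) := fun k l =>
      (integrable_pow_gaussianReal 1 k).mul_prod (integrable_pow_gaussianReal 1 l)
    have hv : ∀ k l : ℕ, ∫ z : ℝ × ℝ, z.1 ^ k * z.2 ^ l
        ∂((gaussianReal 0 1).prod (gaussianReal 0 1)) =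
        (∫ x, x ^ k ∂(gaussianReal 0 1)) * ∫ x, x ^ l ∂(gaussianReal 0 1) := fun k l =>
      integral_prod_mul (fun x : ℝ => x ^ k) (fun x : ℝ => x ^ l)
    have e : (fun z : ℝ × ℝ => (z.1 + z.2) ^ 4) = fun z =>
        (((z.1 ^ 4 * z.2 ^ 0 + 4 * (z.1 ^ 3 * z.2 ^ 1)) + 6 * (z.1 ^ 2 * z.2 ^ 2))
          + 4 * (z.1 ^ 1 * z.2 ^ 3)) + z.1 ^ 0 * z.2 ^ 4 := by
      funext z; ring
    rw [e, integral_add, integral_add, integral_add, integral_add] at h2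
    · simp only [integral_const_mul, hv] at h2
      simp only [integral_sq_gaussianReal, ← hcdef] at h2
      simp at h2
      linarith
    all_goals first
      | exact hi _ _
      | exact (hi _ _).const_mul _
      | skip
    · exact (hi _ _).add ((hi _ _).const_mul _)
    · exact ((hi _ _).add ((hi _ _).const_mul _)).add ((hi _ _).const_mul _)
    · exact (((hi _ _).add ((hi _ _).const_mul _)).add ((hi _ _).const_mul _)).add
        ((hi _ _).const_mul _)
  rw [key v, hc]; ring

theorem integral_linForm_pow_four (v : ι → ℝ≥0) (u : ι → ℝ) :
    ∫ θ : ι → ℝ, (∑ p, u p * θ p) ^ 4 ∂(gaussPi v) = 3 * linCov v u u ^ 2 := by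
  have h := integral_map (μ := gaussPi v) (φ := fun θ : ι → ℝ => ∑ p, u p * θ p)
    (f := fun x : ℝ => x ^ 4) (measurable_linForm u).aemeasurable (by fun_prop)
  rw [← h, map_linForm_eq_gaussianReal, integral_pow_four_gaussianReal,
    Real.coe_toNNReal _ (linCov_self_nonneg v u)]

theorem integral_linForm_sq (v : ι → ℝ≥0) (u : ι → ℝ) :
    ∫ θ : ι → ℝ, (∑ p, u p * θ p) ^ 2 ∂(gaussPi v) = linCov v u u := by
  have h := integral_map (μ := gaussPi v) (φ := fun θ : ι → ℝ => ∑ p, u p * θ p)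
    (f := fun x : ℝ => x ^ 2) (measurable_linForm u).aemeasurable (by fun_prop)
  rw [← h, map_linForm_eq_gaussianReal, integral_sq_gaussianReal,
    Real.coe_toNNReal _ (linCov_self_nonneg v u)]

theorem integrable_linForm_pow (v : ι → ℝ≥0) (u : ι → ℝ) (k : ℕ) :
    Integrable (fun θ : ι → ℝ => (∑ p, u p * θ p) ^ k) (gaussPi v) := by
  have h := integrable_map_measure (μ := gaussPi v) (f := fun θ : ι → ℝ => ∑ p, u p * θ p)
    (g := fun x : ℝ => x ^ k) (by fun_prop) (measurable_linForm u).aemeasurable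
  rw [map_linForm_eq_gaussianReal] at h
  exact h.1 (integrable_pow_gaussianReal _ k)

theorem integrable_linForm_mul_four (v : ι → ℝ≥0) (u w y z : ι → ℝ) :
    Integrable (fun θ : ι → ℝ => (∑ p, u p * θ p) * (∑ p, w p * θ p) * (∑ p, y p * θ p) *
      (∑ p, z p * θ p)) (gaussPi v) := by
  have h := fun (u : ι → ℝ) => memLp_linForm v u 4 (by simp)
  have : ENNReal.HolderTriple 4 4 2 := ⟨by
    rw [← ENNReal.toReal_eq_toReal_iff' (by simp) (by simp), ENNReal.toReal_add (by simp) (by simp)]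
    norm_num⟩
  have h2 := fun (u w : ι → ℝ) => (h w).mul (h u) (r := 2)
  have := (h2 u w).integrable_mul (h2 y z)
  refine this.congr (Eventually.of_forall fun θ => ?_)
  simp only [Pi.mul_apply]
  ring

/-- Isserlis' formula by polarization: a product of four linear forms is a combination of fourth
powers of linear forms, whose moments depend on a variance only. -/
theorem integral_linForm_mul_four (v : ι → ℝ≥0) (u w y z : ι → ℝ) :
    ∫ θ : ι → ℝ, (∑ p, u p * θ p) * (∑ p, w p * θ p) * (∑ p, y p * θ p) *
      (∑ p, z p * θ p) ∂(gaussPi v) =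
    linCov v u w * linCov v y z + linCov v u y * linCov v w z + linCov v u z * linCov v w y := by
  set s : ℝ → ℝ → ℝ → ι → ℝ := fun a b c p => u p + a * w p + b * y p + c * z p with hs
  have hl : ∀ a b c (θ : ι → ℝ), ∑ p, s a b c p * θ p = (∑ p, u p * θ p) + a * (∑ p, w p * θ p)
      + b * (∑ p, y p * θ p) + c * (∑ p, z p * θ p) := fun a b c θ => by
    simp only [hs, Finset.mul_sum, ← Finset.sum_add_distrib]
    exact Finset.sum_congr rfl fun p _ => by ring
  have hcov : ∀ a b c, linCov v (s a b c) (s a b c) = linCov v u u + a ^ 2 * linCov v w w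
      + b ^ 2 * linCov v y y + c ^ 2 * linCov v z z + 2 * a * linCov v u w + 2 * b * linCov v u y
      + 2 * c * linCov v u z + 2 * a * b * linCov v w y + 2 * a * c * linCov v w z
      + 2 * b * c * linCov v y z := fun a b c => by
    simp only [linCov, hs, Finset.mul_sum, ← Finset.sum_add_distrib]
    exact Finset.sum_congr rfl fun p _ => by ring
  have hI := fun a b c => integrable_linForm_pow v (s a b c) 4
  have hE := fun a b c => integral_linForm_pow_four v (s a b c)
  -- The eight choices of signs in `u ± w ± y ± z`, weighted by the product of the signs, leave only
  -- the mixed term, with coefficient 8 · 4! = 192.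
  have e : (fun θ : ι → ℝ => (∑ p, u p * θ p) * (∑ p, w p * θ p) * (∑ p, y p * θ p) *
      (∑ p, z p * θ p)) = fun θ => (1 / 192 : ℝ) *
      ((((∑ p, s 1 1 1 p * θ p) ^ 4 - (∑ p, s 1 1 (-1) p * θ p) ^ 4)
        + ((∑ p, s 1 (-1) (-1) p * θ p) ^ 4 - (∑ p, s 1 (-1) 1 p * θ p) ^ 4))
        + (((∑ p, s (-1) (-1) 1 p * θ p) ^ 4 - (∑ p, s (-1) (-1) (-1) p * θ p) ^ 4)
        + ((∑ p, s (-1) 1 (-1) p * θ p) ^ 4 - (∑ p, s (-1) 1 1 p * θ p) ^ 4))) := by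
    funext θ
    simp only [hl]
    ring
  rw [e, integral_const_mul, integral_add, integral_add, integral_add, integral_sub, integral_sub,
    integral_sub, integral_sub]
  · simp only [hE, hcov]
    ring
  all_goals first
    | exact hI _ _ _
    | exact (hI _ _ _).sub (hI _ _ _)
    | exact ((hI _ _ _).sub (hI _ _ _)).add ((hI _ _ _).sub (hI _ _ _))

end GaussianVectors

/-! ### Bilinear and quadratic forms in Gaussian weights; a law of large numbers -/

section GaussianForms
open scoped NNReal

variable {ι : Type*} [Fintype ι] [DecidableEq ι]

theorem integrable_eval_mul_four (v : ι → ℝ≥0) (p q r s : ι) :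
    Integrable (fun θ : ι → ℝ => θ p * θ q * θ r * θ s) (gaussPi v) := by
  simpa [Pi.single_apply] using
    integrable_linForm_mul_four v (Pi.single p 1) (Pi.single q 1) (Pi.single r 1) (Pi.single s 1)

theorem linCov_single (v : ι → ℝ≥0) (p q : ι) :
    linCov v (Pi.single p 1) (Pi.single q 1) = if p = q then (v p : ℝ) else 0 := by
  simp only [linCov, Pi.single_apply, ite_mul, mul_ite, one_mul, zero_mul, mul_one, mul_zero]
  rcases eq_or_ne p q with rfl | h
  · simp
  · simp [h, h.symm]

theorem integral_eval_mul_four (v : ι → ℝ≥0) (p q r s : ι) :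
    ∫ θ : ι → ℝ, θ p * θ q * θ r * θ s ∂(gaussPi v) =
      (if p = q then (v p : ℝ) else 0) * (if r = s then (v r : ℝ) else 0) +
      (if p = r then (v p : ℝ) else 0) * (if q = s then (v q : ℝ) else 0) +
      (if p = s then (v p : ℝ) else 0) * (if q = r then (v q : ℝ) else 0) := by
  have h := integral_linForm_mul_four v (Pi.single p 1) (Pi.single q 1) (Pi.single r 1)
    (Pi.single s 1)
  simp only [linCov_single] at h
  rw [← h]
  simp [Pi.single_apply]

theorem integrable_eval_mul_two (v : ι → ℝ≥0) (p q : ι) :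
    Integrable (fun θ : ι → ℝ => θ p * θ q) (gaussPi v) := by
  have h := fun p : ι => memLp_linForm v (Pi.single p 1) 2 (by simp)
  simpa [Pi.single_apply, Pi.mul_def] using (h p).integrable_mul (h q)

theorem integral_eval_mul_two (v : ι → ℝ≥0) (p q : ι) :
    ∫ θ : ι → ℝ, θ p * θ q ∂(gaussPi v) = if p = q then (v p : ℝ) else 0 := by
  have h := fun p : ι => memLp_linForm v (Pi.single p 1) 2 (by simp)
  simp only [Pi.single_apply, ite_mul, one_mul, zero_mul, Finset.sum_ite_eq', Finset.mem_univ,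
    if_true] at h
  rw [← covariance_eval_gaussPi v p q, covariance_eq_sub (h p) (h q)]
  simp [integral_eval_gaussPi, Pi.mul_apply]

variable {β : Type*} [Fintype β]

theorem bilinForm_sq (B : β → β → ℝ) (x y : β → ℝ) :
    (∑ j, ∑ j', B j j' * (x j * y j')) ^ 2 =
      ∑ j, ∑ j', ∑ k, ∑ k', B j j' * B k k' * (x j * y j' * x k * y k') := by
  rw [sq, Finset.sum_mul_sum]
  simp only [Finset.sum_mul_sum]
  refine Finset.sum_congr rfl fun j _ => ?_
  rw [Finset.sum_comm]
  refine Finset.sum_congr rfl fun j' _ => Finset.sum_congr rfl fun k _ =>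
    Finset.sum_congr rfl fun k' _ => by ring

theorem integrable_bilinForm_sq (v : ι → ℝ≥0) (e e' : β → ι) (B : β → β → ℝ) :
    Integrable (fun θ : ι → ℝ => (∑ j, ∑ j', B j j' * (θ (e j) * θ (e' j'))) ^ 2)
      (gaussPi v) := by
  have : (fun θ : ι → ℝ => (∑ j, ∑ j', B j j' * (θ (e j) * θ (e' j'))) ^ 2) = fun θ =>
      ∑ j, ∑ j', ∑ k, ∑ k', B j j' * B k k' * (θ (e j) * θ (e' j') * θ (e k) * θ (e' k')) := by
    funext θ; exact bilinForm_sq B (fun j => θ (e j)) (fun j => θ (e' j))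
  rw [this]
  refine integrable_finsetSum _ fun j _ => integrable_finsetSum _ fun j' _ =>
    integrable_finsetSum _ fun k _ => integrable_finsetSum _ fun k' _ =>
      (integrable_eval_mul_four v _ _ _ _).const_mul _

theorem integral_bilinForm_sq (v : ι → ℝ≥0) (e e' : β → ι) (B : β → β → ℝ) :
    ∫ θ : ι → ℝ, (∑ j, ∑ j', B j j' * (θ (e j) * θ (e' j'))) ^ 2 ∂(gaussPi v) =
      ∑ j, ∑ j', ∑ k, ∑ k', B j j' * B k k' *
        ∫ θ : ι → ℝ, θ (e j) * θ (e' j') * θ (e k) * θ (e' k') ∂(gaussPi v) := by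
  have : (fun θ : ι → ℝ => (∑ j, ∑ j', B j j' * (θ (e j) * θ (e' j'))) ^ 2) = fun θ =>
      ∑ j, ∑ j', ∑ k, ∑ k', B j j' * B k k' * (θ (e j) * θ (e' j') * θ (e k) * θ (e' k')) := by
    funext θ; exact bilinForm_sq B (fun j => θ (e j)) (fun j => θ (e' j))
  have hI := fun j j' k k' => ((integrable_eval_mul_four v (e j) (e' j') (e k) (e' k')).const_mul
    (B j j' * B k k'))
  rw [this, integral_finsetSum _ fun j _ => integrable_finsetSum _ fun j' _ =>
    integrable_finsetSum _ fun k _ => integrable_finsetSum _ fun k' _ => hI j j' k k']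
  refine Finset.sum_congr rfl fun j _ => ?_
  rw [integral_finsetSum _ fun j' _ =>
    integrable_finsetSum _ fun k _ => integrable_finsetSum _ fun k' _ => hI j j' k k']
  refine Finset.sum_congr rfl fun j' _ => ?_
  rw [integral_finsetSum _ fun k _ => integrable_finsetSum _ fun k' _ => hI j j' k k']
  refine Finset.sum_congr rfl fun k _ => ?_
  rw [integral_finsetSum _ fun k' _ => hI j j' k k']
  exact Finset.sum_congr rfl fun k' _ => integral_const_mul _ _

/-- Of the three Wick pairings only one survives, because the weights selected by `e` and `e'` are
disjoint. This is the case of two columns of a weight matrix, that is, of off-diagonal kernel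
entries. -/
theorem integral_bilinForm_sq_of_disjoint [DecidableEq β] (v : ι → ℝ≥0) (e e' : β → ι) (c : ℝ)
    (he : Function.Injective e) (he' : Function.Injective e') (hd : ∀ j k, e j ≠ e' k)
    (hv : ∀ j, (v (e j) : ℝ) = c) (hv' : ∀ j, (v (e' j) : ℝ) = c) (B : β → β → ℝ) :
    ∫ θ : ι → ℝ, (∑ j, ∑ j', B j j' * (θ (e j) * θ (e' j'))) ^ 2 ∂(gaussPi v) =
      c ^ 2 * ∑ j, ∑ j', B j j' ^ 2 := by
  rw [integral_bilinForm_sq, Finset.mul_sum]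
  refine Finset.sum_congr rfl fun j _ => ?_
  rw [Finset.mul_sum]
  refine Finset.sum_congr rfl fun j' _ => ?_
  simp only [integral_eval_mul_four, he.eq_iff, he'.eq_iff, hd, (fun j k => (hd k j).symm :
    ∀ j k, e' j ≠ e k), if_false, hv, hv', zero_mul, zero_add, add_zero]
  rw [Finset.sum_eq_single j, Finset.sum_eq_single j']
  · simp; ring
  · intro b _ hb; simp [hb.symm]
  · simp
  · intro b _ hb; simp [hb.symm]
  · simp

theorem integrable_bilinForm (v : ι → ℝ≥0) (e e' : β → ι) (B : β → β → ℝ) :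
    Integrable (fun θ : ι → ℝ => ∑ j, ∑ j', B j j' * (θ (e j) * θ (e' j'))) (gaussPi v) :=
  integrable_finsetSum _ fun _ _ => integrable_finsetSum _ fun _ _ =>
    (integrable_eval_mul_two v _ _).const_mul _

theorem integrable_quadForm_sub_sq (v : ι → ℝ≥0) (e : β → ι) (B : β → β → ℝ) (c : ℝ) :
    Integrable (fun θ : ι → ℝ => (∑ j, ∑ j', B j j' * (θ (e j) * θ (e j')) - c) ^ 2)
      (gaussPi v) := by
  have := ((integrable_bilinForm_sq v e e B).sub ((integrable_bilinForm v e e B).const_mul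
    (2 * c))).add (integrable_const (c ^ 2))
  refine this.congr (Eventually.of_forall fun θ => ?_)
  simp only [Pi.add_apply, Pi.sub_apply]
  ring

/-- Variance bound for a quadratic form in independent Gaussians of equal variance. -/
theorem integral_quadForm_sub_trace_sq_le [DecidableEq β] (v : ι → ℝ≥0) (e : β → ι) (c : ℝ)
    (he : Function.Injective e) (hv : ∀ j, (v (e j) : ℝ) = c) (B : β → β → ℝ) :
    ∫ θ : ι → ℝ, (∑ j, ∑ j', B j j' * (θ (e j) * θ (e j')) - c * ∑ j, B j j) ^ 2 ∂(gaussPi v) ≤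
      2 * c ^ 2 * ∑ j, ∑ j', B j j' ^ 2 := by
  have h1 : ∫ θ : ι → ℝ, ∑ j, ∑ j', B j j' * (θ (e j) * θ (e j')) ∂(gaussPi v) =
      c * ∑ j, B j j := by
    rw [integral_finsetSum _ fun j _ => integrable_finsetSum _ fun j' _ =>
      (integrable_eval_mul_two v _ _).const_mul _, Finset.mul_sum]
    refine Finset.sum_congr rfl fun j _ => ?_
    rw [integral_finsetSum _ fun j' _ => (integrable_eval_mul_two v _ _).const_mul _]
    simp [integral_const_mul, integral_eval_mul_two, he.eq_iff, hv, mul_comm]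
  -- The three Wick pairings give, in this order, the square of the trace, the squared Frobenius
  -- norm and the pairing of `B` with its transpose.
  have h2 : ∫ θ : ι → ℝ, (∑ j, ∑ j', B j j' * (θ (e j) * θ (e j'))) ^ 2 ∂(gaussPi v) =
      (c * ∑ j, B j j) ^ 2 + c ^ 2 * ∑ j, ∑ j', B j j' ^ 2 +
        c ^ 2 * ∑ j, ∑ j', B j j' * B j' j := by
    rw [integral_bilinForm_sq]
    simp only [integral_eval_mul_four, he.eq_iff, hv, mul_add, Finset.sum_add_distrib]
    congr 1
    · congr 1
      · rw [sq, Finset.mul_sum, Finset.sum_mul_sum]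
        refine Finset.sum_congr rfl fun j _ => ?_
        rw [Finset.sum_eq_single j]
        · refine Finset.sum_congr rfl fun k _ => ?_
          rw [Finset.sum_eq_single k]
          · simp; ring
          · intro b _ hb; simp [hb.symm]
          · simp
        · intro b _ hb; simp [hb.symm]
        · simp
      · rw [Finset.mul_sum]
        refine Finset.sum_congr rfl fun j _ => ?_
        rw [Finset.mul_sum]
        refine Finset.sum_congr rfl fun j' _ => ?_
        rw [Finset.sum_eq_single j, Finset.sum_eq_single j']
        · simp; ring
        · intro b _ hb; simp [hb.symm]
        · simp
        · intro b _ hb; simp [hb.symm]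
        · simp
    · rw [Finset.mul_sum]
      refine Finset.sum_congr rfl fun j _ => ?_
      rw [Finset.mul_sum]
      refine Finset.sum_congr rfl fun j' _ => ?_
      rw [Finset.sum_eq_single j', Finset.sum_eq_single j]
      · simp; ring
      · intro b _ hb; simp [hb.symm]
      · simp
      · intro b _ hb; simp [hb.symm]
      · simp
  -- AM-GM bounds the transpose pairing by the squared Frobenius norm, whence the factor 2 in the
  -- variance bound.
  have h3 : ∑ j, ∑ j', B j j' * B j' j ≤ ∑ j, ∑ j', B j j' ^ 2 := by
    have hs : ∑ j, ∑ j', B j' j ^ 2 = ∑ j, ∑ j', B j j' ^ 2 := Finset.sum_comm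
    have : ∑ j, ∑ j', B j j' * B j' j ≤ ∑ j, ∑ j', (B j j' ^ 2 + B j' j ^ 2) / 2 :=
      Finset.sum_le_sum fun j _ => Finset.sum_le_sum fun j' _ => by
        nlinarith [sq_nonneg (B j j' - B j' j)]
    simp only [← Finset.sum_div, Finset.sum_add_distrib, hs] at this
    linarith
  have e1 : (fun θ : ι → ℝ => (∑ j, ∑ j', B j j' * (θ (e j) * θ (e j')) - c * ∑ j, B j j) ^ 2) =
      fun θ => ((∑ j, ∑ j', B j j' * (θ (e j) * θ (e j'))) ^ 2 - 2 * (c * ∑ j, B j j) *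
        (∑ j, ∑ j', B j j' * (θ (e j) * θ (e j')))) + (c * ∑ j, B j j) ^ 2 := by
    funext θ; ring
  have i1 := integrable_bilinForm_sq v e e B
  have i2 : Integrable (fun θ : ι → ℝ => 2 * (c * ∑ j, B j j) *
      (∑ j, ∑ j', B j j' * (θ (e j) * θ (e j')))) (gaussPi v) :=
    (integrable_bilinForm v e e B).const_mul _
  rw [e1, integral_add (i1.sub' i2) (integrable_const _), integral_sub i1 i2,
    integral_const_mul, h1, h2]
  simp only [integral_const, probReal_univ, one_smul]
  nlinarith [mul_le_mul_of_nonneg_left h3 (sq_nonneg c)]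

/-- Uncorrelated families of linear forms are independent. -/
theorem indepFun_linForm {κ κ' : Type*} [Fintype κ] [Fintype κ'] (v : ι → ℝ≥0)
    (u : κ → ι → ℝ) (w : κ' → ι → ℝ) (h : ∀ a b, linCov v (u a) (w b) = 0) :
    IndepFun (fun (θ : ι → ℝ) a => ∑ p, u a p * θ p) (fun θ b => ∑ p, w b p * θ p)
      (gaussPi v) := by
  have hL := (hasGaussianLaw_gaussPi v).map_fun (((ContinuousLinearMap.pi fun a =>
        ∑ p, u a p • ContinuousLinearMap.proj (R := ℝ) (φ := fun _ : ι => ℝ) p)).prod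
      ((ContinuousLinearMap.pi fun a =>
        ∑ p, w a p • ContinuousLinearMap.proj (R := ℝ) (φ := fun _ : ι => ℝ) p)))
  have hL2 : HasGaussianLaw (fun θ : ι → ℝ => ((fun a => ∑ p, u a p * θ p),
      (fun b => ∑ p, w b p * θ p))) (gaussPi v) := by
    have e : (fun θ : ι → ℝ => ((fun a => ∑ p, u a p * θ p), (fun b => ∑ p, w b p * θ p))) =
        fun θ => (((ContinuousLinearMap.pi fun a =>
        ∑ p, u a p • ContinuousLinearMap.proj (R := ℝ) (φ := fun _ : ι => ℝ) p)).prod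
      ((ContinuousLinearMap.pi fun a =>
        ∑ p, w a p • ContinuousLinearMap.proj (R := ℝ) (φ := fun _ : ι => ℝ) p))) θ := by
      funext θ
      ext <;> simp
    rw [e]
    exact hL
  exact HasGaussianLaw.indepFun_of_covariance_eval (X := fun a (θ : ι → ℝ) => ∑ p, u a p * θ p)
    (Y := fun b (θ : ι → ℝ) => ∑ p, w b p * θ p) hL2 (fun a b => by rw [covariance_linForm, h])

/-- Second-moment law of large numbers for a function of i.i.d. Gaussian vectors. -/
theorem lintegral_average_sub_sq_le {κ : Type*} [Fintype κ] [DecidableEq κ] (v : ι → ℝ≥0)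
    (d : ℕ) (hd : 0 < d) (u : Fin d → κ → ι → ℝ) (S : Matrix κ κ ℝ)
    (hu : ∀ i i' a b, linCov v (u i a) (u i' b) = if i = i' then S a b else 0)
    (F : EuclideanSpace ℝ κ → ℝ) (hF : Measurable F) (hF2 : MemLp F 2 (multivariateGaussian 0 S)) :
    ∫⁻ θ, ENNReal.ofReal (((1 / d : ℝ) * ∑ i, F (WithLp.toLp 2 fun a => ∑ p, u i a p * θ p) -
      ∫ y, F y ∂(multivariateGaussian 0 S)) ^ 2) ∂(gaussPi v) ≤
      ENNReal.ofReal ((1 / d : ℝ) * ∫ y, F y ^ 2 ∂(multivariateGaussian 0 S)) := by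
  set H : Fin d → (ι → ℝ) → EuclideanSpace ℝ κ :=
    fun i θ => WithLp.toLp 2 fun a => ∑ p, u i a p * θ p with hH
  have hd' : (d : ℝ) ≠ 0 := by positivity
  have hHm : ∀ i, Measurable (H i) := fun i => by
    refine (WithLp.measurable_toLp 2 _).comp ?_
    exact measurable_pi_lambda _ fun a => measurable_linForm _
  have hmap : ∀ i, (gaussPi v).map (H i) = multivariateGaussian 0 S := fun i => by
    rw [map_linForm_eq_multivariateGaussian]
    congr 1
    ext a b
    simp [hu]
  have hmp : ∀ i, MeasurePreserving (H i) (gaussPi v) (multivariateGaussian 0 S) :=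
    fun i => ⟨hHm i, hmap i⟩
  have hL : ∀ i, MemLp (fun θ => F (H i θ)) 2 (gaussPi v) := fun i =>
    hF2.comp_measurePreserving (hmp i)
  have hE : ∀ i, ∫ θ, F (H i θ) ∂(gaussPi v) = ∫ y, F y ∂(multivariateGaussian 0 S) := fun i => by
    rw [← hmap i, integral_map (hHm i).aemeasurable hF.aestronglyMeasurable]
  -- Uncorrelated jointly Gaussian vectors are independent, so the variance of the sum is the sum of
  -- the variances and that of the average is O(1/d).
  have hind : Set.Pairwise (Finset.univ : Finset (Fin d)) fun i j =>
      IndepFun (fun θ => F (H i θ)) (fun θ => F (H j θ)) (gaussPi v) := by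
    intro i _ j _ hij
    have := indepFun_linForm v (u i) (u j) (fun a b => by rw [hu, if_neg hij])
    have hF' : Measurable fun y : κ → ℝ => F (WithLp.toLp 2 y) :=
      hF.comp (WithLp.measurable_toLp 2 _)
    exact this.comp hF' hF'
  have hvar := IndepFun.variance_sum (fun i _ => hL i) hind
  have hvle : Var[∑ i, fun θ => F (H i θ); gaussPi v] ≤
      d * ∫ y, F y ^ 2 ∂(multivariateGaussian 0 S) := by
    rw [hvar]
    have : ∀ i, Var[fun θ => F (H i θ); gaussPi v] ≤ ∫ y, F y ^ 2 ∂(multivariateGaussian 0 S) := by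
      intro i
      refine (variance_le_expectation_sq (hL i).aestronglyMeasurable).trans (le_of_eq ?_)
      rw [← hmap i, integral_map (hHm i).aemeasurable (hF.pow_const 2).aestronglyMeasurable]
      rfl
    calc _ ≤ ∑ i : Fin d, ∫ y, F y ^ 2 ∂(multivariateGaussian 0 S) :=
          Finset.sum_le_sum fun i _ => this i
      _ = _ := by simp
  have hsum : ∫ θ, (∑ i, fun θ => F (H i θ)) θ ∂(gaussPi v) =
      d * ∫ y, F y ∂(multivariateGaussian 0 S) := by
    simp only [Finset.sum_apply]
    rw [integral_finsetSum _ fun i _ => (hL i).integrable (by norm_num)]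
    simp [hE]
  have hLs : MemLp (∑ i, fun θ => F (H i θ)) 2 (gaussPi v) := memLp_finsetSum' _ fun i _ => hL i
  rw [variance_eq_integral hLs.aemeasurable, hsum] at hvle
  have hpt : ∀ θ, ((1 / d : ℝ) * ∑ i, F (H i θ) - ∫ y, F y ∂(multivariateGaussian 0 S)) ^ 2 =
      (1 / d : ℝ) ^ 2 * ((∑ i, fun θ => F (H i θ)) θ -
        d * ∫ y, F y ∂(multivariateGaussian 0 S)) ^ 2 := fun θ => by
    simp only [Finset.sum_apply]
    field_simp
  have hint : Integrable (fun θ => ((∑ i, fun θ => F (H i θ)) θ -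
        d * ∫ y, F y ∂(multivariateGaussian 0 S)) ^ 2) (gaussPi v) :=
    (hLs.sub (memLp_const _)).integrable_sq
  change ∫⁻ θ, ENNReal.ofReal (((1 / d : ℝ) * ∑ i, F (H i θ) -
      ∫ y, F y ∂(multivariateGaussian 0 S)) ^ 2) ∂(gaussPi v) ≤ _
  simp only [hpt]
  rw [← ofReal_integral_eq_lintegral_ofReal (hint.const_mul _) (Eventually.of_forall fun θ => by
    positivity), integral_const_mul]
  refine ENNReal.ofReal_le_ofReal ?_
  calc _ ≤ (1 / d : ℝ) ^ 2 * (d * ∫ y, F y ^ 2 ∂(multivariateGaussian 0 S)) :=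
        mul_le_mul_of_nonneg_left hvle (by positivity)
    _ = _ := by field_simp

end GaussianForms

/-! ### Calculus of random sequences that vanish or stay bounded in mean -/

section Vanish
open Topology

variable {Ω : ℕ → Type*} [∀ d, MeasurableSpace (Ω d)] {P : ∀ d, Measure (Ω d)}

/-- The positive parts of the random variables `F d` tend to `0` in mean. -/
def VanishInMean (P : ∀ d, Measure (Ω d)) (F : ∀ d, Ω d → ℝ) : Prop :=
  Tendsto (fun d => ∫⁻ ω, ENNReal.ofReal (F d ω) ∂(P d)) atTop (𝓝 0)

/-- The positive parts of the random variables `F d` have eventually bounded means. -/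
def BoundedInMean (P : ∀ d, Measure (Ω d)) (F : ∀ d, Ω d → ℝ) : Prop :=
  ∃ C : ℝ, ∀ᶠ d in atTop, ∫⁻ ω, ENNReal.ofReal (F d ω) ∂(P d) ≤ ENNReal.ofReal C

theorem VanishInMean.mono {F G : ∀ d, Ω d → ℝ} (hG : VanishInMean P G)
    (h : ∀ᶠ d in atTop, ∫⁻ ω, ENNReal.ofReal (F d ω) ∂(P d) ≤ ∫⁻ ω, ENNReal.ofReal (G d ω) ∂(P d)) :
    VanishInMean P F :=
  tendsto_of_tendsto_of_tendsto_of_le_of_le' tendsto_const_nhds hG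
    (Eventually.of_forall fun _ => zero_le) h

theorem VanishInMean.mono_of_le {F G : ∀ d, Ω d → ℝ} (hG : VanishInMean P G)
    (h : ∀ᶠ d in atTop, ∀ ω, F d ω ≤ G d ω) : VanishInMean P F :=
  hG.mono (h.mono fun _ hd => lintegral_mono fun ω => ENNReal.ofReal_le_ofReal (hd ω))

theorem VanishInMean.add {F G : ∀ d, Ω d → ℝ} (hF : VanishInMean P F) (hG : VanishInMean P G)
    (hm : ∀ d, Measurable (F d)) : VanishInMean P (fun d ω => F d ω + G d ω) := by
  have h := Tendsto.add hF hG
  rw [add_zero] at h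
  refine tendsto_of_tendsto_of_tendsto_of_le_of_le tendsto_const_nhds h (fun _ => zero_le)
    fun d => ?_
  change _ ≤ _ + _
  rw [← lintegral_add_left (hm d).ennreal_ofReal]
  exact lintegral_mono fun ω => ENNReal.ofReal_add_le

theorem VanishInMean.sum {κ : Type*} {s : Finset κ} {F : κ → ∀ d, Ω d → ℝ}
    (hF : ∀ a ∈ s, VanishInMean P (F a)) (hm : ∀ a d, Measurable (F a d)) :
    VanishInMean P (fun d ω => ∑ a ∈ s, F a d ω) := by
  classical
  induction s using Finset.induction_on with
  | empty => simp [VanishInMean]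
  | insert a s ha ih =>
    simp only [Finset.sum_insert ha]
    exact (hF a (by simp)).add (ih fun b hb => hF b (by simp [hb])) (hm a)

theorem lintegral_ofReal_const_mul {Ω : Type*} [MeasurableSpace Ω] (P : Measure Ω) {c : ℝ}
    (hc : 0 ≤ c) (F : Ω → ℝ) : ∫⁻ ω, ENNReal.ofReal (c * F ω) ∂P =
      ENNReal.ofReal c * ∫⁻ ω, ENNReal.ofReal (F ω) ∂P := by
  simp only [ENNReal.ofReal_mul hc]
  rw [lintegral_const_mul' _ _ ENNReal.ofReal_ne_top]

theorem VanishInMean.const_mul {F : ∀ d, Ω d → ℝ} (hF : VanishInMean P F) {c : ℝ} (hc : 0 ≤ c) :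
    VanishInMean P (fun d ω => c * F d ω) := by
  unfold VanishInMean
  simp only [lintegral_ofReal_const_mul _ hc]
  simpa using ENNReal.Tendsto.const_mul hF (Or.inr ENNReal.ofReal_ne_top)

theorem BoundedInMean.vanish_mul {F : ∀ d, Ω d → ℝ} (hF : BoundedInMean P F) {c : ℕ → ℝ}
    (hc : ∀ d, 0 ≤ c d) (hc0 : Tendsto c atTop (𝓝 0)) : VanishInMean P (fun d ω => c d * F d ω) := by
  obtain ⟨C, hC⟩ := hF
  unfold VanishInMean
  simp only [lintegral_ofReal_const_mul _ (hc _)]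
  have h1 : Tendsto (fun d => ENNReal.ofReal (c d) * ENNReal.ofReal C) atTop (𝓝 0) := by
    have := ENNReal.Tendsto.mul_const (b := ENNReal.ofReal C)
      ((ENNReal.continuous_ofReal.tendsto 0).comp hc0) (Or.inr ENNReal.ofReal_ne_top)
    simpa using this
  refine tendsto_of_tendsto_of_tendsto_of_le_of_le' tendsto_const_nhds h1
    (Eventually.of_forall fun _ => zero_le) (hC.mono fun d hd => ?_)
  exact mul_le_mul_right hd _

theorem BoundedInMean.mono {F G : ∀ d, Ω d → ℝ} (hG : BoundedInMean P G)
    (h : ∀ᶠ d in atTop, ∫⁻ ω, ENNReal.ofReal (F d ω) ∂(P d) ≤ ∫⁻ ω, ENNReal.ofReal (G d ω) ∂(P d)) :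
    BoundedInMean P F := by
  obtain ⟨C, hC⟩ := hG
  exact ⟨C, (h.and hC).mono fun d hd => hd.1.trans hd.2⟩

theorem BoundedInMean.add {F G : ∀ d, Ω d → ℝ} (hF : BoundedInMean P F) (hG : BoundedInMean P G)
    (hm : ∀ d, Measurable (F d)) : BoundedInMean P (fun d ω => F d ω + G d ω) := by
  obtain ⟨C, hC⟩ := hF
  obtain ⟨C', hC'⟩ := hG
  refine ⟨max C 0 + max C' 0, (hC.and hC').mono fun d hd => ?_⟩
  calc _ ≤ ∫⁻ ω, (ENNReal.ofReal (F d ω) + ENNReal.ofReal (G d ω)) ∂(P d) :=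
        lintegral_mono fun ω => ENNReal.ofReal_add_le
    _ = _ := lintegral_add_left (hm d).ennreal_ofReal _
    _ ≤ ENNReal.ofReal (max C 0) + ENNReal.ofReal (max C' 0) :=
        add_le_add (hd.1.trans (ENNReal.ofReal_le_ofReal (le_max_left _ _)))
          (hd.2.trans (ENNReal.ofReal_le_ofReal (le_max_left _ _)))
    _ = _ := (ENNReal.ofReal_add (le_max_right _ _) (le_max_right _ _)).symm

theorem BoundedInMean.const_mul {F : ∀ d, Ω d → ℝ} (hF : BoundedInMean P F) {c : ℝ} (hc : 0 ≤ c) :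
    BoundedInMean P (fun d ω => c * F d ω) := by
  obtain ⟨C, hC⟩ := hF
  refine ⟨c * C, hC.mono fun d hd => ?_⟩
  rw [lintegral_ofReal_const_mul _ hc, ENNReal.ofReal_mul hc]
  exact mul_le_mul_right hd _

theorem VanishInMean.bounded {F : ∀ d, Ω d → ℝ} (hF : VanishInMean P F) : BoundedInMean P F :=
  ⟨1, (hF.eventually (ge_mem_nhds (by simp : (0 : ENNReal) < 1))).mono fun d hd => by simpa using hd⟩

theorem boundedInMean_const [∀ d, IsProbabilityMeasure (P d)] (c : ℝ) :
    BoundedInMean P (fun _ _ => c) := ⟨c, Eventually.of_forall fun d => by simp⟩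

theorem vanishInMean_const [∀ d, IsProbabilityMeasure (P d)] {c : ℕ → ℝ}
    (hc : Tendsto c atTop (𝓝 0)) : VanishInMean P (fun d _ => c d) := by
  have := (ENNReal.continuous_ofReal.tendsto 0).comp hc
  simpa [VanishInMean, Function.comp_def] using this

theorem VanishInMean.eventually_measure_le {F : ∀ d, Ω d → ℝ} (hF : VanishInMean P F)
    (hm : ∀ d, Measurable (F d)) {ε δ : ℝ} (hε : 0 < ε) (hδ : 0 < δ) :
    ∀ᶠ d in atTop, P d {ω | ε ≤ F d ω} ≤ ENNReal.ofReal δ := by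
  have h := hF.eventually (ge_mem_nhds (ENNReal.ofReal_pos.2 (mul_pos hε hδ)))
  refine h.mono fun d hd => ?_
  have h1 := meas_ge_le_lintegral_div (μ := P d) (hm d).ennreal_ofReal.aemeasurable
    (ENNReal.ofReal_pos.2 hε).ne' ENNReal.ofReal_ne_top
  calc P d {ω | ε ≤ F d ω} ≤ P d {ω | ENNReal.ofReal ε ≤ ENNReal.ofReal (F d ω)} :=
        measure_mono fun ω hω => ENNReal.ofReal_le_ofReal hω
    _ ≤ _ := h1
    _ ≤ ENNReal.ofReal (ε * δ) / ENNReal.ofReal ε := ENNReal.div_le_div_right hd _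
    _ = ENNReal.ofReal δ := by
        rw [← ENNReal.ofReal_div_of_pos hε, mul_div_cancel_left₀ _ hε.ne']

theorem BoundedInMean.exists_measure_le {F : ∀ d, Ω d → ℝ} (hF : BoundedInMean P F)
    (hm : ∀ d, Measurable (F d)) {δ : ℝ} (hδ : 0 < δ) :
    ∃ B₀ : ℝ, ∀ B ≥ B₀, ∀ᶠ d in atTop, P d {ω | B ≤ F d ω} ≤ ENNReal.ofReal δ := by
  obtain ⟨C, hC⟩ := hF
  refine ⟨max C 1 / δ, fun B hB => hC.mono fun d hd => ?_⟩
  have hB0 : 0 < B := lt_of_lt_of_le (by positivity) hB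
  have h1 := meas_ge_le_lintegral_div (μ := P d) (hm d).ennreal_ofReal.aemeasurable
    (ENNReal.ofReal_pos.2 hB0).ne' ENNReal.ofReal_ne_top
  calc P d {ω | B ≤ F d ω} ≤ P d {ω | ENNReal.ofReal B ≤ ENNReal.ofReal (F d ω)} :=
        measure_mono fun ω hω => ENNReal.ofReal_le_ofReal hω
    _ ≤ _ := h1
    _ ≤ ENNReal.ofReal (max C 1) / ENNReal.ofReal B := ENNReal.div_le_div_right
        (hd.trans (ENNReal.ofReal_le_ofReal (le_max_left _ _))) _
    _ ≤ ENNReal.ofReal δ := by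
        rw [← ENNReal.ofReal_div_of_pos hB0]
        refine ENNReal.ofReal_le_ofReal ?_
        rw [ge_iff_le, div_le_iff₀ hδ] at hB
        rw [div_le_iff₀ hB0]; linarith

end Vanish

/-! ### Conditioning on all layers but one by resampling that layer -/

section Resampling

/-- It suffices to test boxes: the preimage of a box is a product of two boxes, and each coordinate
is constrained in exactly one of the two factors. -/
theorem measurePreserving_ite_pi {ι : Type*} [Fintype ι] (μ : ι → Measure ℝ)
    [∀ p, IsProbabilityMeasure (μ p)] (S : ι → Prop) [DecidablePred S] :
    MeasurePreserving (fun z : (ι → ℝ) × (ι → ℝ) => fun p => if S p then z.2 p else z.1 p)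
      ((Measure.pi μ).prod (Measure.pi μ)) (Measure.pi μ) := by
  have hmeas : Measurable (fun z : (ι → ℝ) × (ι → ℝ) => fun p => if S p then z.2 p else z.1 p) := by
    refine measurable_pi_lambda _ fun p => ?_
    by_cases h : S p <;> simp only [h, if_true, if_false] <;> fun_prop
  refine ⟨hmeas, (Measure.pi_eq fun s hs => ?_).symm⟩
  rw [Measure.map_apply hmeas (MeasurableSet.univ_pi hs)]
  have : (fun z : (ι → ℝ) × (ι → ℝ) => fun p => if S p then z.2 p else z.1 p) ⁻¹' Set.univ.pi s =
      (Set.univ.pi fun p => if S p then Set.univ else s p) ×ˢ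
      (Set.univ.pi fun p => if S p then s p else Set.univ) := by
    ext z
    simp only [Set.mem_preimage, Set.mem_univ_pi, Set.mem_prod]
    rw [← forall_and]
    refine forall_congr' fun p => ?_
    by_cases h : S p <;> simp [h]
  rw [this, Measure.prod_prod, Measure.pi_pi, Measure.pi_pi, ← Finset.prod_mul_distrib]
  refine Finset.prod_congr rfl fun p _ => ?_
  by_cases h : S p <;> simp [h]

variable {d₀ m d : ℕ}

/-- The parameters `θ`, with those of layer `l` replaced by those of `θ'`. -/
def resample (l : ℕ) (θ θ' : Params d₀ m d) : Params d₀ m d :=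
  fun p => if layer p = l then θ' p else θ p

/-- Weights and weight terms, with those of layer `l` replaced. -/
def resamplePair (l : ℕ) (ω ω' : Params d₀ m d × Params d₀ m d) : Params d₀ m d × Params d₀ m d :=
  (resample l ω.1 ω'.1, resample l ω.2 ω'.2)

instance (σw : ℝ) (d₀ m d : ℕ) : IsProbabilityMeasure (initLaw σw d₀ m d) := by
  unfold initLaw; infer_instance

instance (ρ : ℕ → Measure ℝ) [∀ l, IsProbabilityMeasure (ρ l)] (d₀ m d : ℕ) :
    IsProbabilityMeasure (rateLaw ρ d₀ m d) := by
  unfold rateLaw; infer_instance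

instance (σw : ℝ) (ρ : ℕ → Measure ℝ) [∀ l, IsProbabilityMeasure (ρ l)] (d₀ m d : ℕ) :
    IsProbabilityMeasure (jointLaw σw ρ d₀ m d) := by
  unfold jointLaw; infer_instance

instance (ρ : ℕ → Measure ℝ) [∀ l, IsProbabilityMeasure (ρ l)] (d₀ m d : ℕ) :
    SFinite (rateLaw ρ d₀ m d) := by
  have : IsProbabilityMeasure (rateLaw ρ d₀ m d) := inferInstance
  infer_instance

instance (σw : ℝ) (ρ : ℕ → Measure ℝ) [∀ l, IsProbabilityMeasure (ρ l)] (d₀ m d : ℕ) :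
    SFinite (jointLaw σw ρ d₀ m d) := by
  have : IsProbabilityMeasure (jointLaw σw ρ d₀ m d) := inferInstance
  infer_instance

variable (σw : ℝ) (ρ : ℕ → Measure ℝ) [∀ l, IsProbabilityMeasure (ρ l)]

theorem measurePreserving_resamplePair (l : ℕ) :
    MeasurePreserving (fun z : (Params d₀ m d × Params d₀ m d) × (Params d₀ m d × Params d₀ m d) =>
      resamplePair l z.1 z.2)
      ((jointLaw σw ρ d₀ m d).prod (jointLaw σw ρ d₀ m d)) (jointLaw σw ρ d₀ m d) := by
  have h1 : MeasurePreserving (fun z : Params d₀ m d × Params d₀ m d => resample l z.1 z.2)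
      ((initLaw σw d₀ m d).prod (initLaw σw d₀ m d)) (initLaw σw d₀ m d) :=
    measurePreserving_ite_pi _ fun p => layer p = l
  have h2 : MeasurePreserving (fun z : Params d₀ m d × Params d₀ m d => resample l z.1 z.2)
      ((rateLaw ρ d₀ m d).prod (rateLaw ρ d₀ m d)) (rateLaw ρ d₀ m d) :=
    measurePreserving_ite_pi _ fun p => layer p = l
  have h3 := h1.prod h2
  -- The four factors are regrouped: two copies of (weights, weight terms) become a pair of weight
  -- vectors and a pair of vectors of weight terms.
  have h4 : MeasurePreserving
      (fun z : (Params d₀ m d × Params d₀ m d) × (Params d₀ m d × Params d₀ m d) =>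
        ((z.1.1, z.2.1), (z.1.2, z.2.2)))
      ((jointLaw σw ρ d₀ m d).prod (jointLaw σw ρ d₀ m d))
      (((initLaw σw d₀ m d).prod (initLaw σw d₀ m d)).prod
        ((rateLaw ρ d₀ m d).prod (rateLaw ρ d₀ m d))) := by
    set α := initLaw σw d₀ m d
    set β := rateLaw ρ d₀ m d
    have a1 := measurePreserving_prodAssoc α β (α.prod β)
    have a2 := (MeasurePreserving.id α).prod
      (MeasurePreserving.symm _ (measurePreserving_prodAssoc β α β))
    have a3 := (MeasurePreserving.id α).prod
      ((Measure.measurePreserving_swap (μ := β) (ν := α)).prod (MeasurePreserving.id β))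
    have a4 := (MeasurePreserving.id α).prod (measurePreserving_prodAssoc α β β)
    have a5 := MeasurePreserving.symm _ (measurePreserving_prodAssoc α α (β.prod β))
    exact a5.comp (a4.comp (a3.comp (a2.comp a1)))
  exact h3.comp h4

/-- This replaces conditional expectations: with `ω` frozen outside layer `l`, only an integral over
a fresh copy of that layer has to be estimated, and the estimate may depend on `ω`. -/
theorem lintegral_le_of_resample (l : ℕ) {F G : Params d₀ m d × Params d₀ m d → ℝ}
    (hF : Measurable F)
    (h : ∀ ω, ∫⁻ ω', ENNReal.ofReal (F (resamplePair l ω ω')) ∂(jointLaw σw ρ d₀ m d) ≤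
      ENNReal.ofReal (G ω)) :
    ∫⁻ ω, ENNReal.ofReal (F ω) ∂(jointLaw σw ρ d₀ m d) ≤
      ∫⁻ ω, ENNReal.ofReal (G ω) ∂(jointLaw σw ρ d₀ m d) := by
  have hmp := measurePreserving_resamplePair (d₀ := d₀) (m := m) (d := d) σw ρ l
  rw [← hmp.lintegral_comp hF.ennreal_ofReal, lintegral_prod
    (fun z : (Params d₀ m d × Params d₀ m d) × (Params d₀ m d × Params d₀ m d) =>
      ENNReal.ofReal (F (resamplePair l z.1 z.2)))
    (hF.ennreal_ofReal.comp hmp.measurable).aemeasurable]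
  exact lintegral_mono h

theorem lintegral_fst_jointLaw {g : Params d₀ m d → ENNReal} (hg : Measurable g) :
    ∫⁻ ω, g ω.1 ∂(jointLaw σw ρ d₀ m d) = ∫⁻ θ, g θ ∂(initLaw σw d₀ m d) :=
  (measurePreserving_fst (μ := initLaw σw d₀ m d) (ν := rateLaw ρ d₀ m d)).lintegral_comp hg

theorem lintegral_snd_jointLaw {g : Params d₀ m d → ENNReal} (hg : Measurable g) :
    ∫⁻ ω, g ω.2 ∂(jointLaw σw ρ d₀ m d) = ∫⁻ θ, g θ ∂(rateLaw ρ d₀ m d) :=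
  (measurePreserving_snd (μ := initLaw σw d₀ m d) (ν := rateLaw ρ d₀ m d)).lintegral_comp hg

end Resampling

/-! ### Layerwise recursions for the pre-activations and the tangent kernel -/

section Forward

variable {d₀ m d : ℕ}

/-- The index of the weight from neuron `j` of hidden layer `k + 1` to neuron `i` of layer `k + 2`.
For `k = m` the next layer is the scalar output, and `i` is ignored. -/
def pidx (k : ℕ) (j i : Fin d) : ParamIdx d₀ m d :=
  if h : k < m then Sum.inr (Sum.inl (⟨k, h⟩, j, i)) else Sum.inr (Sum.inr j)

theorem layer_pidx {k : ℕ} (hk : k ≤ m) (j i : Fin d) :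
    layer (pidx k j i : ParamIdx d₀ m d) = k + 2 := by
  unfold pidx
  split_ifs with h
  · rfl
  · have : k = m := le_antisymm hk (not_lt.1 h)
    simp [layer, this]

theorem fanIn_pidx (k : ℕ) (j i : Fin d) : fanIn (pidx k j i : ParamIdx d₀ m d) = d := by
  unfold pidx
  split_ifs with h <;> rfl

theorem pidx_injective (k : ℕ) (i : Fin d) :
    Function.Injective fun j => (pidx k j i : ParamIdx d₀ m d) := by
  intro j j' h
  simp only [pidx] at h
  split_ifs at h <;> simpa using h

theorem pidx_ne {k : ℕ} (hk : k < m) {i i' : Fin d} (hi : i ≠ i') (j j' : Fin d) :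
    (pidx k j i : ParamIdx d₀ m d) ≠ pidx k j' i' := by
  simp only [pidx, hk, dif_pos]
  intro h
  simp only [Sum.inr.injEq, Sum.inl.injEq, Prod.mk.injEq] at h
  exact hi h.2.2

/-- Pre-activations of all layers; the output of the network is layer `m + 1` of this recursion. -/
def hid (σ : ℝ → ℝ) (θ : Params d₀ m d) (x : EuclideanSpace ℝ (Fin d₀)) : ℕ → Fin d → ℝ
  | 0 => fun i => ∑ j, x j * θ (Sum.inl (j, i))
  | k + 1 => fun i => ∑ j, σ (hid σ θ x k j) * θ (pidx k j i)

theorem preact_eq_hid (σ : ℝ → ℝ) (θ : Params d₀ m d) (x : EuclideanSpace ℝ (Fin d₀)) (k : ℕ)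
    (hk : k ≤ m) : preact σ θ x k hk = hid σ θ x k := by
  induction k with
  | zero => rfl
  | succ k ih =>
    funext i
    have : k < m := hk
    simp only [preact, hid, ih (Nat.le_of_succ_le hk), pidx, this, dif_pos]

theorem net_eq_hid (σ : ℝ → ℝ) (θ : Params d₀ m d) (x : EuclideanSpace ℝ (Fin d₀)) (i : Fin d) :
    net σ θ x = hid σ θ x (m + 1) i := by
  simp [net, hid, preact_eq_hid, pidx]

theorem hid_congr (σ : ℝ → ℝ) (x : EuclideanSpace ℝ (Fin d₀)) {θ θ' : Params d₀ m d} (k : ℕ)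
    (hk : k ≤ m + 1) (h : ∀ p, layer p ≤ k + 1 → θ p = θ' p) : hid σ θ x k = hid σ θ' x k := by
  induction k with
  | zero =>
    funext i
    exact Finset.sum_congr rfl fun j _ => by rw [h _ le_rfl]
  | succ k ih =>
    funext i
    simp only [hid, ih (by omega) fun p hp => h p (by omega)]
    exact Finset.sum_congr rfl fun j _ => by rw [h _ (by rw [layer_pidx (by omega)])]

/-- Indices are shifted twice: `hid` at `k` is layer `k + 1`, and the weights leaving it, `pidx k`,
belong to layer `k + 2`. Resampling layer `k + 2` refreshes these weights and nothing before them.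
-/
theorem hid_resample (σ : ℝ → ℝ) (x : EuclideanSpace ℝ (Fin d₀)) (θ θ' : Params d₀ m d) (k : ℕ)
    (hk : k ≤ m + 1) : hid σ (resample (k + 2) θ θ') x k = hid σ θ x k :=
  hid_congr σ x k hk fun p hp => by
    simp only [resample]
    rw [if_neg (by omega)]

theorem resample_pidx {k : ℕ} (hk : k ≤ m) (θ θ' : Params d₀ m d) (j i : Fin d) :
    resample (k + 2) θ θ' (pidx k j i) = θ' (pidx k j i) := by
  simp [resample, layer_pidx hk]

theorem continuous_hid {σ : ℝ → ℝ} (hσ : Continuous σ) (x : EuclideanSpace ℝ (Fin d₀)) (k : ℕ)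
    (i : Fin d) : Continuous fun θ : Params d₀ m d => hid σ θ x k i := by
  induction k generalizing i with
  | zero => simp only [hid]; fun_prop
  | succ k ih =>
    simp only [hid]
    exact continuous_finsetSum _ fun j _ => (hσ.comp (ih j)).mul (continuous_apply _)

/-- The weighted neural tangent kernel of the pre-activations of a layer, between the neurons `i`
at `x` and `i'` at `x'`, normalized by `1/d`. -/
def wker (σ : ℝ → ℝ) (ω : Params d₀ m d × Params d₀ m d) (x x' : EuclideanSpace ℝ (Fin d₀)) :
    ℕ → Fin d → Fin d → ℝ
  | 0 => fun i i' => if i = i' then (1 / d : ℝ) * ∑ j, ω.2 (Sum.inl (j, i)) * (x j * x' j) else 0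
  | k + 1 => fun i i' =>
      ∑ j, ∑ j', (deriv σ (hid σ ω.1 x k j) * deriv σ (hid σ ω.1 x' k j') *
          wker σ ω x x' k j j') * (ω.1 (pidx k j i) * ω.1 (pidx k j' i')) +
        if i = i' then (1 / d : ℝ) *
          ∑ j, ω.2 (pidx k j i) * (σ (hid σ ω.1 x k j) * σ (hid σ ω.1 x' k j)) else 0

theorem wker_congr (σ : ℝ → ℝ) (x x' : EuclideanSpace ℝ (Fin d₀))
    {ω ω' : Params d₀ m d × Params d₀ m d} (k : ℕ) (hk : k ≤ m + 1)
    (h : ∀ p, layer p ≤ k + 1 → ω.1 p = ω'.1 p) (h' : ∀ p, layer p ≤ k + 1 → ω.2 p = ω'.2 p) :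
    wker σ ω x x' k = wker σ ω' x x' k := by
  induction k with
  | zero =>
    funext i i'
    simp only [wker]
    refine if_congr Iff.rfl ?_ rfl
    congr 1
    exact Finset.sum_congr rfl fun j _ => by rw [h' _ le_rfl]
  | succ k ih =>
    funext i i'
    have hx := hid_congr σ x (θ := ω.1) (θ' := ω'.1) k (by omega) fun p hp => h p (by omega)
    have hx' := hid_congr σ x' (θ := ω.1) (θ' := ω'.1) k (by omega) fun p hp => h p (by omega)
    have hl : ∀ j i, layer (pidx k j i : ParamIdx d₀ m d) ≤ k + 1 + 1 := fun j i => by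
      rw [layer_pidx (by omega)]
    simp only [wker, hx, hx', ih (by omega) (fun p hp => h p (by omega))
      (fun p hp => h' p (by omega)), h _ (hl _ _), h' _ (hl _ _)]

theorem wker_resamplePair (σ : ℝ → ℝ) (x x' : EuclideanSpace ℝ (Fin d₀))
    (ω ω' : Params d₀ m d × Params d₀ m d) (k : ℕ) (hk : k ≤ m + 1) :
    wker σ (resamplePair (k + 2) ω ω') x x' k = wker σ ω x x' k :=
  wker_congr σ x x' k hk
    (fun p hp => by simp only [resamplePair, resample]; rw [if_neg (by omega)])
    (fun p hp => by simp only [resamplePair, resample]; rw [if_neg (by omega)])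

theorem continuous_wker {σ : ℝ → ℝ} (hσ : Continuous σ) (hσ' : Continuous (deriv σ))
    (x x' : EuclideanSpace ℝ (Fin d₀)) (k : ℕ) (i i' : Fin d) :
    Continuous fun ω : Params d₀ m d × Params d₀ m d => wker σ ω x x' k i i' := by
  have hh : ∀ x k j, Continuous fun ω : Params d₀ m d × Params d₀ m d => hid σ ω.1 x k j :=
    fun x k j => (continuous_hid hσ x k j).comp continuous_fst
  induction k generalizing i i' with
  | zero =>
    simp only [wker]
    split_ifs <;> fun_prop
  | succ k ih =>
    simp only [wker]
    refine Continuous.add (continuous_finsetSum _ fun j _ => continuous_finsetSum _ fun j' _ =>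
      (((hσ'.comp (hh x k j)).mul (hσ'.comp (hh x' k j'))).mul (ih j j')).mul (by fun_prop)) ?_
    split_ifs
    · exact continuous_const.mul (continuous_finsetSum _ fun j _ =>
        Continuous.mul (by fun_prop) ((hσ.comp (hh x k j)).mul (hσ.comp (hh x' k j))))
    · exact continuous_const

end Forward

/-! ### Covariances of linear forms in the weights of one neuron -/

section Conditional

variable {d₀ m d : ℕ} (σw : ℝ)

/-- The variances of the weights at initialization. -/
abbrev initVar (d₀ m d : ℕ) (p : ParamIdx d₀ m d) : NNReal :=
  Real.toNNReal (σw ^ 2 / (fanIn p : ℝ))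

theorem initLaw_eq : initLaw σw d₀ m d = gaussPi (initVar σw d₀ m d) := rfl

theorem coe_initVar_pidx (k : ℕ) (j i : Fin d) :
    (initVar σw d₀ m d (pidx k j i) : ℝ) = σw ^ 2 / d := by
  rw [initVar, fanIn_pidx, Real.coe_toNNReal _ (by positivity)]

/-- The coefficients of the linear form `∑ j, c j * θ (e j)`. -/
def pushCoeff {β ι : Type*} [Fintype β] [DecidableEq ι] (e : β → ι) (c : β → ℝ) (p : ι) : ℝ :=
  ∑ j, if e j = p then c j else 0

theorem sum_pushCoeff {β ι : Type*} [Fintype β] [Fintype ι] [DecidableEq ι] (e : β → ι)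
    (c : β → ℝ) (θ : ι → ℝ) : ∑ p, pushCoeff e c p * θ p = ∑ j, c j * θ (e j) := by
  simp only [pushCoeff, Finset.sum_mul, ite_mul, zero_mul]
  rw [Finset.sum_comm]
  simp

theorem linCov_pushCoeff {β β' ι : Type*} [Fintype β] [Fintype β'] [Fintype ι] [DecidableEq ι]
    (v : ι → NNReal) (e : β → ι) (e' : β' → ι) (c : β → ℝ) (c' : β' → ℝ) :
    linCov v (pushCoeff e c) (pushCoeff e' c') =
      ∑ j, ∑ j', if e j = e' j' then c j * c' j' * v (e j) else 0 := by
  have : linCov v (pushCoeff e c) (pushCoeff e' c') =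
      ∑ p, pushCoeff e c p * (pushCoeff e' c' p * v p) := by
    simp only [linCov, mul_assoc]
  rw [this, sum_pushCoeff]
  refine Finset.sum_congr rfl fun j _ => ?_
  simp only [pushCoeff, Finset.sum_mul, Finset.mul_sum]
  refine Finset.sum_congr rfl fun j' _ => ?_
  simp only [eq_comm (a := e' j')]
  split_ifs <;> ring

theorem linCov_pushCoeff_self {β ι : Type*} [Fintype β] [Fintype ι] [DecidableEq ι]
    (v : ι → NNReal) {e : β → ι} (he : Function.Injective e) (c c' : β → ℝ) {s : ℝ}
    (hv : ∀ j, (v (e j) : ℝ) = s) :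
    linCov v (pushCoeff e c) (pushCoeff e c') = s * ∑ j, c j * c' j := by
  classical
  rw [linCov_pushCoeff, Finset.mul_sum]
  refine Finset.sum_congr rfl fun j _ => ?_
  simp [he.eq_iff, hv, mul_comm]

theorem linCov_pushCoeff_disjoint {β β' ι : Type*} [Fintype β] [Fintype β'] [Fintype ι]
    [DecidableEq ι] (v : ι → NNReal) {e : β → ι} {e' : β' → ι} (he : ∀ j j', e j ≠ e' j')
    (c : β → ℝ) (c' : β' → ℝ) : linCov v (pushCoeff e c) (pushCoeff e' c') = 0 := by
  simp [linCov_pushCoeff, he]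

end Conditional

/-! ### Gaussian expectations as functions of the covariance matrix -/

section GaussExp
open Topology
open scoped MatrixOrder

variable {n : ℕ}

-- A Gaussian vector of covariance `S` is the square root of `S` applied to a standard one.
-- Continuity up to the boundary of the cone is needed because `limitCov` may be singular.
open scoped Matrix.Norms.L2Operator in
theorem continuousOn_matrix_sqrt :
    ContinuousOn (CFC.sqrt : Matrix (Fin n) (Fin n) ℝ → Matrix (Fin n) (Fin n) ℝ)
      {S | S.PosSemidef} :=
  (CFC.continuousOn_sqrt (A := Matrix (Fin n) (Fin n) ℝ)).mono fun _ hS => hS.nonneg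

theorem memLp_coord_of_isGaussian (μ : Measure (EuclideanSpace ℝ (Fin n))) [IsGaussian μ] (a : Fin n)
    (r : ENNReal) (hr : r ≠ ⊤) : MemLp (fun y : EuclideanSpace ℝ (Fin n) => y a) r μ := by
  have h := (IsGaussian.hasGaussianLaw_id (μ := μ)).map_fun (EuclideanSpace.proj (𝕜 := ℝ) a)
  simpa using h.memLp hr

theorem memLp_affine_sum_abs {E κ : Type*} [Fintype κ] [MeasurableSpace E] (μ : Measure E)
    [IsProbabilityMeasure μ] (f : κ → E → ℝ) (C M : ℝ) (h : ∀ k, MemLp (f k) 2 μ) :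
    MemLp (fun z => C * (1 + M * ∑ k, |f k z|)) 2 μ := by
  have h2 : MemLp (fun z => ∑ k, |f k z|) 2 μ :=
    memLp_finsetSum (f := fun k z => |f k z|) _ fun k _ => (h k).norm
  have h3 : MemLp (fun z => 1 + M * ∑ k, |f k z|) 2 μ :=
    (memLp_const (1 : ℝ)).add (h2.const_mul M)
  exact h3.const_mul C

theorem abs_mul_le_of_growth {φ : ℝ → ℝ} {C : ℝ} (hC : ∀ z, |φ z| ≤ C * (1 + |z|)) (y z : ℝ) :
    |φ y * φ z| ≤ C ^ 2 * (1 + |y|) * (1 + |z|) := by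
  rw [abs_mul]
  calc |φ y| * |φ z| ≤ (C * (1 + |y|)) * (C * (1 + |z|)) :=
        mul_le_mul (hC y) (hC z) (abs_nonneg _) ((abs_nonneg _).trans (hC y))
    _ = _ := by ring

theorem sq_mul_le_of_growth {φ : ℝ → ℝ} {C : ℝ} (hC : ∀ z, |φ z| ≤ C * (1 + |z|)) (y z : ℝ) :
    (φ y * φ z) ^ 2 ≤ C ^ 4 * (4 * (2 + y ^ 4 + z ^ 4)) := by
  have h := abs_mul_le_of_growth hC y z
  have h1 : (φ y * φ z) ^ 2 ≤ (C ^ 2 * (1 + |y|) * (1 + |z|)) ^ 2 := by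
    rw [← sq_abs]; exact pow_le_pow_left₀ (abs_nonneg _) h 2
  have key : ∀ a b : ℝ, 0 ≤ a → 0 ≤ b → ((1 + a) * (1 + b)) ^ 2 ≤ 4 * (2 + a ^ 4 + b ^ 4) := by
    intro a b ha hb
    have q : ∀ a : ℝ, 0 ≤ a → ((1 + a) ^ 2) ^ 2 ≤ 8 * (1 + a ^ 4) := fun a _ => by
      nlinarith [sq_nonneg (a - 1), sq_nonneg (a ^ 2 - 1), sq_nonneg (a ^ 2 - a), sq_nonneg (a + 1)]
    nlinarith [q a ha, q b hb, sq_nonneg ((1 + a) ^ 2 - (1 + b) ^ 2)]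
  have h2 := key |y| |z| (abs_nonneg _) (abs_nonneg _)
  have e : ∀ y : ℝ, |y| ^ 4 = y ^ 4 := fun y => by
    rw [show |y| ^ 4 = (|y| ^ 2) ^ 2 by ring, sq_abs]; ring
  rw [e, e] at h2
  calc _ ≤ _ := h1
    _ = C ^ 4 * ((1 + |y|) * (1 + |z|)) ^ 2 := by ring
    _ ≤ _ := by gcongr

theorem integral_coord_pow_four {S : Matrix (Fin n) (Fin n) ℝ} (hS : S.PosSemidef) (a : Fin n) :
    ∫ y, (y a) ^ 4 ∂(multivariateGaussian 0 S) = 3 * S a a ^ 2 := by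
  have h := measurePreserving_eval_multivariateGaussian (μ := 0) hS (i := a)
  have h2 := integral_map (μ := multivariateGaussian 0 S) (φ := fun y : EuclideanSpace ℝ (Fin n) => y a)
    (f := fun x : ℝ => x ^ 4) (by fun_prop) (by fun_prop)
  rw [← h2, h.map_eq]
  have : 0 ≤ S a a := hS.diag_nonneg
  rw [PiLp.zero_apply, integral_pow_four_gaussianReal, Real.coe_toNNReal _ this]

theorem integrable_coord_pow_four (S : Matrix (Fin n) (Fin n) ℝ) (a : Fin n) :
    Integrable (fun y : EuclideanSpace ℝ (Fin n) => (y a) ^ 4) (multivariateGaussian 0 S) := by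
  have h := (memLp_coord_of_isGaussian (multivariateGaussian 0 S) a 4 (by simp))
  have := h.integrable_norm_pow (p := 4) (by norm_num)
  refine this.mono' (by fun_prop) (Eventually.of_forall fun y => ?_)
  simp

theorem memLp_growth_mul {φ : ℝ → ℝ} (hφ : Measurable φ) {C : ℝ} (hC : ∀ z, |φ z| ≤ C * (1 + |z|))
    (S : Matrix (Fin n) (Fin n) ℝ) (a b : Fin n) :
    MemLp (fun y : EuclideanSpace ℝ (Fin n) => φ (y a) * φ (y b)) 2 (multivariateGaussian 0 S) := by
  have hm : Measurable (fun y : EuclideanSpace ℝ (Fin n) => φ (y a) * φ (y b)) :=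
    (hφ.comp (by fun_prop)).mul (hφ.comp (by fun_prop))
  rw [memLp_two_iff_integrable_sq hm.aestronglyMeasurable]
  have : Integrable (fun y : EuclideanSpace ℝ (Fin n) => C ^ 4 * (4 * (2 + (y a) ^ 4 + (y b) ^ 4)))
      (multivariateGaussian 0 S) :=
    ((((integrable_const _).add (integrable_coord_pow_four S a)).add
      (integrable_coord_pow_four S b)).const_mul _).const_mul _
  refine this.mono' (hm.pow_const 2).aestronglyMeasurable (Eventually.of_forall fun y => ?_)
  rw [Real.norm_of_nonneg (sq_nonneg _)]
  exact sq_mul_le_of_growth hC _ _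

/-- Linear growth bounds the squared product by fourth powers, whose Gaussian moments are multiples
of squared variances. A bound quadratic in `S` is what mean-square control of the empirical
covariance can absorb. -/
theorem integral_growth_mul_sq_le {φ : ℝ → ℝ} (hφ : Measurable φ) {C : ℝ}
    (hC : ∀ z, |φ z| ≤ C * (1 + |z|)) {S : Matrix (Fin n) (Fin n) ℝ} (hS : S.PosSemidef)
    (a b : Fin n) : ∫ y, (φ (y a) * φ (y b)) ^ 2 ∂(multivariateGaussian 0 S) ≤
      C ^ 4 * (4 * (2 + 3 * S a a ^ 2 + 3 * S b b ^ 2)) := by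
  have i1 : Integrable (fun y : EuclideanSpace ℝ (Fin n) => (2 : ℝ) + (y a) ^ 4)
      (multivariateGaussian 0 S) := (integrable_const _).add (integrable_coord_pow_four S a)
  calc _ ≤ ∫ y, C ^ 4 * (4 * (2 + (y a) ^ 4 + (y b) ^ 4)) ∂(multivariateGaussian 0 S) := by
        refine integral_mono (memLp_growth_mul hφ hC S a b).integrable_sq ?_
          fun y => sq_mul_le_of_growth hC _ _
        exact ((i1.add (integrable_coord_pow_four S b)).const_mul _).const_mul _
    _ = _ := by
        rw [integral_const_mul, integral_const_mul, integral_add i1 (integrable_coord_pow_four S b),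
          integral_add (integrable_const _) (integrable_coord_pow_four S a),
          integral_coord_pow_four hS, integral_coord_pow_four hS]
        simp

theorem gaussExp_sq_le {φ : ℝ → ℝ} (hφ : Measurable φ) {C : ℝ}
    (hC : ∀ z, |φ z| ≤ C * (1 + |z|)) {S : Matrix (Fin n) (Fin n) ℝ} (hS : S.PosSemidef)
    (a b : Fin n) : gaussExp φ S a b ^ 2 ≤ C ^ 4 * (4 * (2 + 3 * S a a ^ 2 + 3 * S b b ^ 2)) := by
  refine le_trans ?_ (integral_growth_mul_sq_le hφ hC hS a b)
  have h := variance_nonneg (fun y : EuclideanSpace ℝ (Fin n) => φ (y a) * φ (y b))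
    (multivariateGaussian 0 S)
  rw [variance_eq_sub (memLp_growth_mul hφ hC S a b)] at h
  simp only [gaussExp, Matrix.of_apply]
  simpa using h

theorem gaussExp_eq_integral_std {φ : ℝ → ℝ} (hφ : Measurable φ) (S : Matrix (Fin n) (Fin n) ℝ)
    (a b : Fin n) : gaussExp φ S a b = ∫ z : EuclideanSpace ℝ (Fin n),
      φ (∑ k, CFC.sqrt S a k * z k) * φ (∑ k, CFC.sqrt S b k * z k)
        ∂(stdGaussian (EuclideanSpace ℝ (Fin n))) := by
  have hm : Measurable (fun y : EuclideanSpace ℝ (Fin n) => φ (y a) * φ (y b)) :=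
    (hφ.comp (by fun_prop)).mul (hφ.comp (by fun_prop))
  simp only [gaussExp, Matrix.of_apply, multivariateGaussian]
  rw [integral_map (by fun_prop) hm.aestronglyMeasurable]
  simp [Matrix.mulVec, dotProduct]

/-- Dominated convergence under the fixed standard Gaussian: near `S` all entries of the square root
stay below some `M`, which gives an integrable quadratic majorant. -/
theorem continuousWithinAt_gaussExp {φ : ℝ → ℝ} (hφ : Continuous φ) {C : ℝ}
    (hC : ∀ z, |φ z| ≤ C * (1 + |z|)) {S : Matrix (Fin n) (Fin n) ℝ} (hS : S.PosSemidef)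
    (a b : Fin n) : ContinuousWithinAt (fun S' => gaussExp φ S' a b) {S' | S'.PosSemidef} S := by
  simp only [gaussExp_eq_integral_std hφ.measurable]
  have hsq : ContinuousWithinAt (CFC.sqrt : Matrix (Fin n) (Fin n) ℝ → _) {S' | S'.PosSemidef} S :=
    continuousOn_matrix_sqrt S hS
  have hent : ∀ i k, ContinuousWithinAt
      (fun S' : Matrix (Fin n) (Fin n) ℝ => CFC.sqrt S' i k) {S' | S'.PosSemidef} S := fun i k =>
    (continuous_apply_apply i k : Continuous fun A : Matrix (Fin n) (Fin n) ℝ =>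
      A i k).continuousAt.comp_continuousWithinAt hsq
  have hbd : ∀ A : Matrix (Fin n) (Fin n) ℝ, ∃ M : ℝ, ∀ i k, |A i k| < M := fun A => by
    refine ⟨1 + ∑ i, ∑ k, |A i k|, fun i k => ?_⟩
    have h1 : |A i k| ≤ ∑ k, |A i k| :=
      Finset.single_le_sum (f := fun k => |A i k|) (fun k _ => abs_nonneg _) (Finset.mem_univ k)
    have h2 : ∑ k, |A i k| ≤ ∑ i, ∑ k, |A i k| :=
      Finset.single_le_sum (f := fun i => ∑ k, |A i k|)
        (fun i _ => Finset.sum_nonneg fun k _ => abs_nonneg _) (Finset.mem_univ i)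
    linarith
  obtain ⟨M, hM⟩ := hbd (CFC.sqrt S)
  have hb : ∀ᶠ S' : Matrix (Fin n) (Fin n) ℝ in 𝓝[{S' | S'.PosSemidef}] S,
      ∀ i k, |CFC.sqrt S' i k| < M := by
    rw [eventually_all]; intro i
    rw [eventually_all]; intro k
    exact (hent i k).abs.eventually (Iio_mem_nhds (hM i k))
  have hC0 : 0 ≤ C := by have := (abs_nonneg _).trans (hC 0); simpa using this
  have hlin : ∀ A : Matrix (Fin n) (Fin n) ℝ, ∀ i, Continuous fun z : EuclideanSpace ℝ (Fin n) =>
      ∑ k, A i k * z k := fun A i => by fun_prop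
  have : FirstCountableTopology (Matrix (Fin n) (Fin n) ℝ) :=
    inferInstanceAs (FirstCountableTopology (Fin n → Fin n → ℝ))
  refine continuousWithinAt_of_dominated
    (bound := fun z => (C * (1 + M * ∑ k, |z k|)) ^ 2) ?_ ?_ ?_ ?_
  · exact Eventually.of_forall fun S' =>
      ((hφ.comp (hlin _ a)).mul (hφ.comp (hlin _ b))).aestronglyMeasurable
  · filter_upwards [hb] with S' hS'
    refine Eventually.of_forall fun z => ?_
    have hz : ∀ i, |φ (∑ k, CFC.sqrt S' i k * z k)| ≤ C * (1 + M * ∑ k, |z k|) := fun i => by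
      refine (hC _).trans (mul_le_mul_of_nonneg_left (add_le_add_right ?_ _) hC0)
      refine (Finset.abs_sum_le_sum_abs _ _).trans ?_
      rw [Finset.mul_sum]
      refine Finset.sum_le_sum fun k _ => ?_
      rw [abs_mul]
      exact mul_le_mul_of_nonneg_right (hS' i k).le (abs_nonneg _)
    rw [Real.norm_eq_abs, abs_mul, sq]
    exact mul_le_mul (hz a) (hz b) (abs_nonneg _) ((abs_nonneg _).trans (hz a))
  · exact (memLp_affine_sum_abs (stdGaussian (EuclideanSpace ℝ (Fin n))) (fun k z => z k) C M
      fun k => memLp_coord_of_isGaussian _ k 2 (by simp)).integrable_sq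
  · refine Eventually.of_forall fun z => ?_
    have hc : ∀ i, ContinuousWithinAt (fun S' : Matrix (Fin n) (Fin n) ℝ =>
        φ (∑ k, CFC.sqrt S' i k * z k)) {S' | S'.PosSemidef} S := fun i => by
      refine hφ.continuousAt.comp_continuousWithinAt ?_
      exact tendsto_finsetSum _ fun k _ => (hent i k).mul_const _
    exact (hc a).mul (hc b)

/-- Quadratic comparison of a Gaussian expectation with its value at a fixed covariance. -/
theorem exists_gaussExp_sub_sq_le {φ : ℝ → ℝ} (hφ : Continuous φ) {C : ℝ}
    (hC : ∀ z, |φ z| ≤ C * (1 + |z|)) {S : Matrix (Fin n) (Fin n) ℝ} (hS : S.PosSemidef)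
    (a b : Fin n) {τ : ℝ} (hτ : 0 < τ) : ∃ K : ℝ, 0 ≤ K ∧ ∀ S' : Matrix (Fin n) (Fin n) ℝ,
      S'.PosSemidef → (gaussExp φ S' a b - gaussExp φ S a b) ^ 2 ≤
        τ + K * ∑ i, ∑ j, (S' i j - S i j) ^ 2 := by
  have hcont := continuousWithinAt_gaussExp hφ hC hS a b
  obtain ⟨r, hr, hball⟩ : ∃ r > 0, ∀ S' : Matrix (Fin n) (Fin n) ℝ, S'.PosSemidef →
      (∀ i j, |S' i j - S i j| < r) → (gaussExp φ S' a b - gaussExp φ S a b) ^ 2 < τ := by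
    let _ : NormedAddCommGroup (Matrix (Fin n) (Fin n) ℝ) := Matrix.normedAddCommGroup
    have h1 : ContinuousWithinAt (fun S' => (gaussExp φ S' a b - gaussExp φ S a b) ^ 2)
        {S' | S'.PosSemidef} S := (hcont.sub continuousWithinAt_const).pow 2
    have h2 := h1.eventually_lt_const (u := τ) (by simpa using hτ)
    rw [eventually_nhdsWithin_iff] at h2
    obtain ⟨r, hr, h3⟩ := Metric.eventually_nhds_iff.1 h2
    refine ⟨r, hr, fun S' hS' hd => h3 ?_ hS'⟩
    rw [dist_eq_norm, Matrix.norm_lt_iff hr]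
    exact hd
  -- Within distance `r` continuity gives `τ`. Farther away `r ^ 2 ≤ Δ`, so every constant is at
  -- most a multiple of `Δ`; `D` collects the terms free of `Δ`, and 96 is the factor of `C ^ 4 * Δ`
  -- left by the growth bound.
  set D := 8 * C ^ 4 * (2 + 6 * (S a a ^ 2 + S b b ^ 2)) + 2 * gaussExp φ S a b ^ 2 with hD
  have hD0 : 0 ≤ D := by positivity
  refine ⟨96 * C ^ 4 + D / r ^ 2, by positivity, fun S' hS' => ?_⟩
  set Δ := ∑ i, ∑ j, (S' i j - S i j) ^ 2 with hΔ
  have hle : ∀ i j, (S' i j - S i j) ^ 2 ≤ Δ := fun i j => by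
    have h1 := Finset.single_le_sum (f := fun j => (S' i j - S i j) ^ 2) (fun k _ => sq_nonneg _)
      (Finset.mem_univ j)
    have h2 := Finset.single_le_sum (f := fun i => ∑ j, (S' i j - S i j) ^ 2)
      (fun i _ => Finset.sum_nonneg fun k _ => sq_nonneg _) (Finset.mem_univ i)
    exact h1.trans h2
  have hΔ0 : 0 ≤ Δ := (sq_nonneg _).trans (hle a a)
  by_cases h : ∀ i j, |S' i j - S i j| < r
  · have h1 := (hball S' hS' h).le
    have : 0 ≤ (96 * C ^ 4 + D / r ^ 2) * Δ := by positivity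
    linarith
  · push Not at h
    obtain ⟨i, j, hij⟩ := h
    have h1 : r ^ 2 ≤ Δ := by
      refine le_trans ?_ (hle i j)
      rw [← sq_abs (S' i j - S i j)]
      exact pow_le_pow_left₀ hr.le hij 2
    have h2 := gaussExp_sq_le hφ.measurable hC hS' a b
    have h3 : S' a a ^ 2 ≤ 2 * Δ + 2 * S a a ^ 2 := by
      nlinarith [hle a a, sq_nonneg (S' a a - 2 * S a a)]
    have h4 : S' b b ^ 2 ≤ 2 * Δ + 2 * S b b ^ 2 := by
      nlinarith [hle b b, sq_nonneg (S' b b - 2 * S b b)]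
    have h5 : (gaussExp φ S' a b - gaussExp φ S a b) ^ 2 ≤
        2 * gaussExp φ S' a b ^ 2 + 2 * gaussExp φ S a b ^ 2 := by
      nlinarith [sq_nonneg (gaussExp φ S' a b + gaussExp φ S a b)]
    have h6 : D ≤ D / r ^ 2 * Δ := by
      rw [div_mul_eq_mul_div, le_div_iff₀ (by positivity)]
      exact mul_le_mul_of_nonneg_left h1 hD0
    have hC4 : 0 ≤ C ^ 4 := by positivity
    have h7 : C ^ 4 * (4 * (2 + 3 * S' a a ^ 2 + 3 * S' b b ^ 2)) ≤
        C ^ 4 * (4 * (2 + 3 * (2 * Δ + 2 * S a a ^ 2) + 3 * (2 * Δ + 2 * S b b ^ 2))) := by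
      gcongr
    have : (96 * C ^ 4 + D / r ^ 2) * Δ = 96 * C ^ 4 * Δ + D / r ^ 2 * Δ := by ring
    rw [this]
    nlinarith [mul_nonneg hC4 hΔ0]

theorem gaussExp_posSemidef {φ : ℝ → ℝ} (hφ : Measurable φ) {C : ℝ}
    (hC : ∀ z, |φ z| ≤ C * (1 + |z|)) (S : Matrix (Fin n) (Fin n) ℝ) :
    (gaussExp φ S).PosSemidef := by
  refine Matrix.PosSemidef.of_dotProduct_mulVec_nonneg ?_ fun u => ?_
  · ext i j
    simp only [gaussExp, Matrix.conjTranspose_apply, Matrix.of_apply, star_trivial, mul_comm]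
  · have hi := fun a b => (memLp_growth_mul hφ hC S a b).integrable (by norm_num)
    have : star u ⬝ᵥ (gaussExp φ S).mulVec u =
        ∫ y, (∑ a, u a * φ (y a)) ^ 2 ∂(multivariateGaussian 0 S) := by
      have e : ∀ y : EuclideanSpace ℝ (Fin n), (∑ a, u a * φ (y a)) ^ 2 =
          ∑ a, ∑ b, u a * u b * (φ (y a) * φ (y b)) := fun y => by
        rw [sq, Finset.sum_mul_sum]
        exact Finset.sum_congr rfl fun a _ => Finset.sum_congr rfl fun b _ => by ring
      simp only [e]
      rw [integral_finsetSum _ fun a _ => integrable_finsetSum _ fun b _ => (hi a b).const_mul _]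
      simp only [dotProduct, Matrix.mulVec, gaussExp, Matrix.of_apply, Finset.mul_sum]
      refine Finset.sum_congr rfl fun a _ => ?_
      rw [integral_finsetSum _ fun b _ => (hi a b).const_mul _]
      refine Finset.sum_congr rfl fun b _ => ?_
      rw [integral_const_mul]
      simp only [Pi.star_apply, star_trivial]
      ring
    rw [this]
    exact integral_nonneg fun y => sq_nonneg _

end GaussExp

/-! ### Convergence of the empirical covariances -/

section CovarianceLimit
open Topology

theorem VanishInMean.of_forall_pos {Ω : ℕ → Type*} [∀ d, MeasurableSpace (Ω d)]
    {P : ∀ d, Measure (Ω d)} {F : ∀ d, Ω d → ℝ}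
    (h : ∀ τ : ℝ, 0 < τ → ∃ G : ∀ d, Ω d → ℝ, VanishInMean P G ∧ ∀ᶠ d in atTop,
      ∫⁻ ω, ENNReal.ofReal (F d ω) ∂(P d) ≤
        ENNReal.ofReal τ + ∫⁻ ω, ENNReal.ofReal (G d ω) ∂(P d)) : VanishInMean P F := by
  refine ENNReal.tendsto_nhds_zero.2 fun ε hε => ?_
  by_cases hε' : ε = ⊤
  · exact Eventually.of_forall fun d => hε' ▸ le_top
  have hr : 0 < ε.toReal := ENNReal.toReal_pos hε.ne' hε'
  obtain ⟨G, hG, hFG⟩ := h (ε.toReal / 2) (by positivity)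
  have h2 := ENNReal.tendsto_nhds_zero.1 hG (ENNReal.ofReal (ε.toReal / 2))
    (ENNReal.ofReal_pos.2 (by positivity))
  filter_upwards [hFG, h2] with d hd hd2
  calc _ ≤ _ := hd
    _ ≤ ENNReal.ofReal (ε.toReal / 2) + ENNReal.ofReal (ε.toReal / 2) := by gcongr
    _ = ε := by
      rw [← ENNReal.ofReal_add (by positivity) (by positivity), add_halves, ENNReal.ofReal_toReal hε']

variable {d₀ m d n : ℕ}

/-- Conditional covariance of the pre-activations of layer `k + 1` on the training inputs. -/
def empCov (σ : ℝ → ℝ) (σw : ℝ) (X : Fin n → EuclideanSpace ℝ (Fin d₀)) (θ : Params d₀ m d) :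
    ℕ → Matrix (Fin n) (Fin n) ℝ
  | 0 => limitCov σ σw X 0
  | k + 1 => Matrix.of fun a b =>
      σw ^ 2 / d * ∑ j, σ (hid σ θ (X a) k j) * σ (hid σ θ (X b) k j)

/-- The average over a layer of the products `φ (h_i(x_a)) φ (h_i(x_b))`. -/
def avgProd (σ φ : ℝ → ℝ) (X : Fin n → EuclideanSpace ℝ (Fin d₀)) (θ : Params d₀ m d) (k : ℕ)
    (a b : Fin n) : ℝ :=
  (1 / d : ℝ) * ∑ i, φ (hid σ θ (X a) k i) * φ (hid σ θ (X b) k i)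

theorem empCov_succ_apply (σ : ℝ → ℝ) (σw : ℝ) (X : Fin n → EuclideanSpace ℝ (Fin d₀))
    (θ : Params d₀ m d) (k : ℕ) (a b : Fin n) :
    empCov σ σw X θ (k + 1) a b = σw ^ 2 * avgProd σ σ X θ k a b := by
  simp only [empCov, Matrix.of_apply, avgProd]; ring

theorem limitCov_succ_apply (σ : ℝ → ℝ) (σw : ℝ) (X : Fin n → EuclideanSpace ℝ (Fin d₀))
    (k : ℕ) (a b : Fin n) :
    limitCov σ σw X (k + 1) a b = σw ^ 2 * gaussExp σ (limitCov σ σw X k) a b := by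
  simp [limitCov, Matrix.smul_apply]

/-- The coefficients of the pre-activation of neuron `i` of layer `k + 1` at the training input
`X a`, as a linear form in the parameters of that layer. -/
def layerCoeff (σ : ℝ → ℝ) (X : Fin n → EuclideanSpace ℝ (Fin d₀)) (θ : Params d₀ m d) :
    ℕ → Fin d → Fin n → ParamIdx d₀ m d → ℝ
  | 0 => fun i a => pushCoeff (fun j => Sum.inl (j, i)) fun j => X a j
  | k + 1 => fun i a => pushCoeff (fun j => pidx k j i) fun j => σ (hid σ θ (X a) k j)

theorem sum_layerCoeff (σ : ℝ → ℝ) (X : Fin n → EuclideanSpace ℝ (Fin d₀))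
    (θ θ' : Params d₀ m d) {k : ℕ} (hk : k ≤ m + 1) (i : Fin d) (a : Fin n) :
    ∑ p, layerCoeff σ X θ k i a p * θ' p = hid σ (resample (k + 1) θ θ') (X a) k i := by
  cases k with
  | zero =>
    simp only [layerCoeff, sum_pushCoeff, hid]
    exact Finset.sum_congr rfl fun j _ => by simp [resample, layer]
  | succ k =>
    simp only [layerCoeff, sum_pushCoeff, hid, hid_resample σ (X a) θ θ' k (by omega)]
    exact Finset.sum_congr rfl fun j _ => by rw [resample_pidx (by omega)]

/-- With the earlier layers frozen, the neurons of layer `k + 1` are i.i.d. Gaussian vectors of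
covariance `empCov`, since different neurons read disjoint sets of weights. The index stops at `m`
because `pidx m` ignores the neuron. -/
theorem linCov_layerCoeff (σ : ℝ → ℝ) (σw : ℝ) (X : Fin n → EuclideanSpace ℝ (Fin d₀))
    (θ : Params d₀ m d) {k : ℕ} (hk : k ≤ m) (i i' : Fin d) (a b : Fin n) :
    linCov (initVar σw d₀ m d) (layerCoeff σ X θ k i a) (layerCoeff σ X θ k i' b) =
      if i = i' then empCov σ σw X θ k a b else 0 := by
  split_ifs with h
  · subst h
    cases k with
    | zero =>
      have hv : ∀ j : Fin d₀, (initVar σw d₀ m d (Sum.inl (j, i)) : ℝ) = σw ^ 2 / d₀ := fun j => by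
        rw [initVar, Real.coe_toNNReal _ (by positivity)]; rfl
      have hinj : Function.Injective fun j : Fin d₀ => (Sum.inl (j, i) : ParamIdx d₀ m d) :=
        fun j j' h => by simpa using h
      simp only [layerCoeff, linCov_pushCoeff_self _ hinj _ _ hv, empCov, limitCov,
        Matrix.of_apply, PiLp.inner_apply]
      congr 1
      exact Finset.sum_congr rfl fun j _ => by simp [mul_comm]
    | succ k =>
      simp only [layerCoeff, linCov_pushCoeff_self _ (pidx_injective k i) _ _
        (coe_initVar_pidx σw k · i), empCov, Matrix.of_apply]
  · cases k with
    | zero =>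
      exact linCov_pushCoeff_disjoint _ (fun j j' e => h (by simpa using (congrArg
        (Sum.elim Prod.snd fun _ => i) e))) _ _
    | succ k =>
      exact linCov_pushCoeff_disjoint _ (fun j j' => pidx_ne (by omega) h j j') _ _

theorem empCov_posSemidef (σ : ℝ → ℝ) (σw : ℝ) (X : Fin n → EuclideanSpace ℝ (Fin d₀))
    (θ : Params d₀ m d) {k : ℕ} (hk : k ≤ m) (hd : 0 < d) :
    (empCov σ σw X θ k).PosSemidef := by
  have h := linCov_gram_posSemidef (initVar σw d₀ m d)
    (fun a => layerCoeff σ X θ k (⟨0, hd⟩ : Fin d) a)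
  simp only [linCov_layerCoeff σ σw X θ hk, if_true] at h
  exact h

theorem limitCov_posSemidef {σ : ℝ → ℝ} (hσ : Measurable σ) {C : ℝ}
    (hC : ∀ z, |σ z| ≤ C * (1 + |z|)) (σw : ℝ) (X : Fin n → EuclideanSpace ℝ (Fin d₀)) (k : ℕ) :
    (limitCov σ σw X k).PosSemidef := by
  cases k with
  | zero =>
    -- `empCov` at index 0 is `limitCov` itself, so any network serves, here one of depth 2 and
    -- width 1.
    exact empCov_posSemidef (m := 0) (d := 1) σ σw X (fun _ => 0) (k := 0) le_rfl one_pos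
  | succ k => exact (gaussExp_posSemidef hσ hC _).smul (by positivity)

variable (σw : ℝ) (ρ : ℕ → Measure ℝ) [∀ l, IsProbabilityMeasure (ρ l)]

theorem continuous_avgProd {σ φ : ℝ → ℝ} (hσ : Continuous σ) (hφ : Continuous φ)
    (X : Fin n → EuclideanSpace ℝ (Fin d₀)) (k : ℕ) (a b : Fin n) :
    Continuous fun θ : Params d₀ m d => avgProd σ φ X θ k a b :=
  continuous_const.mul (continuous_finsetSum _ fun i _ =>
    (hφ.comp (continuous_hid hσ _ k i)).mul (hφ.comp (continuous_hid hσ _ k i)))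

theorem measurable_empCov {σ : ℝ → ℝ} (hσ : Continuous σ)
    (X : Fin n → EuclideanSpace ℝ (Fin d₀)) (k : ℕ) (a b : Fin n) :
    Measurable fun θ : Params d₀ m d => empCov σ σw X θ k a b := by
  cases k with
  | zero => exact measurable_const
  | succ k =>
    simp only [empCov_succ_apply]
    exact ((continuous_avgProd hσ hσ X k a b).measurable).const_mul _

/-- With the earlier layers frozen, `avgProd` is an average of i.i.d. variables: its variance is
O(1/d), and its mean is the Gaussian expectation at the empirical, not the limiting, covariance. The
two errors are separated by `(x + y) ^ 2 ≤ 2 x ^ 2 + 2 y ^ 2`. -/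
theorem lintegral_avgProd_sub_sq_le {σ φ : ℝ → ℝ} (hσ : Continuous σ) (hφ : Continuous φ) {C : ℝ}
    (hC : ∀ z, |φ z| ≤ C * (1 + |z|)) (X : Fin n → EuclideanSpace ℝ (Fin d₀)) {k : ℕ}
    (hk : k ≤ m) (hd : 0 < d) (a b : Fin n) (g : ℝ) :
    ∫⁻ ω, ENNReal.ofReal ((avgProd σ φ X ω.1 k a b - g) ^ 2) ∂(jointLaw σw ρ d₀ m d) ≤
      ∫⁻ ω, ENNReal.ofReal (2 * ((1 / d : ℝ) * (C ^ 4 * (4 *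
        (2 + 3 * empCov σ σw X ω.1 k a a ^ 2 + 3 * empCov σ σw X ω.1 k b b ^ 2)))) +
        2 * (gaussExp φ (empCov σ σw X ω.1 k) a b - g) ^ 2) ∂(jointLaw σw ρ d₀ m d) := by
  have hcont := continuous_avgProd (m := m) (d := d) hσ hφ X k a b
  refine lintegral_le_of_resample σw ρ (k + 1)
    (((hcont.comp continuous_fst).sub continuous_const).pow 2).measurable fun ω => ?_
  have hres : Measurable fun θ' : Params d₀ m d => resample (k + 1) ω.1 θ' := by
    refine measurable_pi_lambda _ fun p => ?_
    unfold resample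
    split_ifs <;> fun_prop
  have hm1 : Measurable fun θ' : Params d₀ m d => ENNReal.ofReal
      ((avgProd σ φ X (resample (k + 1) ω.1 θ') k a b - g) ^ 2) :=
    (((hcont.measurable.comp hres).sub_const _).pow_const 2).ennreal_ofReal
  refine (le_of_eq (lintegral_fst_jointLaw σw ρ hm1)).trans ?_
  set S := empCov σ σw X ω.1 k with hS
  have hSp : S.PosSemidef := empCov_posSemidef σ σw X ω.1 hk hd
  set F : EuclideanSpace ℝ (Fin n) → ℝ := fun y => φ (y a) * φ (y b) with hF
  have hFm : Measurable F := (hφ.measurable.comp (by fun_prop)).mul (hφ.measurable.comp (by fun_prop))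
  have hlln := lintegral_average_sub_sq_le (initVar σw d₀ m d) d hd (layerCoeff σ X ω.1 k) S
    (fun i i' a b => linCov_layerCoeff σ σw X ω.1 hk i i' a b) F hFm
    (memLp_growth_mul hφ.measurable hC S a b)
  have hE : ∫ y, F y ∂(multivariateGaussian 0 S) = gaussExp φ S a b := by
    simp [hF, gaussExp]
  have havg : ∀ θ', (1 / d : ℝ) * ∑ i, F (WithLp.toLp 2 fun a =>
      ∑ p, layerCoeff σ X ω.1 k i a p * θ' p) =
      avgProd σ φ X (resample (k + 1) ω.1 θ') k a b := fun θ' => by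
    simp only [hF, sum_layerCoeff σ X ω.1 θ' (by omega : k ≤ m + 1), avgProd]
  simp only [havg, hE] at hlln
  have hle := integral_growth_mul_sq_le hφ.measurable hC hSp a b
  have hm2 : Measurable fun θ' : Params d₀ m d => ENNReal.ofReal
      (2 * (avgProd σ φ X (resample (k + 1) ω.1 θ') k a b - gaussExp φ S a b) ^ 2) :=
    ((((hcont.measurable.comp hres).sub_const _).pow_const 2).const_mul 2).ennreal_ofReal
  calc ∫⁻ θ', ENNReal.ofReal ((avgProd σ φ X (resample (k + 1) ω.1 θ') k a b - g) ^ 2)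
        ∂(initLaw σw d₀ m d)
      ≤ ∫⁻ θ', (ENNReal.ofReal (2 * (avgProd σ φ X (resample (k + 1) ω.1 θ') k a b -
          gaussExp φ S a b) ^ 2) + ENNReal.ofReal (2 * (gaussExp φ S a b - g) ^ 2))
          ∂(initLaw σw d₀ m d) := by
        refine lintegral_mono fun θ' => ?_
        rw [← ENNReal.ofReal_add (by positivity) (by positivity)]
        refine ENNReal.ofReal_le_ofReal ?_
        nlinarith [sq_nonneg ((avgProd σ φ X (resample (k + 1) ω.1 θ') k a b - gaussExp φ S a b) -
          (gaussExp φ S a b - g))]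
    _ ≤ ENNReal.ofReal (2 * ((1 / d : ℝ) * (C ^ 4 * (4 * (2 + 3 * S a a ^ 2 + 3 * S b b ^ 2))))) +
          ENNReal.ofReal (2 * (gaussExp φ S a b - g) ^ 2) := by
        rw [lintegral_add_left hm2]
        refine add_le_add ?_ (by simp)
        rw [lintegral_ofReal_const_mul _ (by norm_num), ENNReal.ofReal_mul (by norm_num : (0:ℝ) ≤ 2)]
        refine mul_le_mul_right (hlln.trans (ENNReal.ofReal_le_ofReal ?_)) _
        exact mul_le_mul_of_nonneg_left hle (by positivity)
    _ = _ := by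
        rw [← ENNReal.ofReal_add _ (by positivity)]
        have : 0 ≤ C ^ 4 := by positivity
        positivity

variable {σw ρ}

/-- The empirical covariances of layer `k + 1` converge in mean square. -/
def CovConverges (σ : ℝ → ℝ) (σw : ℝ) (ρ : ℕ → Measure ℝ) (m : ℕ)
    (X : Fin n → EuclideanSpace ℝ (Fin d₀)) (k : ℕ) : Prop :=
  ∀ a b, VanishInMean (fun d => jointLaw σw ρ d₀ m d)
    fun _ ω => (empCov σ σw X ω.1 k a b - limitCov σ σw X k a b) ^ 2

theorem CovConverges.bounded {σ : ℝ → ℝ} (hσ : Continuous σ)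
    {X : Fin n → EuclideanSpace ℝ (Fin d₀)} {k : ℕ}
    (h : CovConverges σ σw ρ m X k) (a b : Fin n) :
    BoundedInMean (fun d => jointLaw σw ρ d₀ m d) fun _ ω => empCov σ σw X ω.1 k a b ^ 2 := by
  have h1 := ((h a b).bounded.const_mul (c := 2) (by norm_num)).add
    (boundedInMean_const (P := fun d => jointLaw σw ρ d₀ m d) (2 * limitCov σ σw X k a b ^ 2))
    (fun d => ((((measurable_empCov σw hσ X k a b).comp measurable_fst).sub_const _).pow_const
      2).const_mul 2)
  refine h1.mono (Eventually.of_forall fun d => lintegral_mono fun ω =>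
    ENNReal.ofReal_le_ofReal ?_)
  nlinarith [sq_nonneg (empCov σ σw X ω.1 k a b - 2 * limitCov σ σw X k a b)]

theorem tendsto_one_div_nat : Tendsto (fun d : ℕ => (1 / d : ℝ)) atTop (𝓝 0) :=
  tendsto_one_div_atTop_nhds_zero_nat

/-- The sampling error vanishes like `1/d`, and the bias is at most `τ` plus a multiple of the
squared covariance error. An inequality valid for every covariance can be integrated, which
continuity alone would not allow. -/
theorem CovConverges.avgProd {σ φ : ℝ → ℝ} (hσ : Continuous σ) (hφ : Continuous φ) {C C' : ℝ}
    (hC : ∀ z, |φ z| ≤ C * (1 + |z|)) (hC' : ∀ z, |σ z| ≤ C' * (1 + |z|))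
    {X : Fin n → EuclideanSpace ℝ (Fin d₀)}
    {k : ℕ} (hk : k ≤ m) (h : CovConverges σ σw ρ m X k) (a b : Fin n) :
    VanishInMean (fun d => jointLaw σw ρ d₀ m d)
      fun _ ω => (WNTK.avgProd σ φ X ω.1 k a b - gaussExp φ (limitCov σ σw X k) a b) ^ 2 := by
  refine VanishInMean.of_forall_pos fun τ hτ => ?_
  obtain ⟨K, hK0, hK⟩ := exists_gaussExp_sub_sq_le hφ hC
    (limitCov_posSemidef hσ.measurable hC' σw X k) a b (half_pos hτ)
  have hmE : ∀ d a b, Measurable fun ω : Params d₀ m d × Params d₀ m d =>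
      empCov σ σw X ω.1 k a b := fun d a b => (measurable_empCov σw hσ X k a b).comp measurable_fst
  have hb : BoundedInMean (fun d => jointLaw σw ρ d₀ m d) fun d ω =>
      2 * (C ^ 4 * (4 * (2 + 3 * empCov σ σw X ω.1 k a a ^ 2 + 3 * empCov σ σw X ω.1 k b b ^ 2))) := by
    have h3 : (0 : ℝ) ≤ 3 := by norm_num
    have hC4 : (0 : ℝ) ≤ C ^ 4 := by positivity
    exact (((((boundedInMean_const 2).add ((h.bounded hσ a a).const_mul h3)
      fun d => measurable_const).add ((h.bounded hσ b b).const_mul h3)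
      fun d => (measurable_const.add (((hmE d a a).pow_const 2).const_mul 3))).const_mul
        (by norm_num)).const_mul hC4).const_mul (by norm_num)
  have hv1 := hb.vanish_mul (c := fun d => (1 / d : ℝ)) (fun d => by positivity)
    tendsto_one_div_nat
  have hv2 : VanishInMean (fun d => jointLaw σw ρ d₀ m d) fun d ω =>
      2 * (K * ∑ i, ∑ j, (empCov σ σw X ω.1 k i j - limitCov σ σw X k i j) ^ 2) :=
    ((VanishInMean.sum (fun i _ => VanishInMean.sum (fun j _ => h i j)
      fun j d => (((hmE d i j).sub_const _).pow_const 2)) fun i d => Finset.measurable_fun_sum _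
        fun j _ => (((hmE d i j).sub_const _).pow_const 2)).const_mul hK0).const_mul (by norm_num)
  refine ⟨_, hv1.add hv2 (fun d => ?_), ?_⟩
  · exact ((((((hmE d a a).pow_const 2).const_mul 3).const_add 2).add
      (((hmE d b b).pow_const 2).const_mul 3)).const_mul 4 |>.const_mul (C ^ 4) |>.const_mul 2
      |>.const_mul _)
  · filter_upwards [eventually_gt_atTop 0] with d hd
    refine (lintegral_avgProd_sub_sq_le σw ρ hσ hφ hC X hk hd a b _).trans ?_
    have e : ENNReal.ofReal τ = ∫⁻ _ω : Params d₀ m d × Params d₀ m d, ENNReal.ofReal τ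
        ∂(jointLaw σw ρ d₀ m d) := by simp
    rw [e, ← lintegral_add_left measurable_const]
    refine lintegral_mono fun ω => ?_
    have hnn : 0 ≤ (1 / d : ℝ) * (2 * (C ^ 4 * (4 * (2 + 3 * empCov σ σw X ω.1 k a a ^ 2 +
        3 * empCov σ σw X ω.1 k b b ^ 2)))) + 2 * (K * ∑ i, ∑ j, (empCov σ σw X ω.1 k i j -
        limitCov σ σw X k i j) ^ 2) := by
      have : 0 ≤ C ^ 4 := by positivity
      have : 0 ≤ ∑ i, ∑ j, (empCov σ σw X ω.1 k i j - limitCov σ σw X k i j) ^ 2 :=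
        Finset.sum_nonneg fun i _ => Finset.sum_nonneg fun j _ => sq_nonneg _
      positivity
    rw [← ENNReal.ofReal_add hτ.le hnn]
    refine ENNReal.ofReal_le_ofReal ?_
    have := hK _ (empCov_posSemidef σ σw X ω.1 hk hd)
    linarith

theorem covConverges {σ : ℝ → ℝ} (hσ : Continuous σ) {C : ℝ} (hC : ∀ z, |σ z| ≤ C * (1 + |z|))
    (X : Fin n → EuclideanSpace ℝ (Fin d₀)) (k : ℕ) (hk : k ≤ m + 1) :
    CovConverges σ σw ρ m X k := by
  induction k with
  | zero => intro a b; simp [VanishInMean, empCov]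
  | succ k ih =>
    intro a b
    have := ((ih (by omega)).avgProd hσ hσ hC hC (by omega) a b).const_mul (c := (σw ^ 2) ^ 2)
      (by positivity)
    refine this.mono_of_le (Eventually.of_forall fun d ω => le_of_eq ?_)
    rw [empCov_succ_apply, limitCov_succ_apply]
    ring

end CovarianceLimit

/-! ### One-step mean-square estimates for the tangent kernel -/

section KernelLimit
open Topology

theorem sq_average_le {d : ℕ} (x : Fin d → ℝ) :
    ((1 / d : ℝ) * ∑ i, x i) ^ 2 ≤ (1 / d : ℝ) * ∑ i, x i ^ 2 := by
  have h := sq_sum_le_card_mul_sum_sq (s := (Finset.univ : Finset (Fin d))) (f := x)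
  simp only [Finset.card_univ, Fintype.card_fin] at h
  rcases Nat.eq_zero_or_pos d with rfl | hd
  · simp
  have hd' : (0 : ℝ) < d := by positivity
  rw [mul_pow]
  calc (1 / d : ℝ) ^ 2 * (∑ i, x i) ^ 2 ≤ (1 / d : ℝ) ^ 2 * (d * ∑ i, x i ^ 2) := by gcongr
    _ = _ := by field_simp

theorem lintegral_average_le {Ω : Type*} [MeasurableSpace Ω] (P : Measure Ω) {d : ℕ} (hd : 0 < d)
    {F : Fin d → Ω → ℝ} (hF : ∀ i, Measurable (F i)) (hF0 : ∀ i ω, 0 ≤ F i ω) {C : ENNReal}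
    (h : ∀ i, ∫⁻ ω, ENNReal.ofReal (F i ω) ∂P ≤ C) :
    ∫⁻ ω, ENNReal.ofReal ((1 / d : ℝ) * ∑ i, F i ω) ∂P ≤ C := by
  rw [lintegral_ofReal_const_mul _ (by positivity)]
  simp only [ENNReal.ofReal_sum_of_nonneg fun i (_ : i ∈ Finset.univ) => hF0 i _]
  rw [lintegral_finsetSum _ fun i _ => (hF i).ennreal_ofReal]
  calc _ ≤ ENNReal.ofReal (1 / d) * ∑ _i : Fin d, C :=
        mul_le_mul_right (Finset.sum_le_sum fun i _ => h i) _
    _ = C := by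
        simp only [Finset.sum_const, Finset.card_univ, Fintype.card_fin, nsmul_eq_mul]
        rw [← mul_assoc, ← ENNReal.ofReal_natCast, ← ENNReal.ofReal_mul (by positivity)]
        have : (d : ℝ) ≠ 0 := by positivity
        simp [this]

/-- Variance bound for a linear form in independent bounded variables of common law. -/
theorem lintegral_pi_linForm_sub_sq_le {ι β : Type*} [Fintype ι] [Fintype β] (μ : ι → Measure ℝ)
    [∀ p, IsProbabilityMeasure (μ p)] {e : β → ι} (he : Function.Injective e) {ν : Measure ℝ}
    [IsProbabilityMeasure ν] (hν : ∀ j, μ (e j) = ν) {A : ℝ} (hA : ∀ᵐ x ∂ν, |x| ≤ A) (c : β → ℝ) :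
    ∫⁻ a : ι → ℝ, ENNReal.ofReal ((∑ j, a (e j) * c j - (∫ x, x ∂ν) * ∑ j, c j) ^ 2)
      ∂(Measure.pi μ) ≤ ENNReal.ofReal (A ^ 2 * ∑ j, c j ^ 2) := by
  have hmp : ∀ j, MeasurePreserving (fun a : ι → ℝ => a (e j)) (Measure.pi μ) ν := fun j => by
    rw [← hν j]; exact measurePreserving_eval μ (e j)
  have hid : MemLp (fun x : ℝ => x) 2 ν := MemLp.of_bound (by fun_prop) A hA
  have hL : ∀ j, MemLp (fun a : ι → ℝ => a (e j) * c j) 2 (Measure.pi μ) := fun j =>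
    (hid.comp_measurePreserving (hmp j)).mul_const _
  have hEv : ∀ j, ∫ a : ι → ℝ, a (e j) * c j ∂(Measure.pi μ) = (∫ x, x ∂ν) * c j := fun j => by
    rw [integral_mul_const, ← (hmp j).map_eq, integral_map (hmp j).measurable.aemeasurable
      (by fun_prop)]
  have hind : Set.Pairwise (Finset.univ : Finset β) fun i j =>
      IndepFun (fun a : ι → ℝ => a (e i) * c i) (fun a => a (e j) * c j) (Measure.pi μ) := by
    intro i _ j _ hij
    have h1 : iIndepFun (fun p (a : ι → ℝ) => a p) (Measure.pi μ) :=
      iIndepFun_pi (X := fun _ => id) (fun _ => aemeasurable_id)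
    exact (h1.indepFun (he.ne hij)).comp (measurable_id.mul_const (c i))
      (measurable_id.mul_const (c j))
  have hvar := IndepFun.variance_sum (fun i _ => hL i) hind
  have hLs : MemLp (∑ j, fun a : ι → ℝ => a (e j) * c j) 2 (Measure.pi μ) :=
    memLp_finsetSum' _ fun i _ => hL i
  have hsum : ∫ a, (∑ j, fun a : ι → ℝ => a (e j) * c j) a ∂(Measure.pi μ) =
      (∫ x, x ∂ν) * ∑ j, c j := by
    simp only [Finset.sum_apply]
    rw [integral_finsetSum _ fun i _ => (hL i).integrable (by norm_num), Finset.mul_sum]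
    exact Finset.sum_congr rfl fun j _ => hEv j
  have hbound : Var[∑ j, fun a : ι → ℝ => a (e j) * c j; Measure.pi μ] ≤ A ^ 2 * ∑ j, c j ^ 2 := by
    rw [hvar, Finset.mul_sum]
    refine Finset.sum_le_sum fun j _ => ?_
    refine (variance_le_expectation_sq (hL j).aestronglyMeasurable).trans ?_
    have hb : ∀ᵐ a : ι → ℝ ∂(Measure.pi μ), |a (e j)| ≤ A := (hmp j).quasiMeasurePreserving.ae hA
    have : ∫ a : ι → ℝ, (A ^ 2 * c j ^ 2) ∂(Measure.pi μ) = A ^ 2 * c j ^ 2 := by simp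
    rw [← this]
    refine integral_mono_ae (hL j).integrable_sq (integrable_const _) ?_
    filter_upwards [hb] with a ha
    simp only [Pi.pow_apply, mul_pow]
    exact mul_le_mul_of_nonneg_right (sq_le_sq' (by linarith [abs_le.1 ha]) (abs_le.1 ha).2)
      (sq_nonneg _)
  rw [variance_eq_integral hLs.aemeasurable, hsum] at hbound
  have hint : Integrable (fun a => ((∑ j, fun a : ι → ℝ => a (e j) * c j) a -
      (∫ x, x ∂ν) * ∑ j, c j) ^ 2) (Measure.pi μ) := (hLs.sub (memLp_const _)).integrable_sq
  have h2 := ofReal_integral_eq_lintegral_ofReal hint (Eventually.of_forall fun a => sq_nonneg _)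
  simp only [Finset.sum_apply] at h2 hbound
  rw [← h2]
  exact ENNReal.ofReal_le_ofReal hbound

variable {d₀ m d n : ℕ} (σw : ℝ) (ρ : ℕ → Measure ℝ) [∀ l, IsProbabilityMeasure (ρ l)]

theorem ae_rate_le {amax : ℝ} (hamax : ∀ l, ∀ᵐ a ∂(ρ l), |a| ≤ amax) :
    ∀ᵐ ω ∂(jointLaw σw ρ d₀ m d), ∀ p, |ω.2 p| ≤ amax := by
  rw [ae_all_iff]
  intro p
  have h1 : MeasurePreserving (fun a : Params d₀ m d => a p) (rateLaw ρ d₀ m d) (ρ (layer p)) :=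
    measurePreserving_eval (fun p : ParamIdx d₀ m d => ρ (layer p)) p
  have h2 := measurePreserving_snd (μ := initLaw σw d₀ m d) (ν := rateLaw ρ d₀ m d)
  exact (h1.comp h2).quasiMeasurePreserving.ae (hamax (layer p))

theorem wker_resamplePair_succ (σ : ℝ → ℝ) (x x' : EuclideanSpace ℝ (Fin d₀))
    (ω ω' : Params d₀ m d × Params d₀ m d) {k : ℕ} (hk : k ≤ m) (i i' : Fin d) :
    wker σ (resamplePair (k + 2) ω ω') x x' (k + 1) i i' =
      ∑ j, ∑ j', (deriv σ (hid σ ω.1 x k j) * deriv σ (hid σ ω.1 x' k j') *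
          wker σ ω x x' k j j') * (ω'.1 (pidx k j i) * ω'.1 (pidx k j' i')) +
        if i = i' then (1 / d : ℝ) *
          ∑ j, ω'.2 (pidx k j i) * (σ (hid σ ω.1 x k j) * σ (hid σ ω.1 x' k j)) else 0 := by
  have hh : ∀ x, hid σ (resamplePair (k + 2) ω ω').1 x k = hid σ ω.1 x k := fun x =>
    hid_resample σ x _ _ k (by omega)
  have h1 : ∀ j i, (resamplePair (k + 2) ω ω').1 (pidx k j i) = ω'.1 (pidx k j i) := fun j i =>
    resample_pidx hk _ _ j i
  have h2 : ∀ j i, (resamplePair (k + 2) ω ω').2 (pidx k j i) = ω'.2 (pidx k j i) := fun j i =>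
    resample_pidx hk _ _ j i
  simp only [wker, hh, h1, h2, wker_resamplePair σ x x' ω ω' k (by omega)]

theorem sum_bilin_sq_le {σ : ℝ → ℝ} {D : ℝ} (hD : ∀ z, |deriv σ z| ≤ D) (h h' : Fin d → ℝ)
    (T : Fin d → Fin d → ℝ) :
    ∑ j, ∑ j', (deriv σ (h j) * deriv σ (h' j') * T j j') ^ 2 ≤ D ^ 4 * ∑ j, ∑ j', T j j' ^ 2 := by
  rw [Finset.mul_sum]
  refine Finset.sum_le_sum fun j _ => ?_
  rw [Finset.mul_sum]
  refine Finset.sum_le_sum fun j' _ => ?_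
  have hs : ∀ z, deriv σ z ^ 2 ≤ D ^ 2 := fun z => sq_le_sq' (by linarith [abs_le.1 (hD z)])
    (abs_le.1 (hD z)).2
  calc _ = deriv σ (h j) ^ 2 * deriv σ (h' j') ^ 2 * T j j' ^ 2 := by ring
    _ ≤ D ^ 2 * D ^ 2 * T j j' ^ 2 := mul_le_mul_of_nonneg_right
        (mul_le_mul (hs _) (hs _) (sq_nonneg _) (sq_nonneg _)) (sq_nonneg _)
    _ = _ := by ring

/-- The two neurons use disjoint columns of fresh weights, so the conditional second moment is a
squared Frobenius norm times the square of the weight variance `σw ^ 2 / d`. -/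
theorem lintegral_wker_offdiag_le {σ : ℝ → ℝ} (hσ : Continuous σ) (hσ' : Continuous (deriv σ))
    {D : ℝ} (hD : ∀ z, |deriv σ z| ≤ D) (x x' : EuclideanSpace ℝ (Fin d₀)) {k : ℕ} (hk : k < m)
    {i i' : Fin d} (hi : i ≠ i') :
    ∫⁻ ω, ENNReal.ofReal (wker σ ω x x' (k + 1) i i' ^ 2) ∂(jointLaw σw ρ d₀ m d) ≤
      ∫⁻ ω, ENNReal.ofReal (σw ^ 4 * D ^ 4 * ((1 / d : ℝ) ^ 2 *
        ∑ j, ∑ j', wker σ ω x x' k j j' ^ 2)) ∂(jointLaw σw ρ d₀ m d) := by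
  refine lintegral_le_of_resample σw ρ (k + 2)
    ((continuous_wker hσ hσ' x x' (k + 1) i i').pow 2).measurable fun ω => ?_
  simp only [wker_resamplePair_succ σ x x' ω _ hk.le, if_neg hi, add_zero]
  set B : Fin d → Fin d → ℝ := fun j j' =>
    deriv σ (hid σ ω.1 x k j) * deriv σ (hid σ ω.1 x' k j') * wker σ ω x x' k j j' with hB
  have hm : Measurable fun θ : Params d₀ m d => ENNReal.ofReal
      ((∑ j, ∑ j', B j j' * (θ (pidx k j i) * θ (pidx k j' i'))) ^ 2) := by fun_prop
  refine (le_of_eq (lintegral_fst_jointLaw σw ρ hm)).trans ?_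
  rw [initLaw_eq, ← ofReal_integral_eq_lintegral_ofReal (integrable_bilinForm_sq _ _ _ _)
    (Eventually.of_forall fun θ => sq_nonneg _),
    integral_bilinForm_sq_of_disjoint _ _ _ (σw ^ 2 / d) (pidx_injective k i) (pidx_injective k i')
    (fun j j' => pidx_ne hk hi j j') (fun j => coe_initVar_pidx σw k j i)
    (fun j => coe_initVar_pidx σw k j i')]
  refine ENNReal.ofReal_le_ofReal ?_
  calc _ ≤ (σw ^ 2 / d) ^ 2 * (D ^ 4 * ∑ j, ∑ j', wker σ ω x x' k j j' ^ 2) :=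
        mul_le_mul_of_nonneg_left (sum_bilin_sq_le hD _ _ _) (by positivity)
    _ = _ := by ring

/-- The error has three parts: the fluctuation of a quadratic form in fresh weights, that of an
average of fresh weight terms, and the distance of the conditional mean from `A`. Splitting the
square costs a factor 3, and the variance of the quadratic form brings a 2, whence the 6. -/
theorem lintegral_wker_diag_sub_sq_le {σ : ℝ → ℝ} (hσ : Continuous σ) (hσ' : Continuous (deriv σ))
    {D amax : ℝ} (hD : ∀ z, |deriv σ z| ≤ D) (hamax : ∀ l, ∀ᵐ a ∂(ρ l), |a| ≤ amax)
    (x x' : EuclideanSpace ℝ (Fin d₀)) {k : ℕ} (hk : k ≤ m) (i : Fin d) (A : ℝ) :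
    ∫⁻ ω, ENNReal.ofReal ((wker σ ω x x' (k + 1) i i - A) ^ 2) ∂(jointLaw σw ρ d₀ m d) ≤
      ∫⁻ ω, ENNReal.ofReal (6 * (σw ^ 4 * D ^ 4) * ((1 / d : ℝ) ^ 2 *
          ∑ j, ∑ j', wker σ ω x x' k j j' ^ 2) +
        3 * amax ^ 2 * ((1 / d : ℝ) * ((1 / d : ℝ) *
          ∑ j, (σ (hid σ ω.1 x k j) * σ (hid σ ω.1 x' k j)) ^ 2)) +
        3 * (σw ^ 2 * ((1 / d : ℝ) * ∑ j, deriv σ (hid σ ω.1 x k j) *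
            deriv σ (hid σ ω.1 x' k j) * wker σ ω x x' k j j) +
          (∫ a, a ∂(ρ (k + 2))) * ((1 / d : ℝ) * ∑ j, σ (hid σ ω.1 x k j) * σ (hid σ ω.1 x' k j)) -
          A) ^ 2) ∂(jointLaw σw ρ d₀ m d) := by
  refine lintegral_le_of_resample σw ρ (k + 2)
    (((continuous_wker hσ hσ' x x' (k + 1) i i).sub continuous_const).pow 2).measurable fun ω => ?_
  simp only [wker_resamplePair_succ σ x x' ω _ hk, if_true]
  set B : Fin d → Fin d → ℝ := fun j j' =>
    deriv σ (hid σ ω.1 x k j) * deriv σ (hid σ ω.1 x' k j') * wker σ ω x x' k j j' with hB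
  set c : Fin d → ℝ := fun j => σ (hid σ ω.1 x k j) * σ (hid σ ω.1 x' k j) with hc
  set μ := ∫ a, a ∂(ρ (k + 2)) with hμ
  set M := σw ^ 2 * ((1 / d : ℝ) * ∑ j, B j j) + μ * ((1 / d : ℝ) * ∑ j, c j) - A with hM
  have hm1 : Measurable fun θ : Params d₀ m d => ENNReal.ofReal
      ((∑ j, ∑ j', B j j' * (θ (pidx k j i) * θ (pidx k j' i)) - σw ^ 2 / d * ∑ j, B j j) ^ 2) := by
    fun_prop
  have hm2 : Measurable fun a : Params d₀ m d => ENNReal.ofReal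
      ((∑ j, a (pidx k j i) * c j - μ * ∑ j, c j) ^ 2) := by fun_prop
  have e1 : ∫⁻ ω' : Params d₀ m d × Params d₀ m d, ENNReal.ofReal
      ((∑ j, ∑ j', B j j' * (ω'.1 (pidx k j i) * ω'.1 (pidx k j' i)) - σw ^ 2 / d * ∑ j, B j j) ^ 2)
      ∂(jointLaw σw ρ d₀ m d) ≤ ENNReal.ofReal (2 * (σw ^ 4 * D ^ 4) * ((1 / d : ℝ) ^ 2 *
          ∑ j, ∑ j', wker σ ω x x' k j j' ^ 2)) := by
    refine (le_of_eq (lintegral_fst_jointLaw σw ρ hm1)).trans ?_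
    rw [initLaw_eq, ← ofReal_integral_eq_lintegral_ofReal (integrable_quadForm_sub_sq _ _ _ _)
      (Eventually.of_forall fun θ => sq_nonneg _)]
    refine ENNReal.ofReal_le_ofReal ((integral_quadForm_sub_trace_sq_le _ _ (σw ^ 2 / d)
      (pidx_injective k i) (fun j => coe_initVar_pidx σw k j i) B).trans ?_)
    calc _ ≤ 2 * (σw ^ 2 / d) ^ 2 * (D ^ 4 * ∑ j, ∑ j', wker σ ω x x' k j j' ^ 2) :=
          mul_le_mul_of_nonneg_left (sum_bilin_sq_le hD _ _ _) (by positivity)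
      _ = _ := by ring
  have e2 : ∫⁻ ω' : Params d₀ m d × Params d₀ m d, ENNReal.ofReal
      ((∑ j, ω'.2 (pidx k j i) * c j - μ * ∑ j, c j) ^ 2) ∂(jointLaw σw ρ d₀ m d) ≤
      ENNReal.ofReal (amax ^ 2 * ∑ j, c j ^ 2) := by
    refine (le_of_eq (lintegral_snd_jointLaw σw ρ hm2)).trans ?_
    exact lintegral_pi_linForm_sub_sq_le (fun p : ParamIdx d₀ m d => ρ (layer p))
      (pidx_injective k i) (ν := ρ (k + 2)) (fun j => by simp only [layer_pidx hk]) (hamax _) c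
  calc _ ≤ ∫⁻ ω' : Params d₀ m d × Params d₀ m d, (ENNReal.ofReal (3 * (∑ j, ∑ j', B j j' *
          (ω'.1 (pidx k j i) * ω'.1 (pidx k j' i)) - σw ^ 2 / d * ∑ j, B j j) ^ 2) +
        (ENNReal.ofReal (3 * (1 / d : ℝ) ^ 2 *
          (∑ j, ω'.2 (pidx k j i) * c j - μ * ∑ j, c j) ^ 2) + ENNReal.ofReal (3 * M ^ 2)))
        ∂(jointLaw σw ρ d₀ m d) := by
        refine lintegral_mono fun ω' => ?_
        rw [← ENNReal.ofReal_add (by positivity) (by positivity),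
          ← ENNReal.ofReal_add (by positivity) (by positivity)]
        refine ENNReal.ofReal_le_ofReal ?_
        set Q := ∑ j, ∑ j', B j j' * (ω'.1 (pidx k j i) * ω'.1 (pidx k j' i))
        set R := ∑ j, ω'.2 (pidx k j i) * c j
        have : Q + (1 / d : ℝ) * R - A = (Q - σw ^ 2 / d * ∑ j, B j j) +
          (1 / d : ℝ) * (R - μ * ∑ j, c j) + M := by rw [hM]; ring
        rw [this]
        nlinarith [sq_nonneg ((Q - σw ^ 2 / d * ∑ j, B j j) - (1 / d : ℝ) * (R - μ * ∑ j, c j)),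
          sq_nonneg ((Q - σw ^ 2 / d * ∑ j, B j j) - M),
          sq_nonneg ((1 / d : ℝ) * (R - μ * ∑ j, c j) - M)]
    _ ≤ ENNReal.ofReal 3 * ENNReal.ofReal (2 * (σw ^ 4 * D ^ 4) * ((1 / d : ℝ) ^ 2 *
          ∑ j, ∑ j', wker σ ω x x' k j j' ^ 2)) + (ENNReal.ofReal (3 * (1 / d : ℝ) ^ 2) *
          ENNReal.ofReal (amax ^ 2 * ∑ j, c j ^ 2) + ENNReal.ofReal (3 * M ^ 2)) := by
        rw [lintegral_add_left (by fun_prop), lintegral_add_left (by fun_prop),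
          lintegral_ofReal_const_mul _ (by norm_num), lintegral_ofReal_const_mul _ (by positivity)]
        refine add_le_add (mul_le_mul_right e1 _) (add_le_add (mul_le_mul_right e2 _) (by simp))
    _ = _ := by
        have h1 : 0 ≤ ∑ j, ∑ j', wker σ ω x x' k j j' ^ 2 :=
          Finset.sum_nonneg fun i _ => Finset.sum_nonneg fun j _ => sq_nonneg _
        have h2 : 0 ≤ ∑ j, c j ^ 2 := Finset.sum_nonneg fun i _ => sq_nonneg _
        have h3 : 0 ≤ D ^ 4 := by positivity
        have h4 : 0 ≤ σw ^ 4 := by positivity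
        rw [← ENNReal.ofReal_mul (by norm_num), ← ENNReal.ofReal_mul (by positivity),
          ← ENNReal.ofReal_add (by positivity) (by positivity),
          ← ENNReal.ofReal_add (by positivity) (by positivity)]
        congr 1
        ring

/-- It bounds the variance contributed by the weight terms, which `DiagConverges.succ` multiplies by
`1/d`. -/
theorem lintegral_average_sq_le {σ φ : ℝ → ℝ} (hσ : Continuous σ) (hφ : Continuous φ) {C : ℝ}
    (hC : ∀ z, |φ z| ≤ C * (1 + |z|)) (X : Fin n → EuclideanSpace ℝ (Fin d₀)) {k : ℕ}
    (hk : k ≤ m) (hd : 0 < d) (a b : Fin n) :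
    ∫⁻ ω, ENNReal.ofReal ((1 / d : ℝ) * ∑ i, (φ (hid σ ω.1 (X a) k i) * φ (hid σ ω.1 (X b) k i)) ^ 2)
      ∂(jointLaw σw ρ d₀ m d) ≤
      ∫⁻ ω, ENNReal.ofReal (C ^ 4 * (4 *
        (2 + 3 * empCov σ σw X ω.1 k a a ^ 2 + 3 * empCov σ σw X ω.1 k b b ^ 2)))
        ∂(jointLaw σw ρ d₀ m d) := by
  have hc : ∀ i, Continuous fun θ : Params d₀ m d =>
      (φ (hid σ θ (X a) k i) * φ (hid σ θ (X b) k i)) ^ 2 := fun i =>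
    ((hφ.comp (continuous_hid hσ _ k i)).mul (hφ.comp (continuous_hid hσ _ k i))).pow 2
  set F : Fin d → Params d₀ m d × Params d₀ m d → ℝ := fun i ω =>
    (φ (hid σ ω.1 (X a) k i) * φ (hid σ ω.1 (X b) k i)) ^ 2 with hFdef
  have hFm : ∀ i, Measurable (F i) := fun i => (hc i).measurable.comp measurable_fst
  refine lintegral_average_le (jointLaw σw ρ d₀ m d) hd hFm
    (fun i ω => sq_nonneg _) fun i => ?_
  refine lintegral_le_of_resample σw ρ (k + 1) (hFm i) fun ω => ?_
  have hres : Measurable fun θ' : Params d₀ m d => resample (k + 1) ω.1 θ' := by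
    refine measurable_pi_lambda _ fun p => ?_
    unfold resample
    split_ifs <;> fun_prop
  refine (le_of_eq (lintegral_fst_jointLaw σw ρ
    ((hc i).measurable.comp hres).ennreal_ofReal)).trans ?_
  set S := empCov σ σw X ω.1 k with hS
  have hSp : S.PosSemidef := empCov_posSemidef σ σw X ω.1 hk hd
  have hmap := map_linForm_eq_multivariateGaussian (initVar σw d₀ m d) (layerCoeff σ X ω.1 k i)
  simp only [linCov_layerCoeff σ σw X ω.1 hk, if_true, sum_layerCoeff σ X ω.1 _
    (by omega : k ≤ m + 1)] at hmap
  have hF : Measurable fun y : EuclideanSpace ℝ (Fin n) => ENNReal.ofReal ((φ (y a) * φ (y b)) ^ 2) :=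
    (((hφ.measurable.comp (by fun_prop)).mul (hφ.measurable.comp (by fun_prop))).pow_const
      2).ennreal_ofReal
  have hH : Measurable fun θ : Params d₀ m d => (WithLp.toLp 2 fun a =>
      hid σ (resample (k + 1) ω.1 θ) (X a) k i : EuclideanSpace ℝ (Fin n)) :=
    (WithLp.measurable_toLp 2 _).comp (measurable_pi_lambda _ fun a =>
      ((continuous_hid hσ (X a) k i).measurable.comp hres))
  have h2 := lintegral_map (μ := gaussPi (initVar σw d₀ m d)) hF hH
  rw [hmap] at h2
  change ∫⁻ θ, ENNReal.ofReal ((φ (hid σ (resample (k + 1) ω.1 θ) (X a) k i) *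
    φ (hid σ (resample (k + 1) ω.1 θ) (X b) k i)) ^ 2) ∂(gaussPi (initVar σw d₀ m d)) ≤ _
  refine h2.symm.le.trans ?_
  change ∫⁻ y, ENNReal.ofReal ((φ (y a) * φ (y b)) ^ 2) ∂(multivariateGaussian 0 S) ≤ _
  rw [← ofReal_integral_eq_lintegral_ofReal (memLp_growth_mul hφ.measurable hC S a b).integrable_sq
    (Eventually.of_forall fun y => sq_nonneg _)]
  exact ENNReal.ofReal_le_ofReal (integral_growth_mul_sq_le hφ.measurable hC hSp a b)

end KernelLimit

/-! ### Convergence of the tangent kernel at initialization -/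

section KernelConvergence
open Topology

variable {d₀ m n : ℕ} {σw : ℝ} {ρ : ℕ → Measure ℝ} [∀ l, IsProbabilityMeasure (ρ l)]

/-- The diagonal entries of the kernel of layer `k + 1` converge to `A` in mean square, uniformly
over the neurons. -/
def DiagConverges (σ : ℝ → ℝ) (σw : ℝ) (ρ : ℕ → Measure ℝ) (m : ℕ)
    (x x' : EuclideanSpace ℝ (Fin d₀)) (k : ℕ) (A : ℝ) : Prop :=
  ∃ c : ℕ → ENNReal, Tendsto c atTop (𝓝 0) ∧ ∀ᶠ d : ℕ in atTop, ∀ i : Fin d,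
    ∫⁻ ω, ENNReal.ofReal ((wker σ ω x x' k i i - A) ^ 2) ∂(jointLaw σw ρ d₀ m d) ≤ c d

/-- The mean square of the entries of the kernel of layer `k + 1` vanishes. -/
def OffConverges (σ : ℝ → ℝ) (σw : ℝ) (ρ : ℕ → Measure ℝ) (m : ℕ)
    (x x' : EuclideanSpace ℝ (Fin d₀)) (k : ℕ) : Prop :=
  VanishInMean (fun d => jointLaw σw ρ d₀ m d) fun d ω =>
    (1 / d : ℝ) ^ 2 * ∑ j, ∑ j', wker σ ω x x' k j j' ^ 2

theorem measurable_wker {σ : ℝ → ℝ} (hσ : Continuous σ) (hσ' : Continuous (deriv σ)) {d : ℕ}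
    (x x' : EuclideanSpace ℝ (Fin d₀)) (k : ℕ) (i i' : Fin d) :
    Measurable fun ω : Params d₀ m d × Params d₀ m d => wker σ ω x x' k i i' :=
  (continuous_wker hσ hσ' x x' k i i').measurable

theorem DiagConverges.average {σ : ℝ → ℝ} (hσ : Continuous σ) (hσ' : Continuous (deriv σ))
    {x x' : EuclideanSpace ℝ (Fin d₀)} {k : ℕ} {A : ℝ} (h : DiagConverges σ σw ρ m x x' k A) :
    VanishInMean (fun d => jointLaw σw ρ d₀ m d) fun d ω =>
      (1 / d : ℝ) * ∑ i, (wker σ ω x x' k i i - A) ^ 2 := by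
  obtain ⟨c, hc, h⟩ := h
  refine tendsto_of_tendsto_of_tendsto_of_le_of_le' tendsto_const_nhds hc
    (Eventually.of_forall fun _ => zero_le) ?_
  filter_upwards [h, eventually_gt_atTop 0] with d hd hd0
  exact lintegral_average_le (jointLaw σw ρ d₀ m d) hd0
    (fun i => ((measurable_wker hσ hσ' x x' k i i).sub_const A).pow_const 2)
    (fun i ω => sq_nonneg _) hd

/-- Of the `d ^ 2` entries only `d` are diagonal, so bounded second moments suffice for these, while
the off-diagonal ones have to vanish uniformly. -/
theorem offConverges_of_diag {σ : ℝ → ℝ} (hσ : Continuous σ) (hσ' : Continuous (deriv σ))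
    {x x' : EuclideanSpace ℝ (Fin d₀)} {k : ℕ} {A : ℝ} (h : DiagConverges σ σw ρ m x x' k A)
    {c : ℕ → ENNReal} (hc : Tendsto c atTop (𝓝 0)) (hoff : ∀ᶠ d : ℕ in atTop, ∀ i i' : Fin d,
      i ≠ i' → ∫⁻ ω, ENNReal.ofReal (wker σ ω x x' k i i' ^ 2) ∂(jointLaw σw ρ d₀ m d) ≤ c d) :
    OffConverges σ σw ρ m x x' k := by
  obtain ⟨b, hb, h⟩ := h
  have hlim : Tendsto (fun d : ℕ => c d + ENNReal.ofReal (1 / d) *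
      (ENNReal.ofReal 2 * b d + ENNReal.ofReal (2 * A ^ 2))) atTop (𝓝 0) := by
    have h1 : Tendsto (fun d : ℕ => ENNReal.ofReal (1 / d)) atTop (𝓝 0) := by
      simpa [Function.comp_def] using
        (ENNReal.continuous_ofReal.tendsto 0).comp tendsto_one_div_nat
    have h2 : Tendsto (fun d : ℕ => ENNReal.ofReal 2 * b d + ENNReal.ofReal (2 * A ^ 2)) atTop
        (𝓝 (ENNReal.ofReal (2 * A ^ 2))) := by
      have := (ENNReal.Tendsto.const_mul (a := ENNReal.ofReal 2) hb
        (Or.inr ENNReal.ofReal_ne_top)).add_const (ENNReal.ofReal (2 * A ^ 2))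
      simpa using this
    have := hc.add (ENNReal.Tendsto.mul h1 (Or.inr ENNReal.ofReal_ne_top) h2
      (Or.inr ENNReal.zero_ne_top))
    simpa using this
  refine tendsto_of_tendsto_of_tendsto_of_le_of_le' tendsto_const_nhds hlim
    (Eventually.of_forall fun _ => zero_le) ?_
  filter_upwards [h, hoff, eventually_gt_atTop 0] with d hd hd' hd0
  have hm : ∀ i i', Measurable fun ω : Params d₀ m d × Params d₀ m d =>
    wker σ ω x x' k i i' ^ 2 := fun i i' => (measurable_wker hσ hσ' x x' k i i').pow_const 2
  have hm0 : ∀ i i', Measurable fun ω : Params d₀ m d × Params d₀ m d =>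
      if i = i' then 0 else wker σ ω x x' k i i' ^ 2 := fun i i' => by
    split_ifs
    · exact measurable_const
    · exact hm i i'
  have hsplit : ∀ ω : Params d₀ m d × Params d₀ m d, ∀ i,
      (1 / d : ℝ) * ∑ i', wker σ ω x x' k i i' ^ 2 =
      (1 / d : ℝ) * ∑ i', (if i = i' then 0 else wker σ ω x x' k i i' ^ 2) +
        (1 / d : ℝ) * wker σ ω x x' k i i ^ 2 := fun ω i => by
    rw [← mul_add]
    congr 1
    have : wker σ ω x x' k i i ^ 2 = ∑ i', if i = i' then wker σ ω x x' k i i' ^ 2 else 0 := by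
      simp
    rw [this, ← Finset.sum_add_distrib]
    exact Finset.sum_congr rfl fun i' _ => by split_ifs <;> simp
  have hinner : ∀ i : Fin d, ∫⁻ ω, ENNReal.ofReal ((1 / d : ℝ) * ∑ i', wker σ ω x x' k i i' ^ 2)
      ∂(jointLaw σw ρ d₀ m d) ≤ c d + ENNReal.ofReal (1 / d) *
      (ENNReal.ofReal 2 * b d + ENNReal.ofReal (2 * A ^ 2)) := by
    intro i
    simp only [hsplit]
    calc _ ≤ ∫⁻ ω, (ENNReal.ofReal ((1 / d : ℝ) * ∑ i', (if i = i' then 0 else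
            wker σ ω x x' k i i' ^ 2)) + ENNReal.ofReal ((1 / d : ℝ) * wker σ ω x x' k i i ^ 2))
            ∂(jointLaw σw ρ d₀ m d) := lintegral_mono fun ω => ENNReal.ofReal_add_le
      _ = _ := lintegral_add_left
        ((Finset.measurable_fun_sum _ fun i' _ => hm0 i i').const_mul _).ennreal_ofReal _
      _ ≤ _ := ?_
    refine add_le_add (lintegral_average_le (jointLaw σw ρ d₀ m d) hd0 (hm0 i)
      (fun i' ω => by split_ifs <;> positivity) fun i' => ?_) ?_
    · by_cases hi : i = i'
      · simp [hi]
      · simpa [hi] using hd' i i' hi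
    · rw [lintegral_ofReal_const_mul _ (by positivity)]
      refine mul_le_mul_right ?_ _
      calc _ ≤ ∫⁻ ω, (ENNReal.ofReal (2 * (wker σ ω x x' k i i - A) ^ 2) +
              ENNReal.ofReal (2 * A ^ 2)) ∂(jointLaw σw ρ d₀ m d) := by
            refine lintegral_mono fun ω => ?_
            rw [← ENNReal.ofReal_add (by positivity) (by positivity)]
            exact ENNReal.ofReal_le_ofReal (by
              nlinarith [sq_nonneg (wker σ ω x x' k i i - 2 * A)])
        _ = ENNReal.ofReal 2 * ∫⁻ ω, ENNReal.ofReal ((wker σ ω x x' k i i - A) ^ 2)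
              ∂(jointLaw σw ρ d₀ m d) + ENNReal.ofReal (2 * A ^ 2) := by
            rw [lintegral_add_right _ measurable_const, lintegral_ofReal_const_mul _ (by norm_num)]
            simp
        _ ≤ _ := by gcongr; exact hd i
  have := lintegral_average_le (jointLaw σw ρ d₀ m d) hd0
    (F := fun i ω => (1 / d : ℝ) * ∑ i', wker σ ω x x' k i i' ^ 2)
    (fun i => (Finset.measurable_fun_sum _ fun i' _ => hm i i').const_mul _)
    (fun i ω => mul_nonneg (by positivity) (Finset.sum_nonneg fun _ _ => sq_nonneg _)) hinner
  refine le_trans (le_of_eq ?_) this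
  refine lintegral_congr fun ω => ?_
  rw [← Finset.mul_sum, sq, mul_assoc]

/-- In the normalization by `1/d` the first layer contributes O(1/d), the number of its inputs being
fixed. This is the value 0 from which `analyticWNTK` starts. -/
theorem diagConverges_zero {σ : ℝ → ℝ} {amax : ℝ} (hamax : ∀ l, ∀ᵐ a ∂(ρ l), |a| ≤ amax)
    (x x' : EuclideanSpace ℝ (Fin d₀)) : DiagConverges σ σw ρ m x x' 0 0 := by
  refine ⟨fun d => ENNReal.ofReal ((1 / d : ℝ) ^ 2 * (∑ j, amax * |x j * x' j|) ^ 2), ?_,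
    Eventually.of_forall fun d i => ?_⟩
  · have h := ((tendsto_one_div_nat).pow 2).mul_const ((∑ j, amax * |x j * x' j|) ^ 2)
    simpa [Function.comp_def] using (ENNReal.continuous_ofReal.tendsto _).comp h
  · have : ∫⁻ _ω : Params d₀ m d × Params d₀ m d,
        ENNReal.ofReal ((1 / d : ℝ) ^ 2 * (∑ j, amax * |x j * x' j|) ^ 2) ∂(jointLaw σw ρ d₀ m d) =
        ENNReal.ofReal ((1 / d : ℝ) ^ 2 * (∑ j, amax * |x j * x' j|) ^ 2) := by simp
    refine le_trans ?_ this.le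
    refine lintegral_mono_ae ?_
    filter_upwards [ae_rate_le σw ρ hamax] with ω hω
    refine ENNReal.ofReal_le_ofReal ?_
    simp only [wker, if_true, sub_zero, mul_pow]
    refine mul_le_mul_of_nonneg_left ?_ (by positivity)
    refine sq_le_sq' ?_ ?_
    · rw [neg_le, ← Finset.sum_neg_distrib]
      refine Finset.sum_le_sum fun j _ => (neg_le_abs _).trans ?_
      rw [abs_mul]
      exact mul_le_mul_of_nonneg_right (hω _) (abs_nonneg _)
    · refine Finset.sum_le_sum fun j _ => (le_abs_self _).trans ?_
      rw [abs_mul]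
      exact mul_le_mul_of_nonneg_right (hω _) (abs_nonneg _)

theorem offConverges_zero {σ : ℝ → ℝ} (hσ : Continuous σ) (hσ' : Continuous (deriv σ)) {amax : ℝ}
    (hamax : ∀ l, ∀ᵐ a ∂(ρ l), |a| ≤ amax) (x x' : EuclideanSpace ℝ (Fin d₀)) :
    OffConverges σ σw ρ m x x' 0 :=
  offConverges_of_diag hσ hσ' (diagConverges_zero hamax x x') (c := 0) tendsto_const_nhds
    (Eventually.of_forall fun d i i' hi => by simp [wker, hi])

theorem OffConverges.succ {σ : ℝ → ℝ} (hσ : Continuous σ) (hσ' : Continuous (deriv σ))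
    {D : ℝ} (hD : ∀ z, |deriv σ z| ≤ D) {x x' : EuclideanSpace ℝ (Fin d₀)} {k : ℕ} (hk : k < m)
    (h : OffConverges σ σw ρ m x x' k) {A : ℝ} (hA : DiagConverges σ σw ρ m x x' (k + 1) A) :
    OffConverges σ σw ρ m x x' (k + 1) :=
  offConverges_of_diag hσ hσ' hA (VanishInMean.const_mul h (c := σw ^ 4 * D ^ 4) (by positivity))
    (Eventually.of_forall fun _ _ _ hi => lintegral_wker_offdiag_le σw ρ hσ hσ' hD x x' hk hi)

theorem average_deriv_mul_sq_le {d : ℕ} {σ : ℝ → ℝ} {D : ℝ} (hD : ∀ z, |deriv σ z| ≤ D)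
    (h h' e : Fin d → ℝ) :
    ((1 / d : ℝ) * ∑ j, deriv σ (h j) * deriv σ (h' j) * e j) ^ 2 ≤
      D ^ 4 * ((1 / d : ℝ) * ∑ j, e j ^ 2) := by
  refine (sq_average_le _).trans ?_
  rw [mul_left_comm, Finset.mul_sum (a := D ^ 4)]
  refine mul_le_mul_of_nonneg_left (Finset.sum_le_sum fun j _ => ?_) (by positivity)
  have hs : ∀ z, deriv σ z ^ 2 ≤ D ^ 2 := fun z => sq_le_sq' (by linarith [abs_le.1 (hD z)])
    (abs_le.1 (hD z)).2
  calc _ = deriv σ (h j) ^ 2 * deriv σ (h' j) ^ 2 * e j ^ 2 := by ring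
    _ ≤ D ^ 2 * D ^ 2 * e j ^ 2 := mul_le_mul_of_nonneg_right
        (mul_le_mul (hs _) (hs _) (sq_nonneg _) (sq_nonneg _)) (sq_nonneg _)
    _ = _ := by ring

/-- The conditional mean is an average of products of `deriv σ` with diagonal entries, plus a
multiple of an average of products of `σ`. Replacing the entries by `A` costs their mean-square
error; what remains are averages with known limits. -/
theorem DiagConverges.succ {σ : ℝ → ℝ} (hσ : Continuous σ) (hσ' : Continuous (deriv σ))
    {C D amax : ℝ} (hC : ∀ z, |σ z| ≤ C * (1 + |z|)) (hD : ∀ z, |deriv σ z| ≤ D)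
    (hamax : ∀ l, ∀ᵐ a ∂(ρ l), |a| ≤ amax) (X : Fin n → EuclideanSpace ℝ (Fin d₀)) {k : ℕ}
    (hk : k ≤ m) (a b : Fin n) {A : ℝ} (hd : DiagConverges σ σw ρ m (X a) (X b) k A)
    (ho : OffConverges σ σw ρ m (X a) (X b) k) :
    DiagConverges σ σw ρ m (X a) (X b) (k + 1)
      (A * (σw ^ 2 * gaussExp (deriv σ) (limitCov σ σw X k) a b) +
        (∫ a, a ∂(ρ (k + 2))) * gaussExp σ (limitCov σ σw X k) a b) := by
  set μ := ∫ a, a ∂(ρ (k + 2)) with hμ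
  set Gd := gaussExp (deriv σ) (limitCov σ σw X k) a b with hGd
  set Gs := gaussExp σ (limitCov σ σw X k) a b with hGs
  have hD0 : 0 ≤ D := (abs_nonneg _).trans (hD 0)
  have hD1 : ∀ z, |deriv σ z| ≤ D * (1 + |z|) := fun z =>
    (hD z).trans (by nlinarith [abs_nonneg z])
  have hcov := covConverges (σw := σw) (ρ := ρ) (m := m) hσ hC X k (by omega)
  have v1 := hcov.avgProd hσ hσ' hD1 hC hk a b
  have v2 := hcov.avgProd hσ hσ hC hC hk a b
  have v3 := hd.average hσ hσ'
  have hmE : ∀ d a b, Measurable fun ω : Params d₀ m d × Params d₀ m d =>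
      empCov σ σw X ω.1 k a b := fun d a b => (measurable_empCov σw hσ X k a b).comp measurable_fst
  have hb : BoundedInMean (fun d => jointLaw σw ρ d₀ m d) fun d ω =>
      (1 / d : ℝ) * ∑ i, (σ (hid σ ω.1 (X a) k i) * σ (hid σ ω.1 (X b) k i)) ^ 2 := by
    have h3 : (0 : ℝ) ≤ 3 := by norm_num
    have hC4 : (0 : ℝ) ≤ C ^ 4 := by positivity
    refine BoundedInMean.mono (((((boundedInMean_const 2).add ((hcov.bounded hσ a a).const_mul h3)
      fun d => measurable_const).add ((hcov.bounded hσ b b).const_mul h3)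
      fun d => (measurable_const.add (((hmE d a a).pow_const 2).const_mul 3))).const_mul
        (by norm_num : (0 : ℝ) ≤ 4)).const_mul hC4) ?_
    filter_upwards [eventually_gt_atTop 0] with d hd
    exact lintegral_average_sq_le σw ρ hσ hσ hC X hk hd a b
  have v4 := hb.vanish_mul (c := fun d => (1 / d : ℝ)) (fun d => by positivity) tendsto_one_div_nat
  have hmP : ∀ (φ : ℝ → ℝ), Continuous φ → ∀ d, Measurable fun ω : Params d₀ m d × Params d₀ m d =>
      avgProd σ φ X ω.1 k a b := fun φ hφ d =>
    (continuous_avgProd hσ hφ X k a b).measurable.comp measurable_fst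
  have hmO : ∀ d, Measurable fun ω : Params d₀ m d × Params d₀ m d =>
      (1 / d : ℝ) ^ 2 * ∑ j, ∑ j', wker σ ω (X a) (X b) k j j' ^ 2 := fun d =>
    (Finset.measurable_fun_sum _ fun j _ => Finset.measurable_fun_sum _ fun j' _ =>
      (measurable_wker hσ hσ' _ _ k j j').pow_const 2).const_mul _
  have hmD : ∀ d, Measurable fun ω : Params d₀ m d × Params d₀ m d =>
      (1 / d : ℝ) * ∑ j, (wker σ ω (X a) (X b) k j j - A) ^ 2 := fun d =>
    (Finset.measurable_fun_sum _ fun j _ =>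
      ((measurable_wker hσ hσ' _ _ k j j).sub_const A).pow_const 2).const_mul _
  -- The conditional mean already carries a factor 3 and is again split into three terms, whence the
  -- 9.
  have w1 := v1.const_mul (c := 9 * (σw ^ 4 * A ^ 2)) (by positivity)
  have w2 := v2.const_mul (c := 9 * μ ^ 2) (by positivity)
  have w3 := v3.const_mul (c := 9 * (σw ^ 4 * D ^ 4)) (by positivity)
  have w4 := v4.const_mul (c := 3 * amax ^ 2) (by positivity)
  have w5 := VanishInMean.const_mul ho (c := 6 * (σw ^ 4 * D ^ 4)) (by positivity)
  have hv := w5.add (w3.add (w1.add (w2.add w4 fun d => (((hmP σ hσ d).sub_const Gs).pow_const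
    2).const_mul _) fun d => (((hmP _ hσ' d).sub_const Gd).pow_const 2).const_mul _)
    fun d => (hmD d).const_mul _) fun d => (hmO d).const_mul _
  refine ⟨_, hv, Eventually.of_forall fun d i => ?_⟩
  refine (lintegral_wker_diag_sub_sq_le σw ρ hσ hσ' hD hamax (X a) (X b) hk i _).trans ?_
  refine lintegral_mono fun ω => ENNReal.ofReal_le_ofReal ?_
  set E := (1 / d : ℝ) * ∑ j, deriv σ (hid σ ω.1 (X a) k j) * deriv σ (hid σ ω.1 (X b) k j) *
    (wker σ ω (X a) (X b) k j j - A) with hE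
  have hEsq : E ^ 2 ≤ D ^ 4 * ((1 / d : ℝ) * ∑ j, (wker σ ω (X a) (X b) k j j - A) ^ 2) :=
    average_deriv_mul_sq_le hD _ _ _
  have hsp : (1 / d : ℝ) * ∑ j, deriv σ (hid σ ω.1 (X a) k j) * deriv σ (hid σ ω.1 (X b) k j) *
      wker σ ω (X a) (X b) k j j = E + A * avgProd σ (deriv σ) X ω.1 k a b := by
    rw [hE, avgProd, mul_left_comm A, ← mul_add, Finset.mul_sum (a := A),
      ← Finset.sum_add_distrib]
    congr 1
    exact Finset.sum_congr rfl fun j _ => by ring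
  rw [hsp]
  change _ + _ + 3 * (_ + μ * avgProd σ σ X ω.1 k a b - _) ^ 2 ≤ _
  set P := avgProd σ (deriv σ) X ω.1 k a b
  set Q := avgProd σ σ X ω.1 k a b
  have hM : σw ^ 2 * (E + A * P) + μ * Q - (A * (σw ^ 2 * Gd) + μ * Gs) =
      σw ^ 2 * E + σw ^ 2 * A * (P - Gd) + μ * (Q - Gs) := by ring
  rw [hM]
  have h3 : ∀ x y z : ℝ, (x + y + z) ^ 2 ≤ 3 * (x ^ 2 + y ^ 2 + z ^ 2) := fun x y z => by
    nlinarith [sq_nonneg (x - y), sq_nonneg (x - z), sq_nonneg (y - z)]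
  have h4 := h3 (σw ^ 2 * E) (σw ^ 2 * A * (P - Gd)) (μ * (Q - Gs))
  have h5 := mul_le_mul_of_nonneg_left hEsq (by positivity : 0 ≤ 9 * σw ^ 4)
  nlinarith [h4, h5]

theorem wker_converges {σ : ℝ → ℝ} (hσ : Continuous σ) (hσ' : Continuous (deriv σ))
    {C D amax : ℝ} (hC : ∀ z, |σ z| ≤ C * (1 + |z|)) (hD : ∀ z, |deriv σ z| ≤ D)
    (hamax : ∀ l, ∀ᵐ a ∂(ρ l), |a| ≤ amax) (X : Fin n → EuclideanSpace ℝ (Fin d₀)) (a b : Fin n)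
    (k : ℕ) (hk : k ≤ m) :
    DiagConverges σ σw ρ m (X a) (X b) k
        (analyticWNTK σ σw (fun l => ∫ a, a ∂(ρ l)) X k a b) ∧
      OffConverges σ σw ρ m (X a) (X b) k := by
  induction k with
  | zero => exact ⟨diagConverges_zero hamax _ _, offConverges_zero hσ hσ' hamax _ _⟩
  | succ k ih =>
    obtain ⟨h1, h2⟩ := ih (by omega)
    have h3 := h1.succ hσ hσ' hC hD hamax X (by omega) a b h2
    exact ⟨h3, h2.succ hσ hσ' hD (by omega) h3⟩

/-- At the output every neuron index denotes the same scalar, so off-diagonal entries need not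
vanish there. Only the diagonal step is made, from index `m`. -/
theorem diagConverges_output {σ : ℝ → ℝ} (hσ : Continuous σ) (hσ' : Continuous (deriv σ))
    {C D amax : ℝ} (hC : ∀ z, |σ z| ≤ C * (1 + |z|)) (hD : ∀ z, |deriv σ z| ≤ D)
    (hamax : ∀ l, ∀ᵐ a ∂(ρ l), |a| ≤ amax) (X : Fin n → EuclideanSpace ℝ (Fin d₀)) (a b : Fin n) :
    DiagConverges σ σw ρ m (X a) (X b) (m + 1)
      (analyticWNTK σ σw (fun l => ∫ a, a ∂(ρ l)) X (m + 1) a b) :=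
  (wker_converges hσ hσ' hC hD hamax X a b m le_rfl).1.succ hσ hσ' hC hD hamax X le_rfl a b
    (wker_converges hσ hσ' hC hD hamax X a b m le_rfl).2

end KernelConvergence

/-! ### Moments of the back-propagated derivatives -/

section Backward
open Topology

variable {d₀ m d : ℕ}

/-- The product of the weight matrices from layer `k + 1` to layer `k + s + 2`, interlaced with the
derivatives of the activation. -/
def bmat (σ : ℝ → ℝ) (θ : Params d₀ m d) (x : EuclideanSpace ℝ (Fin d₀)) (k : ℕ) :
    ℕ → Fin d → Fin d → ℝ
  | 0 => fun j i => θ (pidx k j i)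
  | s + 1 => fun j i => ∑ l, bmat σ θ x k s j l * deriv σ (hid σ θ x (k + s + 1) l) *
      θ (pidx (k + s + 1) l i)

/-- `bmat` grows at the output side, so that its last factor is the fresh layer in a moment
recursion, whereas back-propagation peels off the layer nearest the input. The two orders of
multiplication agree. -/
theorem bmat_succ_left (σ : ℝ → ℝ) (θ : Params d₀ m d) (x : EuclideanSpace ℝ (Fin d₀)) (k s : ℕ)
    (j i : Fin d) : bmat σ θ x k (s + 1) j i =
      ∑ l, θ (pidx k j l) * deriv σ (hid σ θ x (k + 1) l) * bmat σ θ x (k + 1) s l i := by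
  induction s generalizing i with
  | zero => simp only [bmat, add_zero]
  | succ s ih =>
    have e : k + 1 + s + 1 = k + (s + 1) + 1 := by omega
    rw [bmat]
    simp only [ih]
    simp only [bmat, e, Finset.sum_mul, Finset.mul_sum]
    rw [Finset.sum_comm]
    exact Finset.sum_congr rfl fun l _ => Finset.sum_congr rfl fun l' _ => by ring

theorem pidx_output (j i : Fin d) : (pidx m j i : ParamIdx d₀ m d) = Sum.inr (Sum.inr j) := by
  simp [pidx]

/-- `pidx m` ignores its last argument, so the column index of a product that reaches the output is
a dummy; `back` fills it with `j`. -/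
theorem bmat_output (σ : ℝ → ℝ) (θ : Params d₀ m d) (x : EuclideanSpace ℝ (Fin d₀)) {k s : ℕ}
    (h : k + s = m) (j i i' : Fin d) : bmat σ θ x k s j i = bmat σ θ x k s j i' := by
  subst h
  cases s with
  | zero => simp only [bmat, add_zero, pidx, lt_irrefl, dif_neg, not_false_eq_true]
  | succ s =>
    have e : k + s + 1 = k + (s + 1) := by omega
    simp only [bmat, e, pidx_output]

/-- The derivatives of the output of the network with respect to the activations of a layer. -/
def back (σ : ℝ → ℝ) (θ : Params d₀ m d) (x : EuclideanSpace ℝ (Fin d₀)) (k : ℕ) (j : Fin d) : ℝ :=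
  bmat σ θ x k (m - k) j j

theorem back_output (σ : ℝ → ℝ) (θ : Params d₀ m d) (x : EuclideanSpace ℝ (Fin d₀)) (j : Fin d) :
    back σ θ x m j = θ (Sum.inr (Sum.inr j)) := by
  simp only [back, Nat.sub_self, bmat, pidx_output]

theorem back_of_lt (σ : ℝ → ℝ) (θ : Params d₀ m d) (x : EuclideanSpace ℝ (Fin d₀)) {k : ℕ}
    (hk : k < m) (j : Fin d) : back σ θ x k j =
      ∑ i, θ (pidx k j i) * (deriv σ (hid σ θ x (k + 1) i) * back σ θ x (k + 1) i) := by
  obtain ⟨s, hs⟩ : ∃ s, m - k = s + 1 := ⟨m - k - 1, by omega⟩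
  have hs' : m - (k + 1) = s := by omega
  simp only [back, hs, hs', bmat_succ_left]
  refine Finset.sum_congr rfl fun i _ => ?_
  rw [bmat_output σ θ x (by omega : k + 1 + s = m) i j i, mul_assoc]

theorem continuous_bmat {σ : ℝ → ℝ} (hσ : Continuous σ) (hσ' : Continuous (deriv σ))
    (x : EuclideanSpace ℝ (Fin d₀)) (k s : ℕ) (j i : Fin d) :
    Continuous fun θ : Params d₀ m d => bmat σ θ x k s j i := by
  induction s generalizing i with
  | zero => simp only [bmat]; fun_prop
  | succ s ih =>
    simp only [bmat]
    exact continuous_finsetSum _ fun l _ =>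
      ((ih l).mul (hσ'.comp (continuous_hid hσ x _ l))).mul (continuous_apply _)

theorem bmat_congr (σ : ℝ → ℝ) (x : EuclideanSpace ℝ (Fin d₀)) {θ θ' : Params d₀ m d} (k s : ℕ)
    (hk : k + s ≤ m) (h : ∀ p, layer p ≤ k + s + 2 → θ p = θ' p) (j i : Fin d) :
    bmat σ θ x k s j i = bmat σ θ' x k s j i := by
  induction s generalizing i with
  | zero => exact h _ (by rw [layer_pidx (by omega), add_zero])
  | succ s ih =>
    simp only [bmat]
    refine Finset.sum_congr rfl fun l _ => ?_
    rw [ih (by omega) (fun p hp => h p (by omega)) l, h _ (by rw [layer_pidx (by omega)]; omega),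
      hid_congr σ x (k + s + 1) (by omega) fun p hp => h p (by omega)]

variable (σw : ℝ) (ρ : ℕ → Measure ℝ) [∀ l, IsProbabilityMeasure (ρ l)]

theorem lintegral_sum_pidx_pow_four (c : Fin d → ℝ) (k : ℕ) (i : Fin d) :
    ∫⁻ ω : Params d₀ m d × Params d₀ m d, ENNReal.ofReal ((∑ l, c l * ω.1 (pidx k l i)) ^ 4)
      ∂(jointLaw σw ρ d₀ m d) = ENNReal.ofReal (3 * (σw ^ 2 / d * ∑ l, c l * c l) ^ 2) := by
  have h := integral_linForm_pow_four (initVar σw d₀ m d) (pushCoeff (fun l => pidx k l i) c)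
  have hI := integrable_linForm_pow (initVar σw d₀ m d) (pushCoeff (fun l => pidx k l i) c) 4
  rw [linCov_pushCoeff_self _ (pidx_injective k i) _ _ (coe_initVar_pidx σw k · i)] at h
  simp only [sum_pushCoeff] at h hI
  rw [← h, ofReal_integral_eq_lintegral_ofReal hI (Eventually.of_forall fun θ => by positivity),
    ← initLaw_eq]
  exact lintegral_fst_jointLaw (g := fun θ : Params d₀ m d =>
    ENNReal.ofReal ((∑ l, c l * θ (pidx k l i)) ^ 4)) σw ρ (by fun_prop)

/-- Given the earlier layers, an entry is Gaussian with variance `σw ^ 2 / d` times the squared norm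
of a fixed vector, so its fourth moment is three times the square of that variance. Jensen's
inequality turns it into an average of the previous fourth moments. The bound on `deriv σ` makes any
independence of the product from the activations unnecessary. -/
theorem lintegral_bmat_pow_four_le {σ : ℝ → ℝ} (hσ : Continuous σ) (hσ' : Continuous (deriv σ))
    {D : ℝ} (hD : ∀ z, |deriv σ z| ≤ D) (x : EuclideanSpace ℝ (Fin d₀)) (k s : ℕ)
    (hk : k + s ≤ m) (j i : Fin d) :
    ∫⁻ ω, ENNReal.ofReal (bmat σ ω.1 x k s j i ^ 4) ∂(jointLaw σw ρ d₀ m d) ≤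
      ENNReal.ofReal ((1 / d : ℝ) ^ 2 * (3 * σw ^ 4 * (3 * σw ^ 4 * D ^ 4) ^ s)) := by
  have hd : 0 < d := j.pos
  induction s generalizing i with
  | zero =>
    have h := lintegral_sum_pidx_pow_four (d₀ := d₀) (m := m) σw ρ (Pi.single j 1) k i
    simp only [Pi.single_apply, ite_mul, one_mul, zero_mul, Finset.sum_ite_eq', Finset.mem_univ,
      if_true] at h
    simp only [bmat, h]
    exact ENNReal.ofReal_le_ofReal (le_of_eq (by ring))
  | succ s ih =>
    have hm : ∀ l, Measurable fun ω : Params d₀ m d × Params d₀ m d => bmat σ ω.1 x k s j l ^ 4 :=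
      fun l => ((continuous_bmat hσ hσ' x k s j l).measurable.comp measurable_fst).pow_const 4
    -- `k + s + 3` is the layer of the weights `pidx (k + s + 1)`, which are appended last.
    refine (lintegral_le_of_resample σw ρ (k + s + 3) (G := fun ω => 3 * σw ^ 4 * D ^ 4 *
      ((1 / d : ℝ) * ∑ l, bmat σ ω.1 x k s j l ^ 4))
      (((continuous_bmat hσ hσ' x k (s + 1) j i).measurable.comp measurable_fst).pow_const 4)
      fun ω => ?_).trans ?_
    · have h1 : ∀ ω' l, bmat σ (resamplePair (k + s + 3) ω ω').1 x k s j l = bmat σ ω.1 x k s j l :=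
        fun ω' l => bmat_congr σ x k s (by omega) (fun p hp => by
          simp only [resamplePair, resample]; rw [if_neg (by omega)]) j l
      have h2 : ∀ ω' l, hid σ (resamplePair (k + s + 3) ω ω').1 x (k + s + 1) l =
          hid σ ω.1 x (k + s + 1) l := fun ω' l => by
        rw [hid_congr σ x (k + s + 1) (by omega) (fun p hp => by
          simp only [resamplePair, resample]; rw [if_neg (by omega)])]
      have h3 : ∀ ω' l, (resamplePair (k + s + 3) ω ω').1 (pidx (k + s + 1) l i) =
          ω'.1 (pidx (k + s + 1) l i) := fun ω' l => resample_pidx (by omega) _ _ l i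
      simp only [Function.comp_apply, bmat, h1, h2, h3]
      rw [lintegral_sum_pidx_pow_four]
      refine ENNReal.ofReal_le_ofReal ?_
      have hs : ∀ z, deriv σ z ^ 2 ≤ D ^ 2 := fun z => sq_le_sq' (by linarith [abs_le.1 (hD z)])
        (abs_le.1 (hD z)).2
      set c := fun l => bmat σ ω.1 x k s j l with hc
      have hle : (1 / d : ℝ) * ∑ l, c l * deriv σ (hid σ ω.1 x (k + s + 1) l) *
          (c l * deriv σ (hid σ ω.1 x (k + s + 1) l)) ≤ D ^ 2 * ((1 / d : ℝ) * ∑ l, c l ^ 2) := by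
        rw [mul_left_comm, Finset.mul_sum (a := D ^ 2)]
        refine mul_le_mul_of_nonneg_left (Finset.sum_le_sum fun l _ => ?_) (by positivity)
        nlinarith [mul_le_mul_of_nonneg_left (hs (hid σ ω.1 x (k + s + 1) l)) (sq_nonneg (c l))]
      have h0 : 0 ≤ (1 / d : ℝ) * ∑ l, c l * deriv σ (hid σ ω.1 x (k + s + 1) l) *
          (c l * deriv σ (hid σ ω.1 x (k + s + 1) l)) :=
        mul_nonneg (by positivity) (Finset.sum_nonneg fun l _ => mul_self_nonneg _)
      have hsq := sq_average_le fun l => c l ^ 2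
      calc _ = 3 * σw ^ 4 * ((1 / d : ℝ) * ∑ l, c l * deriv σ (hid σ ω.1 x (k + s + 1) l) *
            (c l * deriv σ (hid σ ω.1 x (k + s + 1) l))) ^ 2 := by ring
        _ ≤ 3 * σw ^ 4 * (D ^ 2 * ((1 / d : ℝ) * ∑ l, c l ^ 2)) ^ 2 :=
          mul_le_mul_of_nonneg_left (pow_le_pow_left₀ h0 hle 2) (by positivity)
        _ = 3 * σw ^ 4 * D ^ 4 * ((1 / d : ℝ) * ∑ l, c l ^ 2) ^ 2 := by ring
        _ ≤ 3 * σw ^ 4 * D ^ 4 * ((1 / d : ℝ) * ∑ l, (c l ^ 2) ^ 2) :=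
          mul_le_mul_of_nonneg_left hsq (by positivity)
        _ = _ := by simp only [← pow_mul]; rfl
    · rw [lintegral_ofReal_const_mul _ (by positivity)]
      calc _ ≤ ENNReal.ofReal (3 * σw ^ 4 * D ^ 4) *
            ENNReal.ofReal ((1 / d : ℝ) ^ 2 * (3 * σw ^ 4 * (3 * σw ^ 4 * D ^ 4) ^ s)) :=
          mul_le_mul_right (lintegral_average_le (jointLaw σw ρ d₀ m d) hd hm
            (fun l ω => by positivity) fun l => ih (by omega) l) _
        _ = _ := by
          rw [← ENNReal.ofReal_mul (by positivity)]
          congr 1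
          ring

variable {σw ρ}

theorem measurable_back {σ : ℝ → ℝ} (hσ : Continuous σ) (hσ' : Continuous (deriv σ))
    (x : EuclideanSpace ℝ (Fin d₀)) (k : ℕ) (j : Fin d) :
    Measurable fun ω : Params d₀ m d × Params d₀ m d => back σ ω.1 x k j :=
  (continuous_bmat hσ hσ' x k (m - k) j j).measurable.comp measurable_fst

/-- The sum has `d` terms of mean O(d⁻²). Squares would only give a sum of order one; fourth powers
make the largest derivative small, as `negligible_back` requires. -/
theorem vanishInMean_sum_back_pow_four {σ : ℝ → ℝ} (hσ : Continuous σ)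
    (hσ' : Continuous (deriv σ)) {D : ℝ} (hD : ∀ z, |deriv σ z| ≤ D)
    (x : EuclideanSpace ℝ (Fin d₀)) {k : ℕ} (hk : k ≤ m) :
    VanishInMean (fun d => jointLaw σw ρ d₀ m d) fun _ ω => ∑ j, back σ ω.1 x k j ^ 4 := by
  set C := 3 * σw ^ 4 * (3 * σw ^ 4 * D ^ 4) ^ (m - k)
  have hlim : VanishInMean (fun d => jointLaw σw ρ d₀ m d) fun d _ => (1 / d : ℝ) * C :=
    vanishInMean_const (by simpa using tendsto_one_div_nat.mul_const C)
  refine hlim.mono ?_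
  filter_upwards [eventually_gt_atTop 0] with d hd
  have hd' : (d : ℝ) ≠ 0 := by positivity
  have h := lintegral_average_le (jointLaw σw ρ d₀ m d) hd
    (F := fun j ω => (d : ℝ) * back σ ω.1 x k j ^ 4)
    (fun j => ((measurable_back hσ hσ' x k j).pow_const 4).const_mul _)
    (fun j ω => by positivity) (C := ENNReal.ofReal ((1 / d : ℝ) * C)) fun j => by
      rw [lintegral_ofReal_const_mul _ (by positivity)]
      calc _ ≤ ENNReal.ofReal d * ENNReal.ofReal ((1 / d : ℝ) ^ 2 * C) :=
            mul_le_mul_right (lintegral_bmat_pow_four_le σw ρ hσ hσ' hD x k (m - k) (by omega) j j) _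
        _ = _ := by
            rw [← ENNReal.ofReal_mul (by positivity)]
            congr 1
            field_simp
  refine le_trans (le_of_eq ?_) (h.trans (by simp))
  refine lintegral_congr fun ω => ?_
  rw [← Finset.mul_sum]
  congr 1
  field_simp

end Backward

/-! ### Euclidean and operator norms of finite families -/

section Norm

variable {ι κ : Type*} [Fintype ι] [Fintype κ]

/-- The Euclidean norm of a finite family of real numbers. -/
def nrm (v : ι → ℝ) : ℝ := √(∑ i, v i ^ 2)

theorem norm_toLp (v : ι → ℝ) : ‖(WithLp.toLp 2 v : EuclideanSpace ℝ ι)‖ = nrm v := by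
  simp [EuclideanSpace.norm_eq, nrm]

theorem nrm_eq_norm (v : EuclideanSpace ℝ ι) : nrm (fun i => v i) = ‖v‖ := by
  simp [EuclideanSpace.norm_eq, nrm]

theorem nrm_nonneg (v : ι → ℝ) : 0 ≤ nrm v := Real.sqrt_nonneg _

theorem nrm_sq (v : ι → ℝ) : nrm v ^ 2 = ∑ i, v i ^ 2 :=
  Real.sq_sqrt (Finset.sum_nonneg fun _ _ => sq_nonneg _)

theorem nrm_add_le (v w : ι → ℝ) : nrm (fun i => v i + w i) ≤ nrm v + nrm w := by
  rw [← norm_toLp, ← norm_toLp, ← norm_toLp]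
  exact norm_add_le (WithLp.toLp 2 v : EuclideanSpace ℝ ι) (WithLp.toLp 2 w)

theorem nrm_const_mul (c : ℝ) (v : ι → ℝ) : nrm (fun i => c * v i) = |c| * nrm v := by
  simp only [nrm, mul_pow, ← Finset.mul_sum]
  rw [Real.sqrt_mul (sq_nonneg c), Real.sqrt_sq_eq_abs]

theorem nrm_mono {v w : ι → ℝ} (h : ∀ i, |v i| ≤ |w i|) : nrm v ≤ nrm w :=
  Real.sqrt_le_sqrt (Finset.sum_le_sum fun i _ => sq_le_sq.2 (h i))

theorem abs_le_nrm (v : ι → ℝ) (i : ι) : |v i| ≤ nrm v := by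
  rw [nrm, ← Real.sqrt_sq_eq_abs]
  exact Real.sqrt_le_sqrt (Finset.single_le_sum (f := fun i => v i ^ 2)
    (fun _ _ => sq_nonneg _) (Finset.mem_univ i))

theorem nrm_le_of_sq_le {v : ι → ℝ} {b : ℝ} (hb : 0 ≤ b) (h : ∑ i, v i ^ 2 ≤ b ^ 2) : nrm v ≤ b :=
  Real.sqrt_le_iff.2 ⟨hb, h⟩

theorem abs_sum_mul_le (v w : ι → ℝ) : |∑ i, v i * w i| ≤ nrm v * nrm w := by
  refine abs_le_of_sq_le_sq ?_ (mul_nonneg (nrm_nonneg v) (nrm_nonneg w))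
  rw [mul_pow, nrm_sq, nrm_sq]
  exact Finset.sum_mul_sq_le_sq_mul_sq _ _ _

theorem nrm_eq_zero {v : ι → ℝ} (h : nrm v = 0) (i : ι) : v i = 0 :=
  abs_eq_zero.1 (le_antisymm (h ▸ abs_le_nrm v i) (abs_nonneg _))

theorem nrm_one : nrm (fun _ : ι => (1 : ℝ)) = √(Fintype.card ι) := by simp [nrm]

theorem nrm_outer (v : ι → ℝ) (w : κ → ℝ) : nrm (fun p : ι × κ => v p.1 * w p.2) = nrm v * nrm w := by
  rw [nrm, nrm, nrm, ← Real.sqrt_mul (Finset.sum_nonneg fun _ _ => sq_nonneg _),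
    Fintype.sum_prod_type, Finset.sum_mul_sum]
  simp only [mul_pow]

/-- The Frobenius norm bounds the operator norm. -/
theorem nrm_vecMul_le (v : ι → ℝ) (W : ι → κ → ℝ) :
    nrm (fun i => ∑ j, v j * W j i) ≤ nrm v * nrm fun p : ι × κ => W p.1 p.2 := by
  refine nrm_le_of_sq_le (mul_nonneg (nrm_nonneg _) (nrm_nonneg _)) ?_
  rw [mul_pow, nrm_sq, nrm_sq, Fintype.sum_prod_type_right, Finset.mul_sum]
  exact Finset.sum_le_sum fun i _ => Finset.sum_mul_sq_le_sq_mul_sq _ _ _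

/-- The operator norm of `v ↦ v W` is at most `B`. -/
def OpBound (W : ι → κ → ℝ) (B : ℝ) : Prop :=
  ∀ v : ι → ℝ, nrm (fun i => ∑ j, v j * W j i) ≤ B * nrm v

/-- Duality: for `w = W u` one has `‖w‖² = ⟨w W, u⟩ ≤ B ‖w‖ ‖u‖`. -/
theorem OpBound.transpose {W : ι → κ → ℝ} {B : ℝ} (hB : 0 ≤ B) (h : OpBound W B) (u : κ → ℝ) :
    nrm (fun j => ∑ i, W j i * u i) ≤ B * nrm u := by
  set w := fun j => ∑ i, W j i * u i with hw
  have h1 : nrm w ^ 2 ≤ B * nrm w * nrm u := by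
    have : nrm w ^ 2 = ∑ i, (∑ j, w j * W j i) * u i := by
      rw [nrm_sq]
      simp only [Finset.sum_mul]
      rw [Finset.sum_comm]
      refine Finset.sum_congr rfl fun j _ => ?_
      rw [sq]
      nth_rw 2 [hw]
      simp only [Finset.mul_sum, mul_assoc]
    rw [this]
    exact (le_abs_self _).trans ((abs_sum_mul_le _ _).trans
      (mul_le_mul_of_nonneg_right (h w) (nrm_nonneg u)))
  rcases (nrm_nonneg w).eq_or_lt with h0 | h0
  · rw [← h0]
    exact mul_nonneg hB (nrm_nonneg u)
  · nlinarith

end Norm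

/-! ### Operator norms of Gaussian matrices by a volume argument -/

section OperatorNorm
open Topology

/-- If a seminorm on Euclidean space exceeds `B` at a unit vector, then it is at least `B / 2` on a
nonnegligible part of the unit ball. -/
theorem volume_closedBall_le_of_lt_seminorm {d : ℕ} (F : Seminorm ℝ (EuclideanSpace ℝ (Fin d)))
    {B : ℝ} {v : EuclideanSpace ℝ (Fin d)} (hv : ‖v‖ = 1) (hB : B < F v) :
    ENNReal.ofReal ((1 / 2) ^ d) * volume (Metric.closedBall (0 : EuclideanSpace ℝ (Fin d)) 1) ≤
      2 * volume (Metric.closedBall (0 : EuclideanSpace ℝ (Fin d)) 1 ∩ {u | B / 2 ≤ F u}) := by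
  have hhalf : volume (Metric.closedBall (0 : EuclideanSpace ℝ (Fin d)) (1 / 2)) =
      ENNReal.ofReal ((1 / 2) ^ d) *
        volume (Metric.closedBall (0 : EuclideanSpace ℝ (Fin d)) 1) := by
    have := Measure.addHaar_closedBall_mul (volume : Measure (EuclideanSpace ℝ (Fin d))) 0
      (r := 1 / 2) (by norm_num) (s := 1) (by norm_num)
    rwa [mul_one, finrank_euclideanSpace_fin] at this
  -- The two shifts of `w` lie in the unit ball and differ by `v`. If the seminorm were below `B /
  -- 2` at both, it would be below `B` at `v`.
  have hcover : Metric.closedBall (0 : EuclideanSpace ℝ (Fin d)) (1 / 2) ⊆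
      (fun w => w + (1 / 2 : ℝ) • v) ⁻¹' (Metric.closedBall 0 1 ∩ {u | B / 2 ≤ F u}) ∪
      (fun w => w + (-(1 / 2 : ℝ)) • v) ⁻¹' (Metric.closedBall 0 1 ∩ {u | B / 2 ≤ F u}) := by
    intro w hw
    have hw' : ‖w‖ ≤ 1 / 2 := mem_closedBall_zero_iff.1 hw
    have hin : ∀ c : ℝ, |c| = 1 / 2 →
        w + c • v ∈ Metric.closedBall (0 : EuclideanSpace ℝ (Fin d)) 1 := fun c hc => by
      rw [mem_closedBall_zero_iff]
      refine (norm_add_le _ _).trans ?_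
      rw [norm_smul, hv, Real.norm_eq_abs, hc]
      linarith
    have h1 := hin (1 / 2) (by norm_num)
    have h2 := hin (-(1 / 2)) (by norm_num)
    by_contra hcon
    simp only [Set.mem_union, Set.mem_preimage, Set.mem_inter_iff, h1, h2, true_and,
      Set.mem_ofPred_eq, not_or, not_le] at hcon
    have h3 := map_add_le_add F (w + (1 / 2 : ℝ) • v) ((-1 : ℝ) • (w + (-(1 / 2 : ℝ)) • v))
    have e : (w + (1 / 2 : ℝ) • v) + ((-1 : ℝ) • (w + (-(1 / 2 : ℝ)) • v)) = v := by module
    rw [e, map_smul_eq_mul, norm_neg, norm_one, one_mul] at h3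
    linarith [hcon.1, hcon.2]
  rw [← hhalf]
  refine (measure_mono hcover).trans ((measure_union_le _ _).trans ?_)
  rw [measure_preimage_add_right, measure_preimage_add_right, two_mul]

/-- The seminorm `u ↦ ‖u W‖`. -/
def vecMulSeminorm {d : ℕ} (W : Fin d → Fin d → ℝ) : Seminorm ℝ (EuclideanSpace ℝ (Fin d)) :=
  Seminorm.of (fun u => nrm fun i => ∑ j, u j * W j i)
    (fun u w => by
      refine le_trans (le_of_eq ?_) (nrm_add_le _ _)
      simp only [PiLp.add_apply, add_mul, Finset.sum_add_distrib])
    (fun c u => by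
      rw [Real.norm_eq_abs, ← nrm_const_mul]
      simp only [PiLp.smul_apply, smul_eq_mul, Finset.mul_sum, mul_assoc])

theorem vecMulSeminorm_apply {d : ℕ} (W : Fin d → Fin d → ℝ) (u : EuclideanSpace ℝ (Fin d)) :
    vecMulSeminorm W u = nrm fun i => ∑ j, u j * W j i := rfl

theorem exists_unit_of_not_opBound {d : ℕ} {W : Fin d → Fin d → ℝ} {B : ℝ} (h : ¬ OpBound W B) :
    ∃ v : EuclideanSpace ℝ (Fin d), ‖v‖ = 1 ∧ B < vecMulSeminorm W v := by
  simp only [OpBound, not_forall, not_le] at h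
  obtain ⟨u, hu⟩ := h
  have hu0 : 0 < nrm u := by
    refine (nrm_nonneg u).lt_of_ne fun h0 => ?_
    have : ∀ j, u j = 0 := nrm_eq_zero h0.symm
    simp [this, nrm] at hu
  refine ⟨(nrm u)⁻¹ • WithLp.toLp 2 u, ?_, ?_⟩
  · rw [norm_smul, norm_toLp, Real.norm_of_nonneg (inv_nonneg.2 hu0.le), inv_mul_cancel₀ hu0.ne']
  · rw [map_smul_eq_mul, Real.norm_of_nonneg (inv_nonneg.2 hu0.le), inv_mul_eq_div,
      lt_div_iff₀ hu0]
    exact hu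

/-- Volume takes the place of a net: a matrix violating the bound spoils at least the fraction `2 ^
-(d + 1)` of the unit ball, whereas by Fubini the expected spoiled fraction is at most `q`. Markov's
inequality compares the two. -/
theorem measure_not_opBound_le {Ω : Type*} [MeasurableSpace Ω] (P : Measure Ω) [SFinite P] {d : ℕ}
    {W : Ω → Fin d → Fin d → ℝ} (hW : ∀ j i, Measurable fun ω => W ω j i) {B : ℝ} {q : ENNReal}
    (h : ∀ u : Fin d → ℝ, nrm u ≤ 1 → P {ω | B / 2 ≤ nrm (fun i => ∑ j, u j * W ω j i)} ≤ q) :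
    P {ω | ¬ OpBound (W ω) B} ≤ 2 ^ (d + 1) * q := by
  obtain ⟨K, hK⟩ : ∃ K : Set (EuclideanSpace ℝ (Fin d)), K = Metric.closedBall 0 1 := ⟨_, rfl⟩
  have hKm : MeasurableSet K := hK ▸ Metric.isClosed_closedBall.measurableSet
  have hFm : Measurable fun p : Ω × EuclideanSpace ℝ (Fin d) => vecMulSeminorm (W p.1) p.2 := by
    simp only [vecMulSeminorm_apply, nrm]
    refine Measurable.sqrt (Finset.measurable_fun_sum _ fun i _ => Measurable.pow_const
      (Finset.measurable_fun_sum _ fun j _ => Measurable.mul (by fun_prop)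
        ((hW j i).comp measurable_fst)) 2)
  have hSm : MeasurableSet {p : Ω × EuclideanSpace ℝ (Fin d) |
      p.2 ∈ K ∧ B / 2 ≤ vecMulSeminorm (W p.1) p.2} :=
    (measurable_snd hKm).inter (measurableSet_le measurable_const hFm)
  obtain ⟨Z, hZ⟩ : ∃ Z : Ω → ENNReal, ∀ ω, Z ω = volume (K ∩ {u | B / 2 ≤ vecMulSeminorm (W ω) u}) :=
    ⟨_, fun _ => rfl⟩
  have hbad : ∀ ω, ¬ OpBound (W ω) B → ENNReal.ofReal ((1 / 2) ^ d) * volume K ≤ 2 * Z ω := by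
    intro ω hω
    obtain ⟨v, hv, hvB⟩ := exists_unit_of_not_opBound hω
    rw [hZ, hK]
    exact volume_closedBall_le_of_lt_seminorm _ hv hvB
  have hZm : Measurable Z := by
    rw [funext hZ]
    exact measurable_measure_prodMk_left hSm
  have hZint : ∫⁻ ω, Z ω ∂P ≤ q * volume K := by
    have h1 : ∫⁻ ω, Z ω ∂P = (P.prod (volume : Measure (EuclideanSpace ℝ (Fin d))))
        {p | p.2 ∈ K ∧ B / 2 ≤ vecMulSeminorm (W p.1) p.2} := by
      rw [Measure.prod_apply hSm, funext hZ]; rfl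
    rw [h1, Measure.prod_apply_symm hSm, ← lintegral_indicator_const hKm]
    refine lintegral_mono fun u => ?_
    by_cases hu : u ∈ K
    · rw [Set.indicator_of_mem hu]
      refine (measure_mono fun ω hω => hω.2).trans (h (fun i => u i) ?_)
      rw [nrm_eq_norm]
      exact mem_closedBall_zero_iff.1 (hK ▸ hu)
    · rw [Set.indicator_of_notMem hu]
      exact le_of_eq (measure_mono_null (fun ω hω => hu hω.1) measure_empty)
  have hmark := mul_meas_ge_le_lintegral₀ (μ := P) (hZm.const_mul 2).aemeasurable
    (ENNReal.ofReal ((1 / 2) ^ d) * volume K)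
  rw [lintegral_const_mul _ hZm] at hmark
  have hV0 : volume K ≠ 0 := hK ▸ (Metric.measure_closedBall_pos _ _ one_pos).ne'
  have hVt : volume K ≠ ⊤ := hK ▸ measure_closedBall_lt_top.ne
  obtain ⟨p, hp⟩ : ∃ p, p = P {ω | ¬ OpBound (W ω) B} := ⟨_, rfl⟩
  have h2 : ENNReal.ofReal ((1 / 2) ^ d) * volume K * p ≤ 2 * (q * volume K) :=
    (mul_le_mul_right (hp.le.trans (measure_mono hbad)) _).trans
      (hmark.trans (mul_le_mul_right hZint _))
  have h3 : ENNReal.ofReal ((1 / 2) ^ d) * p ≤ 2 * q := by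
    rw [← ENNReal.mul_le_mul_iff_left hV0 hVt]
    calc _ = ENNReal.ofReal ((1 / 2) ^ d) * volume K * p := by ring
      _ ≤ _ := h2
      _ = _ := by ring
  have h4 : (2 : ENNReal) ^ d * ENNReal.ofReal ((1 / 2) ^ d) = 1 := by
    have : (2 : ENNReal) ^ d = ENNReal.ofReal (2 ^ d) := by
      rw [ENNReal.ofReal_pow (by norm_num)]; simp
    rw [this, ← ENNReal.ofReal_mul (by positivity), ← mul_pow]
    norm_num
  rw [← hp]
  calc p = 2 ^ d * (ENNReal.ofReal ((1 / 2) ^ d) * p) := by rw [← mul_assoc, h4, one_mul]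
    _ ≤ 2 ^ d * (2 * q) := mul_le_mul_right h3 _
    _ = _ := by ring

/-- Some exponential moment of the square of a centred Gaussian variable of small variance is
bounded. -/
theorem exists_integral_exp_sq_gaussianReal_le : ∃ c M : ℝ, 0 < c ∧ ∀ (v : NNReal) (t : ℝ), 0 ≤ t →
    t * v ≤ c → Integrable (fun x => Real.exp (t * x ^ 2)) (gaussianReal 0 v) ∧
      ∫ x, Real.exp (t * x ^ 2) ∂(gaussianReal 0 v) ≤ M := by
  obtain ⟨c, hc, hint⟩ := IsGaussian.exists_integrable_exp_sq (gaussianReal 0 1)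
  refine ⟨c, ∫ x, Real.exp (c * ‖x‖ ^ 2) ∂(gaussianReal 0 1), hc, fun v t ht htv => ?_⟩
  have hle : ∀ x : ℝ, Real.exp (t * (√(v : ℝ) * x) ^ 2) ≤ Real.exp (c * ‖x‖ ^ 2) := fun x => by
    rw [Real.exp_le_exp, mul_pow, Real.sq_sqrt v.coe_nonneg, ← mul_assoc, Real.norm_eq_abs, sq_abs]
    exact mul_le_mul_of_nonneg_right htv (sq_nonneg x)
  have hint' : Integrable (fun x : ℝ => Real.exp (t * (√(v : ℝ) * x) ^ 2)) (gaussianReal 0 1) :=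
    hint.mono' (by fun_prop) (Eventually.of_forall fun x => by
      rw [Real.norm_of_nonneg (Real.exp_nonneg _)]; exact hle x)
  rw [gaussianReal_eq_map_std v]
  refine ⟨(integrable_map_measure (by fun_prop) (by fun_prop)).2 hint', ?_⟩
  rw [integral_map (by fun_prop) (by fun_prop)]
  exact integral_mono hint' hint hle

theorem iIndepFun_linForm {ι κ : Type*} [Fintype ι] [Fintype κ] (v : ι → NNReal)
    (u : κ → ι → ℝ) (h : ∀ a b, a ≠ b → linCov v (u a) (u b) = 0) :
    iIndepFun (fun a (θ : ι → ℝ) => ∑ p, u a p * θ p) (gaussPi v) := by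
  have hL := (hasGaussianLaw_gaussPi v).map_fun (ContinuousLinearMap.pi fun a =>
    ∑ p, u a p • ContinuousLinearMap.proj (R := ℝ) (φ := fun _ : ι => ℝ) p)
  have hL2 : HasGaussianLaw (fun (θ : ι → ℝ) a => ∑ p, u a p * θ p) (gaussPi v) := by
    have e : (fun (θ : ι → ℝ) a => ∑ p, u a p * θ p) = fun θ => (ContinuousLinearMap.pi fun a =>
        ∑ p, u a p • ContinuousLinearMap.proj (R := ℝ) (φ := fun _ : ι => ℝ) p) θ := by
      funext θ a
      simp
    rw [e]
    exact hL
  exact hL2.iIndepFun_of_covariance_eq_zero fun a b hab => by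
    rw [covariance_linForm, h a b hab]

/-- Chernoff's bound for a sum of squares of independent Gaussians. The constants do not depend on
the dimension, and `t` may grow with `d` as long as `t` times each variance stays below `c`. -/
theorem exists_gaussPi_sum_sq_ge_le : ∃ c M : ℝ, 0 < c ∧ 0 ≤ M ∧ ∀ {ι : Type} [Fintype ι] {d : ℕ}
    (v : ι → NNReal) (u : Fin d → ι → ℝ) (_ : ∀ a b, a ≠ b → linCov v (u a) (u b) = 0) (t s : ℝ),
    0 ≤ t → (∀ a, t * linCov v (u a) (u a) ≤ c) →
    gaussPi v {θ | s ≤ ∑ a, (∑ p, u a p * θ p) ^ 2} ≤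
      ENNReal.ofReal (Real.exp (-t * s) * M ^ d) := by
  obtain ⟨c, M, hc, h⟩ := exists_integral_exp_sq_gaussianReal_le
  have hM : 0 ≤ M := (integral_nonneg fun x => (Real.exp_nonneg _)).trans (h 0 0 le_rfl (by simpa using hc.le)).2
  refine ⟨c, M, hc, hM, fun v u hu t s ht htc => ?_⟩
  have hind : iIndepFun (fun a (θ : _ → ℝ) => (∑ p, u a p * θ p) ^ 2) (gaussPi v) :=
    (iIndepFun_linForm v u hu).comp (fun _ x => x ^ 2) (fun _ => by fun_prop)
  have hm : ∀ a, Measurable fun θ : _ → ℝ => (∑ p, u a p * θ p) ^ 2 := fun a => by fun_prop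
  have hone : ∀ a, Integrable (fun θ => Real.exp (t * (∑ p, u a p * θ p) ^ 2)) (gaussPi v) ∧
      ∫ θ, Real.exp (t * (∑ p, u a p * θ p) ^ 2) ∂(gaussPi v) ≤ M := by
    intro a
    have h1 := h (linCov v (u a) (u a)).toNNReal t ht (by
      rw [Real.coe_toNNReal _ (linCov_self_nonneg v (u a))]; exact htc a)
    rw [← map_linForm_eq_gaussianReal] at h1
    rw [integrable_map_measure (by fun_prop) (measurable_linForm _).aemeasurable,
      integral_map (measurable_linForm _).aemeasurable (by fun_prop)] at h1
    exact h1
  have hint := hind.integrable_exp_mul_sum hm (s := Finset.univ) (t := t) fun a _ => (hone a).1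
  have hch := measure_ge_le_exp_mul_mgf s ht hint
  rw [hind.mgf_sum hm] at hch
  have hset : {θ : _ → ℝ | s ≤ ∑ a, (∑ p, u a p * θ p) ^ 2} =
      {θ : _ → ℝ | s ≤ (∑ a, fun θ : _ → ℝ => (∑ p, u a p * θ p) ^ 2) θ} := by
    ext θ; simp
  rw [hset, ← ofReal_measureReal]
  refine ENNReal.ofReal_le_ofReal (hch.trans ?_)
  refine mul_le_mul_of_nonneg_left ?_ (Real.exp_nonneg _)
  calc _ ≤ ∏ _a : Fin _, M := Finset.prod_le_prod (fun a _ => mgf_nonneg) fun a _ => (hone a).2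
    _ = _ := by simp

variable {d₀ m : ℕ} (σw : ℝ) (ρ : ℕ → Measure ℝ) [∀ l, IsProbabilityMeasure (ρ l)]

/-- With high probability the operator norms of the hidden weight matrices are bounded. -/
theorem exists_opBound_initLaw (hσw : 0 < σw) : ∃ B₀ : ℝ, ∀ B ≥ B₀, ∀ k < m, ∀ δ : ℝ, 0 < δ →
    ∀ᶠ d : ℕ in atTop, jointLaw σw ρ d₀ m d
      {ω | ¬ OpBound (fun j i : Fin d => ω.1 (pidx k j i)) B} ≤ ENNReal.ofReal δ := by
  obtain ⟨c, M, hc, hM, h⟩ := exists_gaussPi_sum_sq_ge_le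
  -- The volume argument costs `2 ^ (d + 1)`, so a tail of `(1 / 4) ^ d` is wanted; this `τ` makes
  -- `exp (-τ) * M ≤ 1 / 4`.
  obtain ⟨τ, hτ⟩ : ∃ τ : ℝ, 4 * (M + 1) < Real.exp τ := by
    obtain ⟨τ, hτ⟩ := (Real.tendsto_exp_atTop.eventually (eventually_gt_atTop (4 * (M + 1)))).exists
    exact ⟨τ, hτ⟩
  -- The second entry makes `c / σw ^ 2 * (B / 2) ^ 2` at least `τ`; the first allows `B` to be
  -- replaced by `B ^ 2` in that estimate.
  refine ⟨max 1 (4 * σw ^ 2 * max τ 0 / c), fun B hB k hk δ hδ => ?_⟩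
  have hB1 : 1 ≤ B := (le_max_left _ _).trans hB
  have hB2 : 4 * σw ^ 2 * max τ 0 / c ≤ B := (le_max_right _ _).trans hB
  have hlim : Tendsto (fun d : ℕ => 2 * (1 / 2 : ℝ) ^ d) atTop (𝓝 0) := by
    simpa using (tendsto_pow_atTop_nhds_zero_of_lt_one (by norm_num : (0 : ℝ) ≤ 1 / 2)
      (by norm_num)).const_mul 2
  filter_upwards [hlim.eventually (ge_mem_nhds hδ), eventually_gt_atTop 0] with d hd hd0
  have hd0' : (0 : ℝ) < d := by positivity
  have hq : ∀ u : Fin d → ℝ, nrm u ≤ 1 → jointLaw σw ρ d₀ m d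
      {ω | B / 2 ≤ nrm (fun i => ∑ j, u j * ω.1 (pidx k j i))} ≤
      ENNReal.ofReal ((1 / 4) ^ d) := by
    intro u hu
    have hle := h (initVar σw d₀ m d) (fun i => pushCoeff (fun j => pidx k j i) u)
      (fun i i' hi => linCov_pushCoeff_disjoint _ (fun j j' => pidx_ne hk hi j j') _ _)
      -- The exponent grows with `d`: for `u` in the unit ball each coordinate has variance at most
      -- `σw ^ 2 / d`, so the product stays below `c`.
      (c * d / σw ^ 2) ((B / 2) ^ 2) (by positivity) (fun i => by
        rw [linCov_pushCoeff_self _ (pidx_injective k i) _ _ (coe_initVar_pidx σw k · i)]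
        have : ∑ j, u j * u j ≤ 1 := by
          have := nrm_sq u
          simp only [sq] at this
          rw [← this]
          nlinarith [nrm_nonneg u]
        calc _ = c * ∑ j, u j * u j := by field_simp
          _ ≤ c * 1 := by gcongr
          _ = c := mul_one c)
    simp only [sum_pushCoeff] at hle
    have hset : MeasurableSet {θ : Params d₀ m d | (B / 2) ^ 2 ≤
        ∑ i, (∑ j, u j * θ (pidx k j i)) ^ 2} :=
      measurableSet_le measurable_const (by fun_prop)
    have hpre : jointLaw σw ρ d₀ m d {ω | B / 2 ≤ nrm (fun i => ∑ j, u j * ω.1 (pidx k j i))} ≤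
        gaussPi (initVar σw d₀ m d) {θ | (B / 2) ^ 2 ≤ ∑ i, (∑ j, u j * θ (pidx k j i)) ^ 2} := by
      rw [← initLaw_eq, ← (measurePreserving_fst (μ := initLaw σw d₀ m d)
        (ν := rateLaw ρ d₀ m d)).measure_preimage hset.nullMeasurableSet]
      refine measure_mono fun ω hω => ?_
      simp only [Set.mem_ofPred_eq, Set.mem_preimage] at hω ⊢
      rw [← nrm_sq fun i => ∑ j, u j * ω.1 (pidx k j i)]
      exact pow_le_pow_left₀ (by linarith) hω 2
    refine hpre.trans (hle.trans (ENNReal.ofReal_le_ofReal ?_))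
    have hexp : Real.exp (-(c * d / σw ^ 2) * (B / 2) ^ 2) ≤ Real.exp (-τ) ^ d := by
      rw [← Real.exp_nat_mul, Real.exp_le_exp]
      have h1 : 4 * σw ^ 2 * max τ 0 ≤ B * c := by rwa [div_le_iff₀ hc] at hB2
      have h2 : 4 * σw ^ 2 * τ ≤ B ^ 2 * c := by
        have : 4 * σw ^ 2 * τ ≤ 4 * σw ^ 2 * max τ 0 := by gcongr; exact le_max_left _ _
        nlinarith [mul_nonneg (by linarith : 0 ≤ B) hc.le]
      have h3 : τ ≤ c / σw ^ 2 * (B / 2) ^ 2 := by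
        rw [div_mul_eq_mul_div, le_div_iff₀ (by positivity)]
        nlinarith
      calc -(c * d / σw ^ 2) * (B / 2) ^ 2 = d * -(c / σw ^ 2 * (B / 2) ^ 2) := by ring
        _ ≤ d * -τ := by gcongr
    calc _ ≤ Real.exp (-τ) ^ d * M ^ d := by gcongr
      _ = (Real.exp (-τ) * M) ^ d := (mul_pow _ _ _).symm
      _ ≤ (1 / 4) ^ d := by
        refine pow_le_pow_left₀ (by positivity) ?_ d
        rw [Real.exp_neg, inv_mul_le_iff₀ (Real.exp_pos _)]
        linarith
  refine (measure_not_opBound_le (jointLaw σw ρ d₀ m d)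
    (W := fun ω j i => ω.1 (pidx k j i)) (fun j i => by fun_prop) hq).trans ?_
  have e : (2 : ENNReal) ^ (d + 1) = ENNReal.ofReal (2 ^ (d + 1)) := by
    rw [ENNReal.ofReal_pow (by norm_num)]; simp
  rw [e, ← ENNReal.ofReal_mul (by positivity)]
  refine ENNReal.ofReal_le_ofReal (le_trans (le_of_eq ?_) hd)
  rw [pow_succ, mul_comm ((2 : ℝ) ^ d), mul_assoc, ← mul_pow]
  norm_num

end OperatorNorm

/-! ### Back-propagation and the tangent kernel -/

section Gradient

variable {d₀ m d : ℕ}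

/-- The linear form with the given coefficients. -/
def dotCLM {ι : Type*} [Fintype ι] (g : ι → ℝ) : (ι → ℝ) →L[ℝ] ℝ :=
  ∑ p, g p • ContinuousLinearMap.proj (R := ℝ) (φ := fun _ : ι => ℝ) p

theorem dotCLM_apply {ι : Type*} [Fintype ι] (g ξ : ι → ℝ) : dotCLM g ξ = ∑ p, g p * ξ p := by
  simp [dotCLM]

/-- The derivatives of the output of the network with respect to the pre-activations of a layer. -/
def delta (σ : ℝ → ℝ) (θ : Params d₀ m d) (x : EuclideanSpace ℝ (Fin d₀)) (k : ℕ) (i : Fin d) : ℝ :=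
  deriv σ (hid σ θ x k i) * back σ θ x k i

/-- The gradient of the network in its parameters, by backpropagation. -/
def grad (σ : ℝ → ℝ) (θ : Params d₀ m d) (x : EuclideanSpace ℝ (Fin d₀)) : ParamIdx d₀ m d → ℝ
  | Sum.inl q => x q.1 * delta σ θ x 0 q.2
  | Sum.inr (Sum.inl q) => σ (hid σ θ x q.1 q.2.1) * delta σ θ x (q.1 + 1) q.2.2
  | Sum.inr (Sum.inr i) => σ (hid σ θ x m i)

/-- The derivatives of the pre-activations in the parameters. -/
def dhid (σ : ℝ → ℝ) (θ : Params d₀ m d) (x : EuclideanSpace ℝ (Fin d₀)) :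
    ℕ → Fin d → (Params d₀ m d →L[ℝ] ℝ)
  | 0 => fun i => ∑ j, x j • ContinuousLinearMap.proj (R := ℝ) (φ := fun _ => ℝ) (Sum.inl (j, i))
  | k + 1 => fun i => ∑ j, (σ (hid σ θ x k j) •
        ContinuousLinearMap.proj (R := ℝ) (φ := fun _ => ℝ) (pidx k j i) +
      θ (pidx k j i) • (deriv σ (hid σ θ x k j) • dhid σ θ x k j))

theorem hasFDerivAt_proj {ι : Type*} [Fintype ι] (p : ι) (θ : ι → ℝ) :
    HasFDerivAt (fun θ : ι → ℝ => θ p) (ContinuousLinearMap.proj (R := ℝ) (φ := fun _ => ℝ) p) θ :=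
  (ContinuousLinearMap.proj (R := ℝ) (φ := fun _ : ι => ℝ) p).hasFDerivAt

theorem hasFDerivAt_hid {σ : ℝ → ℝ} (hσ : Differentiable ℝ σ) (θ : Params d₀ m d)
    (x : EuclideanSpace ℝ (Fin d₀)) (k : ℕ) (i : Fin d) :
    HasFDerivAt (fun θ : Params d₀ m d => hid σ θ x k i) (dhid σ θ x k i) θ := by
  induction k generalizing i with
  | zero =>
    simp only [hid, dhid]
    exact HasFDerivAt.fun_sum fun j _ => (hasFDerivAt_proj _ θ).const_mul (x j)
  | succ k ih =>
    simp only [hid, dhid]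
    exact HasFDerivAt.fun_sum fun j _ =>
      ((hσ _).hasDerivAt.comp_hasFDerivAt θ (ih j)).fun_mul (hasFDerivAt_proj _ θ)

/-- Pairing the derivatives in the pre-activations with the variation of the pre-activations
changes, from one layer to the next, exactly by the direct effect of the weights in between. Summed
over the layers, this telescopes to the full gradient. -/
theorem sum_delta_mul_dhid_succ (σ : ℝ → ℝ) (θ ξ : Params d₀ m d) (x : EuclideanSpace ℝ (Fin d₀))
    {k : ℕ} (hk : k < m) :
    ∑ i, delta σ θ x (k + 1) i * dhid σ θ x (k + 1) i ξ - ∑ j, delta σ θ x k j * dhid σ θ x k j ξ =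
      ∑ j, ∑ i, σ (hid σ θ x k j) * delta σ θ x (k + 1) i * ξ (pidx k j i) := by
  have h1 : ∑ i, delta σ θ x (k + 1) i * dhid σ θ x (k + 1) i ξ =
      ∑ j, ∑ i, (σ (hid σ θ x k j) * delta σ θ x (k + 1) i * ξ (pidx k j i) +
        (deriv σ (hid σ θ x k j) * dhid σ θ x k j ξ) *
          (θ (pidx k j i) * delta σ θ x (k + 1) i)) := by
    rw [Finset.sum_comm]
    refine Finset.sum_congr rfl fun i _ => ?_
    simp only [dhid, _root_.sum_apply, _root_.add_apply,
      _root_.smul_apply, ContinuousLinearMap.proj_apply, smul_eq_mul, Finset.mul_sum]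
    exact Finset.sum_congr rfl fun j _ => by ring
  have h2 : ∑ j, delta σ θ x k j * dhid σ θ x k j ξ = ∑ j, ∑ i,
      (deriv σ (hid σ θ x k j) * dhid σ θ x k j ξ) * (θ (pidx k j i) * delta σ θ x (k + 1) i) := by
    refine Finset.sum_congr rfl fun j _ => ?_
    rw [← Finset.mul_sum, delta, back_of_lt σ θ x hk]
    simp only [delta]
    ring
  rw [h1, h2, ← Finset.sum_sub_distrib]
  refine Finset.sum_congr rfl fun j _ => ?_
  rw [← Finset.sum_sub_distrib]
  exact Finset.sum_congr rfl fun i _ => by ring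

theorem pidx_of_fin (k : Fin m) (j i : Fin d) :
    (pidx (k : ℕ) j i : ParamIdx d₀ m d) = Sum.inr (Sum.inl (k, j, i)) := by
  simp [pidx]

theorem hasFDerivAt_net {σ : ℝ → ℝ} (hσ : Differentiable ℝ σ) (θ : Params d₀ m d)
    (x : EuclideanSpace ℝ (Fin d₀)) :
    HasFDerivAt (fun θ : Params d₀ m d => net σ θ x) (dotCLM (grad σ θ x)) θ := by
  have h : HasFDerivAt (fun θ : Params d₀ m d => ∑ i, σ (hid σ θ x m i) * θ (Sum.inr (Sum.inr i)))
      (∑ i, (σ (hid σ θ x m i) •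
        ContinuousLinearMap.proj (R := ℝ) (φ := fun _ => ℝ) (Sum.inr (Sum.inr i)) +
        θ (Sum.inr (Sum.inr i)) • (deriv σ (hid σ θ x m i) • dhid σ θ x m i))) θ :=
    HasFDerivAt.fun_sum fun i _ =>
      ((hσ _).hasDerivAt.comp_hasFDerivAt θ (hasFDerivAt_hid hσ θ x m i)).fun_mul
        (hasFDerivAt_proj _ θ)
  simp only [net, preact_eq_hid]
  refine h.congr_fderiv (ContinuousLinearMap.ext fun ξ => Eq.symm ?_)
  have htel := Finset.sum_range_sub
    (fun k => ∑ i, delta σ θ x k i * dhid σ θ x k i ξ) m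
  rw [Finset.sum_congr rfl fun k hk =>
    sum_delta_mul_dhid_succ σ θ ξ x (Finset.mem_range.1 hk)] at htel
  rw [dotCLM_apply, Fintype.sum_sum_type, Fintype.sum_sum_type]
  simp only [Fintype.sum_prod_type, grad]
  have h1 : ∑ k : Fin m, ∑ j, ∑ i, σ (hid σ θ x k j) * delta σ θ x (k + 1) i *
      ξ (Sum.inr (Sum.inl (k, j, i))) = ∑ k ∈ Finset.range m, ∑ j, ∑ i,
      σ (hid σ θ x k j) * delta σ θ x (k + 1) i * ξ (pidx k j i) := by
    rw [Finset.sum_range]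
    simp only [pidx_of_fin]
  have h2 : ∑ j : Fin d₀, ∑ i, x j * delta σ θ x 0 i * ξ (Sum.inl (j, i)) =
      ∑ i, delta σ θ x 0 i * dhid σ θ x 0 i ξ := by
    rw [Finset.sum_comm]
    refine Finset.sum_congr rfl fun i _ => ?_
    simp only [dhid, _root_.sum_apply, _root_.smul_apply,
      ContinuousLinearMap.proj_apply, smul_eq_mul, Finset.mul_sum]
    exact Finset.sum_congr rfl fun j _ => by ring
  rw [h1, h2, htel]
  simp only [_root_.sum_apply, _root_.add_apply,
    _root_.smul_apply, ContinuousLinearMap.proj_apply, smul_eq_mul,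
    Finset.sum_add_distrib, delta, back_output]
  have h3 : ∑ i, deriv σ (hid σ θ x m i) * θ (Sum.inr (Sum.inr i)) * dhid σ θ x m i ξ =
      ∑ i, θ (Sum.inr (Sum.inr i)) * (deriv σ (hid σ θ x m i) * dhid σ θ x m i ξ) :=
    Finset.sum_congr rfl fun i _ => by ring
  rw [h3]
  ring

/-- The quadratic analogue of `sum_delta_mul_dhid_succ`: contracted with `delta`, the propagated
part of `wker` at `k + 1` is the whole of `wker` at `k`, which leaves the share of the weights in
between. -/
theorem sum_delta_mul_wker_succ (σ : ℝ → ℝ) (ω : Params d₀ m d × Params d₀ m d)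
    (x x' : EuclideanSpace ℝ (Fin d₀)) {k : ℕ} (hk : k < m) :
    ∑ i, ∑ i', delta σ ω.1 x (k + 1) i * delta σ ω.1 x' (k + 1) i' * wker σ ω x x' (k + 1) i i' -
      ∑ j, ∑ j', delta σ ω.1 x k j * delta σ ω.1 x' k j' * wker σ ω x x' k j j' =
    ∑ j, ∑ i, (1 / d : ℝ) * (ω.2 (pidx k j i) *
      (σ (hid σ ω.1 x k j) * delta σ ω.1 x (k + 1) i) *
      (σ (hid σ ω.1 x' k j) * delta σ ω.1 x' (k + 1) i)) := by
  have h1 : ∑ i, ∑ i', delta σ ω.1 x (k + 1) i * delta σ ω.1 x' (k + 1) i' *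
      (∑ j, ∑ j', (deriv σ (hid σ ω.1 x k j) * deriv σ (hid σ ω.1 x' k j') *
          wker σ ω x x' k j j') * (ω.1 (pidx k j i) * ω.1 (pidx k j' i'))) =
      ∑ j, ∑ j', delta σ ω.1 x k j * delta σ ω.1 x' k j' * wker σ ω x x' k j j' := by
    have e : ∀ j j', delta σ ω.1 x k j * delta σ ω.1 x' k j' * wker σ ω x x' k j j' =
        ∑ i, ∑ i', (deriv σ (hid σ ω.1 x k j) * deriv σ (hid σ ω.1 x' k j') *
          wker σ ω x x' k j j') * ((ω.1 (pidx k j i) * delta σ ω.1 x (k + 1) i) *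
          (ω.1 (pidx k j' i') * delta σ ω.1 x' (k + 1) i')) := fun j j' => by
      simp only [← Finset.mul_sum, ← Finset.sum_mul]
      rw [delta, delta, back_of_lt σ ω.1 x hk, back_of_lt σ ω.1 x' hk]
      simp only [delta]
      ring
    simp only [e, Finset.mul_sum]
    calc _ = ∑ i, ∑ j, ∑ i', ∑ j', delta σ ω.1 x (k + 1) i * delta σ ω.1 x' (k + 1) i' *
          (deriv σ (hid σ ω.1 x k j) * deriv σ (hid σ ω.1 x' k j') * wker σ ω x x' k j j' *
            (ω.1 (pidx k j i) * ω.1 (pidx k j' i'))) :=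
          Finset.sum_congr rfl fun i _ => Finset.sum_comm
      _ = ∑ j, ∑ i, ∑ j', ∑ i', delta σ ω.1 x (k + 1) i * delta σ ω.1 x' (k + 1) i' *
          (deriv σ (hid σ ω.1 x k j) * deriv σ (hid σ ω.1 x' k j') * wker σ ω x x' k j j' *
            (ω.1 (pidx k j i) * ω.1 (pidx k j' i'))) := by
          rw [Finset.sum_comm]
          exact Finset.sum_congr rfl fun j _ => Finset.sum_congr rfl fun i _ => Finset.sum_comm
      _ = ∑ j, ∑ j', ∑ i, ∑ i', delta σ ω.1 x (k + 1) i * delta σ ω.1 x' (k + 1) i' *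
          (deriv σ (hid σ ω.1 x k j) * deriv σ (hid σ ω.1 x' k j') * wker σ ω x x' k j j' *
            (ω.1 (pidx k j i) * ω.1 (pidx k j' i'))) :=
          Finset.sum_congr rfl fun j _ => Finset.sum_comm
      _ = _ := Finset.sum_congr rfl fun j _ => Finset.sum_congr rfl fun j' _ =>
          Finset.sum_congr rfl fun i _ => Finset.sum_congr rfl fun i' _ => by ring
  simp only [wker, mul_add, Finset.sum_add_distrib, h1, add_sub_cancel_left, mul_ite, mul_zero,
    Finset.sum_ite_eq, Finset.mem_univ, if_true]
  rw [Finset.sum_comm]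
  refine Finset.sum_congr rfl fun i _ => ?_
  simp only [Finset.mul_sum]
  exact Finset.sum_congr rfl fun j _ => by ring

/-- The weighted neural tangent kernel, normalized by `1/d`. -/
theorem sum_grad_mul_grad (σ : ℝ → ℝ) (ω : Params d₀ m d × Params d₀ m d)
    (x x' : EuclideanSpace ℝ (Fin d₀)) (i₀ : Fin d) :
    (1 / d : ℝ) * ∑ p, ω.2 p * grad σ ω.1 x p * grad σ ω.1 x' p = wker σ ω x x' (m + 1) i₀ i₀ := by
  -- The telescoping sum is the share of all hidden weights. Its lower end is the share of the first
  -- layer, and its upper end is the propagated part of the last step of `wker`.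
  have htel := Finset.sum_range_sub (fun k => ∑ i, ∑ i', delta σ ω.1 x k i *
    delta σ ω.1 x' k i' * wker σ ω x x' k i i') m
  rw [Finset.sum_congr rfl fun k hk =>
    sum_delta_mul_wker_succ σ ω x x' (Finset.mem_range.1 hk)] at htel
  rw [Fintype.sum_sum_type, Fintype.sum_sum_type, mul_add, mul_add]
  simp only [Fintype.sum_prod_type, grad]
  have h1 : (1 / d : ℝ) * ∑ k : Fin m, ∑ j, ∑ i, ω.2 (Sum.inr (Sum.inl (k, j, i))) *
      (σ (hid σ ω.1 x k j) * delta σ ω.1 x (k + 1) i) *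
      (σ (hid σ ω.1 x' k j) * delta σ ω.1 x' (k + 1) i) = ∑ k ∈ Finset.range m, ∑ j, ∑ i,
      (1 / d : ℝ) * (ω.2 (pidx k j i) * (σ (hid σ ω.1 x k j) * delta σ ω.1 x (k + 1) i) *
      (σ (hid σ ω.1 x' k j) * delta σ ω.1 x' (k + 1) i)) := by
    rw [Finset.sum_range]
    simp only [pidx_of_fin, Finset.mul_sum]
  have h2 : (1 / d : ℝ) * ∑ j : Fin d₀, ∑ i, ω.2 (Sum.inl (j, i)) * (x j * delta σ ω.1 x 0 i) *
      (x' j * delta σ ω.1 x' 0 i) =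
      ∑ i, ∑ i', delta σ ω.1 x 0 i * delta σ ω.1 x' 0 i' * wker σ ω x x' 0 i i' := by
    simp only [wker, mul_ite, mul_zero, Finset.sum_ite_eq, Finset.mem_univ, if_true]
    rw [Finset.sum_comm, Finset.mul_sum]
    refine Finset.sum_congr rfl fun i _ => ?_
    simp only [Finset.mul_sum]
    exact Finset.sum_congr rfl fun j _ => by ring
  rw [h1, h2, htel]
  simp only [wker, if_true, pidx_output, delta, back_output]
  have h3 : ∀ j j', deriv σ (hid σ ω.1 x m j) * ω.1 (Sum.inr (Sum.inr j)) *
      (deriv σ (hid σ ω.1 x' m j') * ω.1 (Sum.inr (Sum.inr j'))) * wker σ ω x x' m j j' =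
      deriv σ (hid σ ω.1 x m j) * deriv σ (hid σ ω.1 x' m j') * wker σ ω x x' m j j' *
      (ω.1 (Sum.inr (Sum.inr j)) * ω.1 (Sum.inr (Sum.inr j'))) := fun j j' => by ring
  have h4 : ∀ j, ω.2 (Sum.inr (Sum.inr j)) * σ (hid σ ω.1 x m j) * σ (hid σ ω.1 x' m j) =
      ω.2 (Sum.inr (Sum.inr j)) * (σ (hid σ ω.1 x m j) * σ (hid σ ω.1 x' m j)) := fun j => by ring
  simp only [h3, h4]
  ring

end Gradient

/-! ### Norms of block vectors and outer products -/

section NormBlocks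

variable {ι κ : Type*} [Fintype ι] [Fintype κ]

theorem nrm_mul_le {a : ι → ℝ} {A : ℝ} (ha : ∀ i, |a i| ≤ A) (v : ι → ℝ) :
    nrm (fun i => a i * v i) ≤ |A| * nrm v := by
  rw [← nrm_const_mul]
  refine nrm_mono fun i => ?_
  rw [abs_mul, abs_mul]
  exact mul_le_mul_of_nonneg_right ((ha i).trans (le_abs_self A)) (abs_nonneg _)

theorem nrm_comp_le {e : κ → ι} (he : Function.Injective e) (v : ι → ℝ) :
    nrm (fun j => v (e j)) ≤ nrm v := by
  have h := Finset.sum_map Finset.univ ⟨e, he⟩ fun i => v i ^ 2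
  simp only [Function.Embedding.coeFn_mk] at h
  refine Real.sqrt_le_sqrt ?_
  rw [← h]
  exact Finset.sum_le_sum_of_subset_of_nonneg (Finset.subset_univ _) fun _ _ _ => sq_nonneg _

theorem nrm_sum_le (v : ι ⊕ κ → ℝ) :
    nrm v ≤ nrm (fun i => v (Sum.inl i)) + nrm (fun j => v (Sum.inr j)) := by
  refine nrm_le_of_sq_le (add_nonneg (nrm_nonneg _) (nrm_nonneg _)) ?_
  rw [Fintype.sum_sum_type, ← nrm_sq, ← nrm_sq]
  nlinarith [mul_nonneg (nrm_nonneg fun i => v (Sum.inl i)) (nrm_nonneg fun j => v (Sum.inr j))]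

theorem nrm_prod_le (v : ι × κ → ℝ) : nrm v ≤ ∑ i, nrm (fun j => v (i, j)) := by
  refine nrm_le_of_sq_le (Finset.sum_nonneg fun _ _ => nrm_nonneg _) ?_
  rw [Fintype.sum_prod_type, Finset.sum_congr rfl fun i _ => (nrm_sq fun j => v (i, j)).symm]
  exact Finset.sum_sq_le_sq_sum_of_nonneg fun i _ => nrm_nonneg fun j => v (i, j)

theorem nrm_outer_sub_le (v v' : ι → ℝ) (w w' : κ → ℝ) :
    nrm (fun p : ι × κ => v p.1 * w p.2 - v' p.1 * w' p.2) ≤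
      nrm (fun i => v i - v' i) * nrm w + nrm v' * nrm (fun j => w j - w' j) := by
  rw [← nrm_outer, ← nrm_outer]
  refine le_trans (le_of_eq ?_) (nrm_add_le _ _)
  congr 1
  funext p
  ring

end NormBlocks

/-! ### Stability of activations and gradients under small parameter changes -/

section Perturbation

variable {d₀ m d : ℕ}

/-- Growth, Lipschitz and derivative bounds of an activation function. -/
structure ActBounds (σ : ℝ → ℝ) (C D Λ : ℝ) : Prop where
  growth : ∀ z, |σ z| ≤ C * (1 + |z|)
  lip : ∀ z z', |σ z - σ z'| ≤ D * |z - z'|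
  bdd : ∀ z, |deriv σ z| ≤ D
  dlip : ∀ z z', |deriv σ z - deriv σ z'| ≤ Λ * |z - z'|

theorem exists_actBounds {σ : ℝ → ℝ} (hσ : Differentiable ℝ σ) {D Λ : ℝ}
    (hD : ∀ z, |deriv σ z| ≤ D) (hΛ : ∀ z z', |deriv σ z - deriv σ z'| ≤ Λ * |z - z'|) :
    ∃ C, ActBounds σ C D Λ := by
  have hlip : ∀ z z', |σ z - σ z'| ≤ D * |z - z'| := fun z z' =>
    Convex.norm_image_sub_le_of_norm_deriv_le (fun x _ => hσ x) (fun x _ => hD x) convex_univ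
      (Set.mem_univ z') (Set.mem_univ z)
  refine ⟨|σ 0| + D, fun z => ?_, hlip, hD, hΛ⟩
  have h := hlip z 0
  rw [sub_zero] at h
  have h0 : 0 ≤ D := (abs_nonneg _).trans (hD 0)
  have := abs_add_le (σ z - σ 0) (σ 0)
  rw [sub_add_cancel] at this
  nlinarith [abs_nonneg z, abs_nonneg (σ 0)]

namespace ActBounds

variable {σ : ℝ → ℝ} {C D Λ : ℝ} (h : ActBounds σ C D Λ)
include h

theorem C_nonneg : 0 ≤ C := by
  have := (abs_nonneg _).trans (h.growth 0); simpa using this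

theorem D_nonneg : 0 ≤ D := (abs_nonneg _).trans (h.bdd 0)

theorem Λ_nonneg : 0 ≤ Λ := by
  have := (abs_nonneg _).trans (h.dlip 1 0); simpa using this

theorem nrm_act_le (v : Fin d → ℝ) : nrm (fun i => σ (v i)) ≤ C * (√d + nrm v) := by
  calc _ ≤ nrm (fun i => C * (1 + |v i|)) := nrm_mono fun i => by
        rw [abs_of_nonneg (mul_nonneg h.C_nonneg (by positivity))]; exact h.growth _
    _ = C * nrm (fun i => 1 + |v i|) := by rw [nrm_const_mul, abs_of_nonneg h.C_nonneg]
    _ ≤ C * (nrm (fun _ : Fin d => (1 : ℝ)) + nrm (fun i => |v i|)) :=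
        mul_le_mul_of_nonneg_left (nrm_add_le _ _) h.C_nonneg
    _ = _ := by rw [nrm_one]; simp [nrm]

theorem nrm_act_sub_le (v w : Fin d → ℝ) :
    nrm (fun i => σ (v i) - σ (w i)) ≤ D * nrm (fun i => v i - w i) := by
  calc _ ≤ nrm (fun i => D * (v i - w i)) := nrm_mono fun i => by
        rw [abs_mul, abs_of_nonneg h.D_nonneg]; exact h.lip _ _
    _ = _ := by rw [nrm_const_mul, abs_of_nonneg h.D_nonneg]

theorem nrm_deriv_mul_le (v u : Fin d → ℝ) : nrm (fun i => deriv σ (v i) * u i) ≤ D * nrm u := by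
  have := nrm_mul_le (fun i => h.bdd (v i)) u
  rwa [abs_of_nonneg h.D_nonneg] at this

/-- Lipschitz continuity of `deriv σ` controls its change only in the Euclidean norm over the layer,
so multiplying by `u'` costs the sup norm `ζ`. This is why the back-propagated derivatives at
initialization must be uniformly small. -/
theorem nrm_deriv_mul_sub_le (v w u u' : Fin d → ℝ) {ζ : ℝ} (hζ : ∀ i, |u' i| ≤ ζ) :
    nrm (fun i => deriv σ (v i) * u i - deriv σ (w i) * u' i) ≤
      Λ * nrm (fun i => v i - w i) * ζ + D * nrm (fun i => u i - u' i) := by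
  have e : (fun i => deriv σ (v i) * u i - deriv σ (w i) * u' i) = fun i =>
      (deriv σ (v i) - deriv σ (w i)) * u' i + deriv σ (v i) * (u i - u' i) := by
    funext i; ring
  rw [e]
  refine (nrm_add_le _ _).trans (add_le_add ?_ (h.nrm_deriv_mul_le _ _))
  rcases isEmpty_or_nonempty (Fin d) with hd | ⟨⟨i₀⟩⟩
  · simp [nrm]
  have hζ0 : 0 ≤ ζ := (abs_nonneg _).trans (hζ i₀)
  calc _ ≤ nrm (fun i => (Λ * ζ) * (v i - w i)) := nrm_mono fun i => by
        rw [abs_mul, abs_mul, abs_of_nonneg (mul_nonneg h.Λ_nonneg hζ0)]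
        calc _ ≤ (Λ * |v i - w i|) * ζ := mul_le_mul (h.dlip _ _) (hζ i) (abs_nonneg _)
              (mul_nonneg h.Λ_nonneg (abs_nonneg _))
          _ = _ := by ring
    _ = _ := by rw [nrm_const_mul, abs_of_nonneg (mul_nonneg h.Λ_nonneg hζ0)]; ring

end ActBounds

/-- Bounds on the weight matrices that hold with high probability at initialization. -/
structure GoodWeights (B : ℝ) (θ : Params d₀ m d) : Prop where
  input : nrm (fun p : Fin d₀ × Fin d => θ (Sum.inl p)) ≤ B * √d
  hidden : ∀ k < m, OpBound (fun j i => θ (pidx k j i)) B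
  output : nrm (fun i => θ (Sum.inr (Sum.inr i))) ≤ B

theorem pidx_injective_prod {k : ℕ} (hk : k < m) :
    Function.Injective fun p : Fin d × Fin d => (pidx k p.1 p.2 : ParamIdx d₀ m d) := by
  rintro ⟨j, i⟩ ⟨j', i'⟩ h
  simpa [pidx, hk] using h

theorem nrm_vecMul_pidx_le {k : ℕ} (hk : k < m) (u : Fin d → ℝ) (Δ : Params d₀ m d) :
    nrm (fun i => ∑ j, u j * Δ (pidx k j i)) ≤ nrm u * nrm Δ :=
  (nrm_vecMul_le u fun j i => Δ (pidx k j i)).trans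
    (mul_le_mul_of_nonneg_left (nrm_comp_le (pidx_injective_prod hk) Δ) (nrm_nonneg u))

theorem nrm_mulVec_pidx_le {k : ℕ} (hk : k < m) (u : Fin d → ℝ) (Δ : Params d₀ m d) :
    nrm (fun j => ∑ i, Δ (pidx k j i) * u i) ≤ nrm Δ * nrm u := by
  have h : OpBound (fun j i => Δ (pidx k j i)) (nrm Δ) := fun v => by
    rw [mul_comm]; exact nrm_vecMul_pidx_le hk v Δ
  exact h.transpose (nrm_nonneg Δ) u

/-- A change of norm at most 1 alters each operator norm by at most 1, as the Frobenius norm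
dominates it; for the input block `1 ≤ √d` is used. -/
theorem GoodWeights.perturb {B : ℝ} {θ₀ θ : Params d₀ m d} (h : GoodWeights B θ₀) (hd : 0 < d)
    (hθ : nrm (fun p => θ p - θ₀ p) ≤ 1) : GoodWeights (B + 1) θ := by
  have hd1 : (1 : ℝ) ≤ √d := Real.one_le_sqrt.2 (by exact_mod_cast hd)
  obtain ⟨Δ, hΔ⟩ : ∃ Δ : Params d₀ m d, ∀ p, θ p = θ₀ p + Δ p := ⟨θ - θ₀, fun p => by simp⟩
  simp only [hΔ, add_sub_cancel_left] at hθ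
  have hsub : ∀ {κ : Type} [Fintype κ] (e : κ → ParamIdx d₀ m d), Function.Injective e →
      nrm (fun p => θ (e p)) ≤ nrm (fun p => θ₀ (e p)) + 1 := fun e he => by
    simp only [hΔ]
    exact (nrm_add_le _ _).trans (add_le_add le_rfl ((nrm_comp_le he Δ).trans hθ))
  refine ⟨?_, fun k hk v => ?_, ?_⟩
  · refine (hsub Sum.inl Sum.inl_injective).trans ?_
    rw [add_mul, one_mul]
    exact add_le_add h.input hd1
  · have e : (fun i => ∑ j, v j * θ (pidx k j i)) = fun i =>
        ∑ j, v j * θ₀ (pidx k j i) + ∑ j, v j * Δ (pidx k j i) := by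
      funext i
      simp only [hΔ]
      rw [← Finset.sum_add_distrib]
      exact Finset.sum_congr rfl fun j _ => by ring
    rw [e, add_mul, one_mul]
    refine (nrm_add_le _ _).trans (add_le_add (h.hidden k hk v) ?_)
    refine (nrm_vecMul_pidx_le hk v Δ).trans ?_
    nlinarith [nrm_nonneg v]
  · exact (hsub (fun i => Sum.inr (Sum.inr i)) (Sum.inr_injective.comp Sum.inr_injective)).trans
      (add_le_add h.output le_rfl)

variable {σ : ℝ → ℝ} {C D Λ : ℝ}

theorem exists_nrm_hid_le (hσ : ActBounds σ C D Λ) (d₀ m : ℕ) {B Xm : ℝ} (hB : 0 ≤ B)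
    (hX : 0 ≤ Xm) (k : ℕ) (hk : k ≤ m) : ∃ K : ℝ, 0 ≤ K ∧ ∀ (d : ℕ) (θ : Params d₀ m d)
      (x : EuclideanSpace ℝ (Fin d₀)), GoodWeights B θ → ‖x‖ ≤ Xm →
      nrm (hid σ θ x k) ≤ K * √d := by
  induction k with
  | zero =>
    refine ⟨Xm * B, by positivity, fun d θ x hθ hx => ?_⟩
    refine (nrm_vecMul_le (fun j => x j) fun j i => θ (Sum.inl (j, i))).trans ?_
    rw [nrm_eq_norm, mul_assoc]
    exact mul_le_mul hx hθ.input (nrm_nonneg _) hX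
  | succ k ih =>
    obtain ⟨K, hK, h⟩ := ih (by omega)
    have hC := hσ.C_nonneg
    refine ⟨B * (C * (1 + K)), by positivity, fun d θ x hθ hx => ?_⟩
    refine (hθ.hidden k (by omega) fun j => σ (hid σ θ x k j)).trans ?_
    rw [mul_assoc]
    refine mul_le_mul_of_nonneg_left ((hσ.nrm_act_le _).trans ?_) hB
    rw [mul_assoc, add_mul, one_mul]
    exact mul_le_mul_of_nonneg_left (add_le_add le_rfl (h d θ x hθ hx)) hC

theorem exists_nrm_act_hid_le (hσ : ActBounds σ C D Λ) (d₀ m : ℕ) {B Xm : ℝ} (hB : 0 ≤ B)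
    (hX : 0 ≤ Xm) (k : ℕ) (hk : k ≤ m) : ∃ K : ℝ, 0 ≤ K ∧ ∀ (d : ℕ) (θ : Params d₀ m d)
      (x : EuclideanSpace ℝ (Fin d₀)), GoodWeights B θ → ‖x‖ ≤ Xm →
      nrm (fun i => σ (hid σ θ x k i)) ≤ K * √d := by
  obtain ⟨K, hK, h⟩ := exists_nrm_hid_le hσ d₀ m hB hX k hk
  have hC := hσ.C_nonneg
  refine ⟨C * (1 + K), by positivity, fun d θ x hθ hx => (hσ.nrm_act_le _).trans ?_⟩
  rw [mul_assoc, add_mul, one_mul]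
  exact mul_le_mul_of_nonneg_left (add_le_add le_rfl (h d θ x hθ hx)) hC

/-- A weight change of size O(1/√d) acts on activations of norm O(√d), while earlier changes pass
through matrices of bounded norm. A whole layer of pre-activations thus moves by O(1). -/
theorem exists_nrm_hid_sub_le (hσ : ActBounds σ C D Λ) (d₀ m : ℕ) {B Xm R : ℝ} (hB : 0 ≤ B)
    (hX : 0 ≤ Xm) (hR : 0 ≤ R) (k : ℕ) (hk : k ≤ m) : ∃ K : ℝ, 0 ≤ K ∧ ∀ (d : ℕ)
      (θ₀ θ : Params d₀ m d) (x : EuclideanSpace ℝ (Fin d₀)), 0 < d → GoodWeights B θ₀ →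
      GoodWeights B θ → nrm (fun p => θ p - θ₀ p) ≤ R / √d → ‖x‖ ≤ Xm →
      nrm (fun i => hid σ θ x k i - hid σ θ₀ x k i) ≤ K := by
  induction k with
  | zero =>
    refine ⟨Xm * R, by positivity, fun d θ₀ θ x hd h0 hθ hΔ hx => ?_⟩
    obtain ⟨Δ, hΔ'⟩ : ∃ Δ : Params d₀ m d, ∀ p, θ p - θ₀ p = Δ p := ⟨θ - θ₀, fun p => rfl⟩
    simp only [hΔ'] at hΔ
    have hd1 : (1 : ℝ) ≤ √d := Real.one_le_sqrt.2 (by exact_mod_cast hd)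
    have e : (fun i => hid σ θ x 0 i - hid σ θ₀ x 0 i) = fun i =>
        ∑ j, x j * Δ (Sum.inl (j, i)) := by
      funext i
      simp only [hid]
      rw [← Finset.sum_sub_distrib]
      exact Finset.sum_congr rfl fun j _ => by rw [← hΔ']; ring
    rw [e]
    refine (nrm_vecMul_le (fun j => x j) fun j i => Δ (Sum.inl (j, i))).trans ?_
    rw [nrm_eq_norm]
    refine mul_le_mul hx ?_ (nrm_nonneg _) hX
    exact (nrm_comp_le (e := fun q : Fin d₀ × Fin d => (Sum.inl q : ParamIdx d₀ m d))
      Sum.inl_injective Δ).trans (hΔ.trans (div_le_self hR hd1))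
  | succ k ih =>
    obtain ⟨K, hK, h⟩ := ih (by omega)
    obtain ⟨K', hK', h'⟩ := exists_nrm_act_hid_le hσ d₀ m hB hX k (by omega)
    have hD := hσ.D_nonneg
    refine ⟨B * (D * K) + K' * R, by positivity, fun d θ₀ θ x hd h0 hθ hΔ hx => ?_⟩
    obtain ⟨Δ, hΔ'⟩ : ∃ Δ : Params d₀ m d, ∀ p, θ p - θ₀ p = Δ p := ⟨θ - θ₀, fun p => rfl⟩
    have hΔ2 := hΔ
    simp only [hΔ'] at hΔ2
    have hd1 : 0 < √(d : ℝ) := Real.sqrt_pos.2 (by exact_mod_cast hd)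
    have e : (fun i => hid σ θ x (k + 1) i - hid σ θ₀ x (k + 1) i) = fun i =>
        ∑ j, (σ (hid σ θ x k j) - σ (hid σ θ₀ x k j)) * θ (pidx k j i) +
        ∑ j, σ (hid σ θ₀ x k j) * Δ (pidx k j i) := by
      funext i
      simp only [hid]
      rw [← Finset.sum_sub_distrib, ← Finset.sum_add_distrib]
      exact Finset.sum_congr rfl fun j _ => by rw [← hΔ']; ring
    rw [e]
    refine (nrm_add_le _ _).trans (add_le_add ?_ ?_)
    · refine (hθ.hidden k (by omega) _).trans (mul_le_mul_of_nonneg_left ?_ hB)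
      exact (hσ.nrm_act_sub_le _ _).trans
        (mul_le_mul_of_nonneg_left (h d θ₀ θ x hd h0 hθ hΔ hx) hD)
    · refine (nrm_vecMul_pidx_le (by omega) _ Δ).trans ?_
      calc _ ≤ (K' * √d) * (R / √d) := mul_le_mul (h' d θ₀ x h0 hx) hΔ2 (nrm_nonneg _) (by positivity)
        _ = K' * R := by field_simp

theorem exists_nrm_back_le (hσ : ActBounds σ C D Λ) (d₀ m : ℕ) {B : ℝ} (hB : 0 ≤ B) (s k : ℕ)
    (hk : k + s = m) : ∃ K : ℝ, 0 ≤ K ∧ ∀ (d : ℕ) (θ : Params d₀ m d)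
      (x : EuclideanSpace ℝ (Fin d₀)), GoodWeights B θ → nrm (back σ θ x k) ≤ K := by
  induction s generalizing k with
  | zero =>
    obtain rfl : k = m := hk
    refine ⟨B, hB, fun d θ x hθ => ?_⟩
    have : back σ θ x k = fun j => θ (Sum.inr (Sum.inr j)) := funext fun j => back_output σ θ x j
    rw [this]
    exact hθ.output
  | succ s ih =>
    obtain ⟨K, hK, h⟩ := ih (k + 1) (by omega)
    have hD := hσ.D_nonneg
    refine ⟨B * (D * K), by positivity, fun d θ x hθ => ?_⟩
    have hkm : k < m := by omega
    rw [show back σ θ x k = _ from funext fun j => back_of_lt σ θ x hkm j]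
    refine ((hθ.hidden k hkm).transpose hB _).trans (mul_le_mul_of_nonneg_left ?_ hB)
    exact (hσ.nrm_deriv_mul_le _ _).trans (mul_le_mul_of_nonneg_left (h d θ x hθ) hD)

/-- There are three sources of change: the weights, of size O(1/√d); the derivatives of the later
layers, by induction; and `deriv σ`, which costs `ζ` by `nrm_deriv_mul_sub_le`. -/
theorem exists_nrm_back_sub_le (hσ : ActBounds σ C D Λ) (d₀ m : ℕ) {B Xm R : ℝ} (hB : 0 ≤ B)
    (hX : 0 ≤ Xm) (hR : 0 ≤ R) (s k : ℕ) (hk : k + s = m) : ∃ K : ℝ, 0 ≤ K ∧ ∀ (d : ℕ)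
      (θ₀ θ : Params d₀ m d) (x : EuclideanSpace ℝ (Fin d₀)) (ζ : ℝ), 0 < d → GoodWeights B θ₀ →
      GoodWeights B θ → nrm (fun p => θ p - θ₀ p) ≤ R / √d → ‖x‖ ≤ Xm → 0 ≤ ζ →
      (∀ k ≤ m, ∀ j, |back σ θ₀ x k j| ≤ ζ) →
      nrm (fun i => back σ θ x k i - back σ θ₀ x k i) ≤ K * (1 / √d + ζ) := by
  induction s generalizing k with
  | zero =>
    obtain rfl : k = m := hk
    refine ⟨R, hR, fun d θ₀ θ x ζ hd h0 hθ hΔ hx hζ0 hζ => ?_⟩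
    obtain ⟨Δ, hΔ'⟩ : ∃ Δ : Params d₀ k d, ∀ p, θ p - θ₀ p = Δ p := ⟨θ - θ₀, fun p => rfl⟩
    simp only [hΔ'] at hΔ
    simp only [back_output, hΔ']
    refine (nrm_comp_le (e := fun i : Fin d => (Sum.inr (Sum.inr i) : ParamIdx d₀ k d))
      (Sum.inr_injective.comp Sum.inr_injective) Δ).trans (hΔ.trans ?_)
    rw [mul_add, mul_one_div]
    exact le_add_of_nonneg_right (by positivity)
  | succ s ih =>
    obtain ⟨K, hK, h⟩ := ih (k + 1) (by omega)
    obtain ⟨K', hK', h'⟩ := exists_nrm_back_le hσ d₀ m hB s (k + 1) (by omega)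
    obtain ⟨H, hH, h''⟩ := exists_nrm_hid_sub_le hσ d₀ m hB hX hR (k + 1) (by omega)
    have hD := hσ.D_nonneg
    have hΛ := hσ.Λ_nonneg
    refine ⟨R * (D * K') + B * (Λ * H + D * K), by positivity,
      fun d θ₀ θ x ζ hd h0 hθ hΔ hx hζ0 hζ => ?_⟩
    obtain ⟨Δ, hΔ'⟩ : ∃ Δ : Params d₀ m d, ∀ p, θ p - θ₀ p = Δ p := ⟨θ - θ₀, fun p => rfl⟩
    have hΔ2 := hΔ
    simp only [hΔ'] at hΔ2
    have hkm : k < m := by omega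
    have e : (fun j => back σ θ x k j - back σ θ₀ x k j) = fun j =>
        ∑ i, Δ (pidx k j i) *
          (deriv σ (hid σ θ x (k + 1) i) * back σ θ x (k + 1) i) +
        ∑ i, θ₀ (pidx k j i) * (deriv σ (hid σ θ x (k + 1) i) * back σ θ x (k + 1) i -
          deriv σ (hid σ θ₀ x (k + 1) i) * back σ θ₀ x (k + 1) i) := by
      funext j
      rw [back_of_lt σ θ x hkm, back_of_lt σ θ₀ x hkm, ← Finset.sum_sub_distrib,
        ← Finset.sum_add_distrib]
      exact Finset.sum_congr rfl fun i _ => by rw [← hΔ']; ring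
    rw [e]
    have h1 : nrm (fun j => ∑ i, Δ (pidx k j i) *
        (deriv σ (hid σ θ x (k + 1) i) * back σ θ x (k + 1) i)) ≤ R * (D * K') * (1 / √d) := by
      refine (nrm_mulVec_pidx_le hkm _ Δ).trans ?_
      calc _ ≤ R / √d * (D * K') := mul_le_mul hΔ2 ((hσ.nrm_deriv_mul_le _ _).trans
            (mul_le_mul_of_nonneg_left (h' d θ x hθ) hD)) (nrm_nonneg _) (by positivity)
        _ = _ := by ring
    have h2 := ((h0.hidden k hkm).transpose hB _).trans (mul_le_mul_of_nonneg_left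
      ((hσ.nrm_deriv_mul_sub_le (hid σ θ x (k + 1)) (hid σ θ₀ x (k + 1)) (back σ θ x (k + 1))
        (back σ θ₀ x (k + 1)) (hζ (k + 1) (by omega))).trans (add_le_add
        (mul_le_mul_of_nonneg_right (mul_le_mul_of_nonneg_left (h'' d θ₀ θ x hd h0 hθ hΔ hx) hΛ) hζ0)
        (mul_le_mul_of_nonneg_left (h d θ₀ θ x ζ hd h0 hθ hΔ hx hζ0 hζ) hD))) hB)
    refine (nrm_add_le _ _).trans ((add_le_add h1 h2).trans ?_)
    have h3 : 0 ≤ 1 / √(d : ℝ) := by positivity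
    have h4 : 0 ≤ R * (D * K') * ζ := by positivity
    have h5 : 0 ≤ B * (Λ * H) * (1 / √(d : ℝ)) := by positivity
    nlinarith

theorem nrm_le_blocks (g : ParamIdx d₀ m d → ℝ) :
    nrm g ≤ nrm (fun q : Fin d₀ × Fin d => g (Sum.inl q)) +
      (∑ k : Fin m, nrm (fun q : Fin d × Fin d => g (Sum.inr (Sum.inl (k, q)))) +
        nrm (fun i => g (Sum.inr (Sum.inr i)))) :=
  (nrm_sum_le g).trans (add_le_add le_rfl ((nrm_sum_le _).trans
    (add_le_add (nrm_prod_le _) le_rfl)))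

theorem exists_nrm_grad_le (hσ : ActBounds σ C D Λ) (d₀ m : ℕ) {B Xm : ℝ} (hB : 0 ≤ B)
    (hX : 0 ≤ Xm) : ∃ K : ℝ, 0 ≤ K ∧ ∀ (d : ℕ) (θ : Params d₀ m d)
      (x : EuclideanSpace ℝ (Fin d₀)), 0 < d → GoodWeights B θ → ‖x‖ ≤ Xm →
      nrm (grad σ θ x) ≤ K * √d := by
  -- The bounds are stated for every `k`, with the value 0 beyond `m`, so that `choose` yields
  -- sequences of constants.
  have hv : ∀ k, ∃ K : ℝ, 0 ≤ K ∧ (k ≤ m → ∀ (d : ℕ) (θ : Params d₀ m d)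
      (x : EuclideanSpace ℝ (Fin d₀)), GoodWeights B θ → nrm (back σ θ x k) ≤ K) := fun k => by
    by_cases hk : k ≤ m
    · obtain ⟨K, hK, h⟩ := exists_nrm_back_le hσ d₀ m hB (m - k) k (by omega)
      exact ⟨K, hK, fun _ => h⟩
    · exact ⟨0, le_rfl, fun h => absurd h hk⟩
  have hz : ∀ k, ∃ K : ℝ, 0 ≤ K ∧ (k ≤ m → ∀ (d : ℕ) (θ : Params d₀ m d)
      (x : EuclideanSpace ℝ (Fin d₀)), GoodWeights B θ → ‖x‖ ≤ Xm →
      nrm (fun i => σ (hid σ θ x k i)) ≤ K * √d) := fun k => by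
    by_cases hk : k ≤ m
    · obtain ⟨K, hK, h⟩ := exists_nrm_act_hid_le hσ d₀ m hB hX k (by omega)
      exact ⟨K, hK, fun _ => h⟩
    · exact ⟨0, le_rfl, fun h => absurd h hk⟩
  choose V hV0 hV using hv
  choose Z hZ0 hZ using hz
  have hD := hσ.D_nonneg
  have hVn := hV0 0
  have hZn := hZ0 m
  have hS : 0 ≤ ∑ k : Fin m, Z k * (D * V (k + 1)) :=
    Finset.sum_nonneg fun k _ => mul_nonneg (hZ0 k) (mul_nonneg hD (hV0 _))
  refine ⟨Xm * (D * V 0) + (∑ k : Fin m, Z k * (D * V (k + 1)) + Z m), by positivity,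
    fun d θ x hd hθ hx => ?_⟩
  have hd1 : (1 : ℝ) ≤ √d := Real.one_le_sqrt.2 (by exact_mod_cast hd)
  have hδ : ∀ k ≤ m, nrm (delta σ θ x k) ≤ D * V k := fun k hk =>
    (hσ.nrm_deriv_mul_le _ _).trans (mul_le_mul_of_nonneg_left (hV k hk d θ x hθ) hD)
  refine (nrm_le_blocks _).trans ?_
  rw [add_mul, add_mul, Finset.sum_mul]
  refine add_le_add ?_ (add_le_add (Finset.sum_le_sum fun k _ => ?_) (hZ m le_rfl d θ x hθ hx))
  · refine (nrm_outer (fun j => x j) (delta σ θ x 0)).le.trans ?_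
    rw [nrm_eq_norm]
    calc _ ≤ Xm * (D * V 0) := mul_le_mul hx (hδ 0 (by omega)) (nrm_nonneg _) hX
      _ ≤ _ := le_mul_of_one_le_right (by positivity) hd1
  · refine (nrm_outer (fun j => σ (hid σ θ x k j)) (delta σ θ x (k + 1))).le.trans ?_
    calc _ ≤ (Z k * √d) * (D * V (k + 1)) := mul_le_mul (hZ k k.2.le d θ x hθ hx)
          (hδ (k + 1) k.2) (nrm_nonneg _) (mul_nonneg (hZ0 k) (Real.sqrt_nonneg _))
      _ = _ := by ring

theorem exists_nrm_delta_sub_le (hσ : ActBounds σ C D Λ) (d₀ m : ℕ) {B Xm R : ℝ} (hB : 0 ≤ B)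
    (hX : 0 ≤ Xm) (hR : 0 ≤ R) (k : ℕ) (hk : k ≤ m) : ∃ K : ℝ, 0 ≤ K ∧ ∀ (d : ℕ)
      (θ₀ θ : Params d₀ m d) (x : EuclideanSpace ℝ (Fin d₀)) (ζ : ℝ), 0 < d → GoodWeights B θ₀ →
      GoodWeights B θ → nrm (fun p => θ p - θ₀ p) ≤ R / √d → ‖x‖ ≤ Xm → 0 ≤ ζ →
      (∀ k ≤ m, ∀ j, |back σ θ₀ x k j| ≤ ζ) →
      nrm (fun i => delta σ θ x k i - delta σ θ₀ x k i) ≤ K * (1 / √d + ζ) := by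
  obtain ⟨K, hK, h⟩ := exists_nrm_back_sub_le hσ d₀ m hB hX hR (m - k) k (by omega)
  obtain ⟨H, hH, h'⟩ := exists_nrm_hid_sub_le hσ d₀ m hB hX hR k hk
  have hD := hσ.D_nonneg
  have hΛ := hσ.Λ_nonneg
  refine ⟨Λ * H + D * K, by positivity, fun d θ₀ θ x ζ hd h0 hθ hΔ hx hζ0 hζ => ?_⟩
  refine (hσ.nrm_deriv_mul_sub_le (hid σ θ x k) (hid σ θ₀ x k) (back σ θ x k)
    (back σ θ₀ x k) (hζ k hk)).trans ((add_le_add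
    (mul_le_mul_of_nonneg_right (mul_le_mul_of_nonneg_left (h' d θ₀ θ x hd h0 hθ hΔ hx) hΛ) hζ0)
    (mul_le_mul_of_nonneg_left (h d θ₀ θ x ζ hd h0 hθ hΔ hx hζ0 hζ) hD)).trans ?_)
  have h5 : 0 ≤ Λ * H * (1 / √(d : ℝ)) := by positivity
  nlinarith

/-- A hidden block of the gradient is an outer product of activations of norm O(√d) with derivatives
of norm O(1). Relative to the size √d of the gradient, the change is of order `1 / √d + ζ`, hence
small. -/
theorem exists_nrm_grad_sub_le (hσ : ActBounds σ C D Λ) (d₀ m : ℕ) {B Xm R : ℝ} (hB : 0 ≤ B)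
    (hX : 0 ≤ Xm) (hR : 0 ≤ R) : ∃ K : ℝ, 0 ≤ K ∧ ∀ (d : ℕ)
      (θ₀ θ : Params d₀ m d) (x : EuclideanSpace ℝ (Fin d₀)) (ζ : ℝ), 0 < d → GoodWeights B θ₀ →
      GoodWeights B θ → nrm (fun p => θ p - θ₀ p) ≤ R / √d → ‖x‖ ≤ Xm → 0 ≤ ζ →
      (∀ k ≤ m, ∀ j, |back σ θ₀ x k j| ≤ ζ) →
      nrm (fun p => grad σ θ x p - grad σ θ₀ x p) ≤ K * (1 / √d + ζ) * √d := by
  have hv : ∀ k, ∃ K : ℝ, 0 ≤ K ∧ (k ≤ m → ∀ (d : ℕ) (θ : Params d₀ m d)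
      (x : EuclideanSpace ℝ (Fin d₀)), GoodWeights B θ → nrm (back σ θ x k) ≤ K) := fun k => by
    by_cases hk : k ≤ m
    · obtain ⟨K, hK, h⟩ := exists_nrm_back_le hσ d₀ m hB (m - k) k (by omega)
      exact ⟨K, hK, fun _ => h⟩
    · exact ⟨0, le_rfl, fun h => absurd h hk⟩
  have hz : ∀ k, ∃ K : ℝ, 0 ≤ K ∧ (k ≤ m → ∀ (d : ℕ) (θ : Params d₀ m d)
      (x : EuclideanSpace ℝ (Fin d₀)), GoodWeights B θ → ‖x‖ ≤ Xm →
      nrm (fun i => σ (hid σ θ x k i)) ≤ K * √d) := fun k => by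
    by_cases hk : k ≤ m
    · obtain ⟨K, hK, h⟩ := exists_nrm_act_hid_le hσ d₀ m hB hX k (by omega)
      exact ⟨K, hK, fun _ => h⟩
    · exact ⟨0, le_rfl, fun h => absurd h hk⟩
  have hh : ∀ k, ∃ K : ℝ, 0 ≤ K ∧ (k ≤ m → ∀ (d : ℕ)
      (θ₀ θ : Params d₀ m d) (x : EuclideanSpace ℝ (Fin d₀)), 0 < d → GoodWeights B θ₀ →
      GoodWeights B θ → nrm (fun p => θ p - θ₀ p) ≤ R / √d → ‖x‖ ≤ Xm →
      nrm (fun i => hid σ θ x k i - hid σ θ₀ x k i) ≤ K) := fun k => by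
    by_cases hk : k ≤ m
    · obtain ⟨K, hK, h⟩ := exists_nrm_hid_sub_le hσ d₀ m hB hX hR k hk
      exact ⟨K, hK, fun _ => h⟩
    · exact ⟨0, le_rfl, fun h => absurd h hk⟩
  have hdl : ∀ k, ∃ K : ℝ, 0 ≤ K ∧ (k ≤ m → ∀ (d : ℕ)
      (θ₀ θ : Params d₀ m d) (x : EuclideanSpace ℝ (Fin d₀)) (ζ : ℝ), 0 < d → GoodWeights B θ₀ →
      GoodWeights B θ → nrm (fun p => θ p - θ₀ p) ≤ R / √d → ‖x‖ ≤ Xm → 0 ≤ ζ →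
      (∀ k ≤ m, ∀ j, |back σ θ₀ x k j| ≤ ζ) →
      nrm (fun i => delta σ θ x k i - delta σ θ₀ x k i) ≤ K * (1 / √d + ζ)) := fun k => by
    by_cases hk : k ≤ m
    · obtain ⟨K, hK, h⟩ := exists_nrm_delta_sub_le hσ d₀ m hB hX hR k hk
      exact ⟨K, hK, fun _ => h⟩
    · exact ⟨0, le_rfl, fun h => absurd h hk⟩
  choose V hV0 hV using hv
  choose Z hZ0 hZ using hz
  choose H hH0 hH using hh
  choose E hE0 hE using hdl
  have hD := hσ.D_nonneg
  have hE0' := hE0 0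
  have hHm := hH0 m
  have hS : 0 ≤ ∑ k : Fin m, (D * H k * (D * V (k + 1)) + Z k * E (k + 1)) :=
    Finset.sum_nonneg fun k _ => add_nonneg (mul_nonneg (mul_nonneg hD (hH0 k))
      (mul_nonneg hD (hV0 _))) (mul_nonneg (hZ0 k) (hE0 _))
  refine ⟨Xm * E 0 + (∑ k : Fin m, (D * H k * (D * V (k + 1)) + Z k * E (k + 1)) + D * H m),
    by positivity, fun d θ₀ θ x ζ hd h0 hθ hΔ hx hζ0 hζ => ?_⟩
  have hd1 : (1 : ℝ) ≤ √d := Real.one_le_sqrt.2 (by exact_mod_cast hd)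
  have hd0 : 0 < √(d : ℝ) := by linarith
  have hδ : ∀ k ≤ m, nrm (delta σ θ x k) ≤ D * V k := fun k hk =>
    (hσ.nrm_deriv_mul_le _ _).trans (mul_le_mul_of_nonneg_left (hV k hk d θ x hθ) hD)
  -- Changes of order one, such as that of the activations, fit in the bound because this product is
  -- at least 1.
  have hq : (1 : ℝ) ≤ (1 / √d + ζ) * √d := by
    rw [add_mul, one_div, inv_mul_cancel₀ hd0.ne']
    exact le_add_of_nonneg_right (by positivity)
  have hq0 : 0 ≤ (1 / √d + ζ) := by positivity
  have hzs : ∀ k ≤ m, nrm (fun i => σ (hid σ θ x k i) - σ (hid σ θ₀ x k i)) ≤ D * H k := fun k hk =>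
    (hσ.nrm_act_sub_le _ _).trans (mul_le_mul_of_nonneg_left (hH k hk d θ₀ θ x hd h0 hθ hΔ hx) hD)
  refine (nrm_le_blocks _).trans ?_
  obtain ⟨q, hqd⟩ : ∃ q, q = (1 / √d + ζ) * √d := ⟨_, rfl⟩
  rw [← hqd] at hq
  rw [mul_assoc, ← hqd, add_mul, add_mul, Finset.sum_mul]
  refine add_le_add ?_ (add_le_add (Finset.sum_le_sum fun k _ => ?_) ?_)
  · refine (nrm_outer_sub_le (fun j => x j) (fun j => x j) (delta σ θ x 0)
      (delta σ θ₀ x 0)).trans ?_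
    simp only [sub_self]
    have e0 : nrm (fun _ : Fin d₀ => (0 : ℝ)) = 0 := by simp [nrm]
    rw [e0, zero_mul, zero_add, nrm_eq_norm]
    calc _ ≤ Xm * (E 0 * (1 / √d + ζ)) := mul_le_mul hx
          (hE 0 (by omega) d θ₀ θ x ζ hd h0 hθ hΔ hx hζ0 hζ) (nrm_nonneg _) hX
      _ = Xm * E 0 * (1 / √d + ζ) * 1 := by ring
      _ ≤ Xm * E 0 * (1 / √d + ζ) * √d := mul_le_mul_of_nonneg_left hd1 (by positivity)
      _ = _ := by rw [hqd]; ring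
  · refine (nrm_outer_sub_le (fun j => σ (hid σ θ x k j)) (fun j => σ (hid σ θ₀ x k j))
      (delta σ θ x (k + 1)) (delta σ θ₀ x (k + 1))).trans ?_
    have h1 := mul_le_mul (hzs k k.2.le) (hδ (k + 1) k.2) (nrm_nonneg _)
      (mul_nonneg hD (hH0 k))
    have h2 := mul_le_mul (hZ k k.2.le d θ₀ x h0 hx)
      (hE (k + 1) k.2 d θ₀ θ x ζ hd h0 hθ hΔ hx hζ0 hζ) (nrm_nonneg _)
      (mul_nonneg (hZ0 k) hd0.le)
    have h3 := le_mul_of_one_le_right (mul_nonneg (mul_nonneg hD (hH0 k))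
      (mul_nonneg hD (hV0 (k + 1)))) hq
    calc _ ≤ _ := add_le_add h1 h2
      _ ≤ _ := add_le_add_left h3 _
      _ = _ := by rw [hqd]; ring
  · have hHm' : 0 ≤ D * H m := by positivity
    exact (hzs m le_rfl).trans (le_mul_of_one_le_right hHm' hq)

end Perturbation

/-! ### Global solutions of ordinary differential equations -/

section GlobalExistence
open Topology Set

/-- A bounded Lipschitz vector field has integral curves on `[0, ∞)`. -/
theorem exists_integralCurve_of_lipschitz {E : Type*} [NormedAddCommGroup E] [NormedSpace ℝ E]
    [CompleteSpace E] {V : E → E} {K L : NNReal} (hV : LipschitzWith K V) (hL : ∀ x, ‖V x‖ ≤ L)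
    (x₀ : E) : ∃ θ : ℝ → E, θ 0 = x₀ ∧ ∀ t, 0 ≤ t → HasDerivWithinAt θ (V (θ t)) (Ici 0) t := by
  have hsol : ∀ n : ℕ, ∃ θ : ℝ → E, θ 0 = x₀ ∧
      ∀ t ∈ Icc (0 : ℝ) n, HasDerivWithinAt θ (V (θ t)) (Icc 0 n) t := by
    intro n
    -- A field bounded by `L` moves a point by at most `L * n` up to time `n`, so a ball of this
    -- radius is not left.
    have hP : IsPicardLindelof (fun _ => V) (tmin := 0) (tmax := n) ⟨0, by simp⟩ x₀ (L * n) 0 L K :=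
      { lipschitzOnWith := fun t _ => hV.lipschitzOnWith
        continuousOn := fun x _ => continuousOn_const
        norm_le := fun t _ x _ => hL x
        mul_max_le := by simp }
    obtain ⟨θ, h0, h⟩ := hP.exists_eq_forall_mem_Icc_hasDerivWithinAt₀
    exact ⟨θ, h0, h⟩
  choose s hs0 hs using hsol
  have hright : ∀ n : ℕ, ∀ N : ℝ, N ≤ n → ∀ t ∈ Ico (0 : ℝ) N,
      HasDerivWithinAt (s n) (V (s n t)) (Ici t) t := fun n N hN t ht =>
    (hs n t ⟨ht.1, ht.2.le.trans hN⟩).mono_of_mem_nhdsWithin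
      (mem_of_superset (Icc_mem_nhdsGE (ht.2.trans_le hN)) (Icc_subset_Icc_left ht.1))
  have hcont : ∀ n : ℕ, ∀ N : ℝ, N ≤ n → ContinuousOn (s n) (Icc 0 N) := fun n N hN t ht =>
    ((hs n t ⟨ht.1, ht.2.trans hN⟩).continuousWithinAt).mono (Icc_subset_Icc_right hN)
  have hagree : ∀ n k : ℕ, n ≤ k → EqOn (s n) (s k) (Icc 0 n) := fun n k hnk =>
    ODE_solution_unique (fun _ => hV) (hcont n n le_rfl) (hright n n le_rfl)
      (hcont k n (by exact_mod_cast hnk)) (hright k n (by exact_mod_cast hnk))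
      ((hs0 n).trans (hs0 k).symm)
  have heq : ∀ n : ℕ, ∀ t ∈ Icc (0 : ℝ) n, s ⌈t⌉₊ t = s n t := fun n t ht =>
    hagree _ n (Nat.ceil_le.2 ht.2) ⟨ht.1, Nat.le_ceil t⟩
  -- Solutions on growing intervals agree by uniqueness, and the one on `[0, ⌈t⌉₊]` is read at time
  -- `t`.
  refine ⟨fun t => s ⌈t⌉₊ t, by simpa using hs0 0, fun t ht => ?_⟩
  obtain ⟨n, hn⟩ := exists_nat_gt t
  have hmem : Icc (0 : ℝ) n ∈ 𝓝[Ici 0] t := by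
    have : Iio (n : ℝ) ∈ 𝓝[Ici 0] t := mem_nhdsWithin_of_mem_nhds (Iio_mem_nhds hn)
    filter_upwards [this, self_mem_nhdsWithin] with u hu hu0
    exact ⟨hu0, le_of_lt hu⟩
  have h1 : HasDerivWithinAt (s n) (V (s n t)) (Ici 0) t :=
    (hs n t ⟨ht, hn.le⟩).mono_of_mem_nhdsWithin hmem
  have h2 : s ⌈t⌉₊ t = s n t := heq n t ⟨ht, hn.le⟩
  change HasDerivWithinAt (fun t => s ⌈t⌉₊ t) (V (s ⌈t⌉₊ t)) (Ici 0) t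
  rw [h2]
  exact h1.congr_of_eventuallyEq_of_mem (by filter_upwards [hmem] with u hu using heq n u hu) ht

/-- A locally Lipschitz vector field agrees near a point with a bounded Lipschitz one. -/
theorem exists_lipschitz_eq_near {ι : Type*} [Fintype ι] {V : (ι → ℝ) → ι → ℝ}
    (hV : LocallyLipschitz V) (θ₀ : ι → ℝ) {r : ℝ} (hr : 0 ≤ r) :
    ∃ (W : (ι → ℝ) → ι → ℝ) (K L : NNReal), LipschitzWith K W ∧ (∀ θ, ‖W θ‖ ≤ L) ∧
      ∀ θ, (∀ p, |θ p - θ₀ p| ≤ r) → W θ = V θ := by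
  -- Clamping the coordinates is 1-Lipschitz in the sup norm and maps into a compact cube, on which
  -- the field is bounded and Lipschitz.
  set clamp : (ι → ℝ) → ι → ℝ := fun θ p => max (θ₀ p - r) (min (θ₀ p + r) (θ p)) with hc
  have hclip : LipschitzWith 1 clamp := by
    refine LipschitzWith.of_dist_le_mul fun θ θ' => ?_
    rw [NNReal.coe_one, one_mul]
    refine (dist_pi_le_iff dist_nonneg).2 fun p => ?_
    have h1 : LipschitzWith 1 fun x : ℝ => max (θ₀ p - r) (min (θ₀ p + r) x) :=
      (LipschitzWith.id.const_min _).const_max _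
    have := h1.dist_le_mul (θ p) (θ' p)
    rw [NNReal.coe_one, one_mul] at this
    exact this.trans (dist_le_pi_dist θ θ' p)
  have hmem : ∀ θ, clamp θ ∈ Metric.closedBall θ₀ r := fun θ => by
    rw [Metric.mem_closedBall, dist_pi_le_iff hr]
    intro p
    rw [Real.dist_eq, abs_le]
    constructor
    · have := le_max_left (θ₀ p - r) (min (θ₀ p + r) (θ p))
      simp only [hc]; linarith
    · have : max (θ₀ p - r) (min (θ₀ p + r) (θ p)) ≤ θ₀ p + r :=
        max_le (by linarith) (min_le_left _ _)
      simp only [hc]; linarith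
  have hcomp : IsCompact (Metric.closedBall θ₀ r) := isCompact_closedBall _ _
  obtain ⟨K, hK⟩ := LocallyLipschitzOn.exists_lipschitzOnWith_of_compact hcomp
    (hV.locallyLipschitzOn (s := Metric.closedBall θ₀ r))
  obtain ⟨L, hL⟩ := hcomp.exists_bound_of_continuousOn hV.continuous.continuousOn
  refine ⟨fun θ => V (clamp θ), K * 1, L.toNNReal, ?_, fun θ => ?_, fun θ hθ => ?_⟩
  · rw [← lipschitzOnWith_univ]
    exact hK.comp hclip.lipschitzOnWith fun θ _ => hmem θ
  · exact (hL _ (hmem θ)).trans (Real.le_coe_toNNReal L)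
  · have : clamp θ = θ := funext fun p => by
      have := abs_le.1 (hθ p)
      simp only [hc]
      rw [min_eq_right (by linarith), max_eq_right (by linarith)]
    exact congrArg V this

end GlobalExistence

/-! ### Locally Lipschitz real functions -/

section LocallyLipschitzReal

variable {α : Type*} [PseudoEMetricSpace α]

theorem locallyLipschitz_mul {f g : α → ℝ} (hf : LocallyLipschitz f) (hg : LocallyLipschitz g) :
    LocallyLipschitz fun x => f x * g x :=
  (contDiff_mul (𝕜 := ℝ) (n := 1)).locallyLipschitz.comp (hf.prodMk hg)

theorem locallyLipschitz_add {f g : α → ℝ} (hf : LocallyLipschitz f) (hg : LocallyLipschitz g) :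
    LocallyLipschitz fun x => f x + g x :=
  (contDiff_add (𝕜 := ℝ) (F := ℝ) (n := 1)).locallyLipschitz.comp (hf.prodMk hg)

theorem locallyLipschitz_sum {κ : Type*} {s : Finset κ} {f : κ → α → ℝ}
    (hf : ∀ i ∈ s, LocallyLipschitz (f i)) : LocallyLipschitz fun x => ∑ i ∈ s, f i x := by
  classical
  induction s using Finset.induction_on with
  | empty => simpa using LocallyLipschitz.const (0 : ℝ)
  | insert a s ha ih =>
    simp only [Finset.sum_insert ha]
    exact locallyLipschitz_add (hf a (by simp)) (ih fun i hi => hf i (by simp [hi]))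

theorem locallyLipschitz_pi {ι : Type*} [Fintype ι] {f : α → ι → ℝ}
    (hf : ∀ i, LocallyLipschitz fun x => f x i) : LocallyLipschitz f := by
  intro x
  choose K t ht hK using fun i => hf i x
  refine ⟨∑ i, K i, ⋂ i, t i, Filter.iInter_mem.2 ht, fun y hy z hz => ?_⟩
  rw [edist_pi_le_iff]
  intro i
  refine (hK i (Set.mem_iInter.1 hy i) (Set.mem_iInter.1 hz i)).trans ?_
  gcongr
  exact_mod_cast Finset.single_le_sum (fun i _ => zero_le) (Finset.mem_univ i)

theorem locallyLipschitz_eval {ι : Type*} [Fintype ι] (p : ι) :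
    LocallyLipschitz fun θ : ι → ℝ => θ p :=
  (contDiff_apply ℝ ℝ (n := 1) p).locallyLipschitz

end LocallyLipschitzReal

/-! ### Decay and confinement of the gradient flow -/

section Flow
open Topology Set

/-- A Grönwall inequality with damping and an exponentially decaying source. -/
theorem le_exp_of_deriv_le {S S' : ℝ → ℝ} {T b κ : ℝ} (hb : 0 < b) (hκ : 0 ≤ κ)
    (hS : ContinuousOn S (Icc 0 T)) (hS' : ∀ t ∈ Ico 0 T, HasDerivWithinAt S (S' t) (Ici t) t)
    (hle : ∀ t ∈ Ico 0 T, S' t ≤ -b * S t + κ * Real.exp (-(2 * b * t))) {t : ℝ}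
    (ht : t ∈ Icc 0 T) : S t ≤ Real.exp (-(b * t)) * (S 0 + κ / b) := by
  have hexp : ∀ c t : ℝ, HasDerivAt (fun t : ℝ => Real.exp (c * t)) (Real.exp (c * t) * c) t :=
    fun c t => by simpa using ((hasDerivAt_id t).const_mul c).exp
  -- The integrating factor `exp (b * t)` removes the damping and turns the source into `κ * exp (-b
  -- * t)`, of total mass at most `κ / b`.
  have h := image_le_of_deriv_right_le_deriv_boundary
    (f := fun t => Real.exp (b * t) * S t)
    (f' := fun t => Real.exp (b * t) * b * S t + Real.exp (b * t) * S' t)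
    (B := fun t => S 0 + κ / b * (1 - Real.exp (-b * t)))
    (B' := fun t => κ * Real.exp (-b * t)) (a := 0) (b := T)
    ((by fun_prop : Continuous fun t : ℝ => Real.exp (b * t)).continuousOn.mul hS)
    (fun t ht => (hexp b t).hasDerivWithinAt.mul (hS' t ht)) (by simp) (by fun_prop)
    (fun t _ => by
      have := ((((hexp (-b) t).const_sub 1).const_mul (κ / b)).const_add (S 0)).hasDerivWithinAt
        (s := Ici t)
      refine this.congr_deriv ?_
      have := hb.ne'
      field_simp)
    (fun t ht => by
      have h1 := mul_le_mul_of_nonneg_left (hle t ht) (Real.exp_pos (b * t)).le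
      have h2 : Real.exp (b * t) * Real.exp (-(2 * b * t)) = Real.exp (-b * t) := by
        rw [← Real.exp_add]; congr 1; ring
      nlinarith) ht
  have h3 : Real.exp (b * t) * S t ≤ S 0 + κ / b := by
    refine h.trans ?_
    have : 0 ≤ κ / b * Real.exp (-b * t) := by positivity
    linarith
  rw [Real.exp_neg, inv_mul_eq_div, le_div_iff₀ (Real.exp_pos _)]
  linarith

/-- The bound on the speed has integral at most `M / c`, whatever the horizon `T`. -/
theorem norm_le_of_norm_deriv_le_exp {E : Type*} [NormedAddCommGroup E] [NormedSpace ℝ E]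
    {ψ ψ' : ℝ → E} {T c M : ℝ} (hc : 0 < c) (hψ : ContinuousOn ψ (Icc 0 T))
    (hψ' : ∀ t ∈ Ico 0 T, HasDerivWithinAt ψ (ψ' t) (Ici t) t) (h0 : ψ 0 = 0) (hM : 0 ≤ M)
    (hle : ∀ t ∈ Ico 0 T, ‖ψ' t‖ ≤ M * Real.exp (-(c * t))) {t : ℝ} (ht : t ∈ Icc 0 T) :
    ‖ψ t‖ ≤ M / c := by
  have hexp : ∀ c t : ℝ, HasDerivAt (fun t : ℝ => Real.exp (c * t)) (Real.exp (c * t) * c) t :=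
    fun c t => by simpa using ((hasDerivAt_id t).const_mul c).exp
  have h := image_norm_le_of_norm_deriv_right_le_deriv_boundary hψ hψ'
    (B := fun t => M / c * (1 - Real.exp (-c * t))) (B' := fun t => M * Real.exp (-c * t))
    (by simp [h0]) (fun t => by
      refine (((hexp (-c) t).const_sub 1).const_mul (M / c)).congr_deriv ?_
      have := hc.ne'
      field_simp) (fun t ht => by simpa [neg_mul] using hle t ht) ht
  refine h.trans ?_
  have : 0 ≤ M / c * Real.exp (-c * t) := by positivity
  linarith

variable {ι : Type*} [Fintype ι] {n : ℕ}

/-- The gradient flow of a sum-of-squares loss: the velocity at `θ`. -/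
def velocity (α : ι → ℝ) (f : Fin n → (ι → ℝ) → ℝ) (G : Fin n → (ι → ℝ) → ι → ℝ) (y : Fin n → ℝ)
    (θ : ι → ℝ) (p : ι) : ℝ := -α p * ∑ b, (f b θ - y b) * G b θ p

/-- The tangent kernel of a model. -/
def kern (α : ι → ℝ) (g g' : ι → ℝ) : ℝ := ∑ p, α p * g p * g' p

theorem dotCLM_velocity (α : ι → ℝ) (f : Fin n → (ι → ℝ) → ℝ) (G : Fin n → (ι → ℝ) → ι → ℝ)
    (y : Fin n → ℝ) (θ g : ι → ℝ) :
    dotCLM g (velocity α f G y θ) = -∑ b, kern α g (G b θ) * (f b θ - y b) := by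
  simp only [dotCLM_apply, velocity, kern, Finset.sum_mul, Finset.mul_sum]
  rw [Finset.sum_comm, ← Finset.sum_neg_distrib]
  refine Finset.sum_congr rfl fun b _ => ?_
  rw [← Finset.sum_neg_distrib]
  exact Finset.sum_congr rfl fun p _ => by ring

/-- Solutions of the gradient flow do not leave a ball on which the kernel is uniformly positive
definite, provided the residuals are initially small enough. -/
theorem flow_trapped {α : ι → ℝ} {f : Fin n → (ι → ℝ) → ℝ} {G : Fin n → (ι → ℝ) → ι → ℝ}
    {y : Fin n → ℝ} {θ₀ : ι → ℝ} {r c M : ℝ} (hc : 0 < c) (hM : 0 ≤ M)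
    (hG : ∀ a θ, HasFDerivAt (f a) (dotCLM (G a θ)) θ)
    (hpos : ∀ θ, nrm (fun p => θ p - θ₀ p) ≤ r → ∀ u : Fin n → ℝ,
      c * nrm u ^ 2 ≤ ∑ a, u a * ∑ b, kern α (G a θ) (G b θ) * u b)
    (hvel : ∀ θ, nrm (fun p => θ p - θ₀ p) ≤ r →
      nrm (velocity α f G y θ) ≤ M * nrm fun a => f a θ - y a)
    (hr : M * nrm (fun a => f a θ₀ - y a) / c < r)
    {θ : ℝ → ι → ℝ} {T : ℝ} (h0 : θ 0 = θ₀) (hcont : ContinuousOn θ (Icc 0 T))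
    (hθ : ∀ t ∈ Ico 0 T, nrm (fun p => θ t p - θ₀ p) < r →
      HasDerivWithinAt θ (velocity α f G y (θ t)) (Ici t) t) :
    ∀ t ∈ Icc 0 T, nrm (fun p => θ t p - θ₀ p) < r ∧
      nrm (fun a => f a (θ t) - y a) ≤ Real.exp (-(c * t)) * nrm (fun a => f a θ₀ - y a) := by
  set R := nrm (fun a => f a θ₀ - y a) with hR
  have hR0 : 0 ≤ R := nrm_nonneg _
  -- as long as the solution stays inside, the residuals decay and it stays well inside
  have key : ∀ T', T' ≤ T → (∀ t ∈ Ico 0 T', nrm (fun p => θ t p - θ₀ p) < r) →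
      ∀ t ∈ Icc 0 T', nrm (fun a => f a (θ t) - y a) ≤ Real.exp (-(c * t)) * R ∧
        nrm (fun p => θ t p - θ₀ p) ≤ M * R / c := by
    intro T' hT' hin
    have hcont' : ContinuousOn θ (Icc 0 T') := hcont.mono (Icc_subset_Icc_right hT')
    have hd : ∀ t ∈ Ico 0 T', HasDerivWithinAt θ (velocity α f G y (θ t)) (Ici t) t :=
      fun t ht => hθ t ⟨ht.1, ht.2.trans_le hT'⟩ (hin t ht)
    have hfc : ∀ a, Continuous (f a) := fun a =>
      continuous_iff_continuousAt.2 fun θ => (hG a θ).continuousAt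
    have hres : ∀ t ∈ Icc 0 T', nrm (fun a => f a (θ t) - y a) ≤ Real.exp (-(c * t)) * R := by
      intro t ht
      -- The squared residual decays at rate `2 * c`, without a source.
      have h := le_exp_of_deriv_le (S := fun t => ∑ a, (f a (θ t) - y a) ^ 2)
        (S' := fun t => ∑ a, 2 * (f a (θ t) - y a) *
          dotCLM (G a (θ t)) (velocity α f G y (θ t))) (b := 2 * c) (κ := 0) (T := T')
        (by positivity) le_rfl
        (continuousOn_finsetSum _ fun a _ =>
          (((hfc a).comp_continuousOn hcont').sub continuousOn_const).pow 2)
        (fun t ht => HasDerivWithinAt.fun_sum fun a _ => by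
          have := (((hG a (θ t)).comp_hasDerivWithinAt t (hd t ht)).sub_const (y a)).fun_pow 2
          simpa using this)
        (fun t ht => by
          have h1 := hpos (θ t) (hin t ht).le fun a => f a (θ t) - y a
          rw [nrm_sq] at h1
          simp only [dotCLM_velocity]
          have e : ∑ a, 2 * (f a (θ t) - y a) * -∑ b, kern α (G a (θ t)) (G b (θ t)) *
              (f b (θ t) - y b) = -2 * ∑ a, (f a (θ t) - y a) *
              ∑ b, kern α (G a (θ t)) (G b (θ t)) * (f b (θ t) - y b) := by
            rw [Finset.mul_sum]
            exact Finset.sum_congr rfl fun a _ => by ring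
          rw [e]
          linarith) ht
      simp only [h0, zero_div, add_zero] at h
      rw [← nrm_sq fun a => f a θ₀ - y a, ← hR] at h
      refine nrm_le_of_sq_le (by positivity) (h.trans (le_of_eq ?_))
      rw [mul_pow, ← Real.exp_nat_mul]
      congr 2
      push_cast
      ring
    refine fun t ht => ⟨hres t ht, ?_⟩
    have hE : ∀ t ∈ Ico 0 T', HasDerivWithinAt
        (fun t => (WithLp.toLp 2 (fun p => θ t p - θ₀ p) : EuclideanSpace ℝ ι))
        (WithLp.toLp 2 (velocity α f G y (θ t))) (Ici t) t := fun t ht =>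
      (EuclideanSpace.equiv ι ℝ).symm.toContinuousLinearMap.hasFDerivAt.comp_hasDerivWithinAt t
        ((hd t ht).sub_const θ₀)
    have hEc : ContinuousOn
        (fun t => (WithLp.toLp 2 (fun p => θ t p - θ₀ p) : EuclideanSpace ℝ ι)) (Icc 0 T') :=
      (EuclideanSpace.equiv ι ℝ).symm.continuous.comp_continuousOn
        (hcont'.sub continuousOn_const)
    have h := norm_le_of_norm_deriv_le_exp (M := M * R) hc hEc hE (by simp [h0]; rfl)
      (by positivity) (fun t ht => by
        rw [norm_toLp]
        refine (hvel _ (hin t ht).le).trans ?_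
        have := mul_le_mul_of_nonneg_left (hres t ⟨ht.1, ht.2.le⟩) hM
        linarith) ht
    rwa [norm_toLp] at h
  have hinside : ∀ t ∈ Icc 0 T, nrm (fun p => θ t p - θ₀ p) < r := by
    by_contra hcon
    push Not at hcon
    obtain ⟨t₁, ht₁, hrt₁⟩ := hcon
    have hnc : ContinuousOn (fun t => nrm (fun p => θ t p - θ₀ p)) (Icc 0 T) := by
      simp only [← norm_toLp]
      exact ((EuclideanSpace.equiv ι ℝ).symm.continuous.comp_continuousOn
        (hcont.sub continuousOn_const)).norm
    have hclosed : IsCompact (Icc 0 T ∩ (fun t => nrm (fun p => θ t p - θ₀ p)) ⁻¹' Ici r) :=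
      isCompact_Icc.of_isClosed_subset (hnc.preimage_isClosed_of_isClosed isClosed_Icc isClosed_Ici)
        inter_subset_left
    -- `s` is the first time at distance at least `r`. The solution was inside before, so `key` puts
    -- it within `M * R / c < r` at time `s`, a contradiction.
    obtain ⟨s, hs, hmin⟩ := hclosed.exists_isLeast ⟨t₁, ht₁, hrt₁⟩
    have h1 := (key s hs.1.2 (fun t ht => by
      by_contra hcon
      exact absurd (hmin ⟨⟨ht.1, ht.2.le.trans hs.1.2⟩, not_lt.1 hcon⟩) (not_le.2 ht.2)) s
      ⟨hs.1.1, le_rfl⟩).2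
    exact absurd (hs.2.trans h1) (not_le.2 hr)
  exact fun t ht => ⟨hinside t ht, (key T le_rfl (fun t ht => hinside t ⟨ht.1, ht.2.le⟩) t ht).1⟩

/-- Under the conditions of `flow_trapped`, the flow exists for all times. -/
theorem exists_flow {α : ι → ℝ} {f : Fin n → (ι → ℝ) → ℝ} {G : Fin n → (ι → ℝ) → ι → ℝ}
    {y : Fin n → ℝ} {θ₀ : ι → ℝ} {r c M : ℝ} (hc : 0 < c) (hM : 0 ≤ M)
    (hG : ∀ a θ, HasFDerivAt (f a) (dotCLM (G a θ)) θ)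
    (hpos : ∀ θ, nrm (fun p => θ p - θ₀ p) ≤ r → ∀ u : Fin n → ℝ,
      c * nrm u ^ 2 ≤ ∑ a, u a * ∑ b, kern α (G a θ) (G b θ) * u b)
    (hvel : ∀ θ, nrm (fun p => θ p - θ₀ p) ≤ r →
      nrm (velocity α f G y θ) ≤ M * nrm fun a => f a θ - y a)
    (hr : M * nrm (fun a => f a θ₀ - y a) / c < r)
    (hlip : LocallyLipschitz (velocity α f G y)) :
    ∃ θ : ℝ → ι → ℝ, θ 0 = θ₀ ∧
      ∀ t, 0 ≤ t → HasDerivWithinAt θ (velocity α f G y (θ t)) (Ici 0) t := by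
  have hr0 : 0 ≤ r := by
    have : 0 ≤ M * nrm (fun a => f a θ₀ - y a) / c :=
      div_nonneg (mul_nonneg hM (nrm_nonneg _)) hc.le
    linarith
  obtain ⟨W, K, L, hW, hWL, hWV⟩ := exists_lipschitz_eq_near hlip θ₀ hr0
  obtain ⟨θ, h0, hθ⟩ := exists_integralCurve_of_lipschitz hW hWL θ₀
  have hin : ∀ t, 0 ≤ t → nrm (fun p => θ t p - θ₀ p) < r := fun t ht =>
    -- `flow_trapped` asks for the equation only while the distance is below `r`, where the
    -- truncated field `W` is the true velocity. The solution therefore never meets the truncation.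
    (flow_trapped hc hM hG hpos hvel hr (T := t) h0
      (fun s hs => (hθ s hs.1).continuousWithinAt.mono Icc_subset_Ici_self) (fun s hs hsr => by
        have := (hθ s hs.1).mono (Ici_subset_Ici.2 hs.1)
        rwa [hWV _ fun p => (abs_le_nrm _ p).trans hsr.le] at this) t ⟨ht, le_rfl⟩).1
  refine ⟨θ, h0, fun t ht => ?_⟩
  rw [← hWV _ fun p => (abs_le_nrm _ p).trans (hin t ht).le]
  exact hθ t ht

end Flow

/-! ### Comparison of two linear systems -/

section Comparison
open Topology Set

variable {n : ℕ}

theorem abs_sum_mul_le_of_abs_le {h v : Fin n → ℝ} {κ : ℝ} (hκ : ∀ b, |h b| ≤ κ) :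
    |∑ b, h b * v b| ≤ n * κ * nrm v := by
  refine (Finset.abs_sum_le_sum_abs _ _).trans ?_
  calc ∑ b, |h b * v b| ≤ ∑ _b : Fin n, κ * nrm v := Finset.sum_le_sum fun b _ => by
        rw [abs_mul]
        exact mul_le_mul (hκ b) (abs_le_nrm v b) (abs_nonneg _) ((abs_nonneg _).trans (hκ b))
    _ = n * κ * nrm v := by simp [mul_assoc]

theorem abs_bilin_le_of_abs_le {E : Fin n → Fin n → ℝ} {κ : ℝ} (hE : ∀ a b, |E a b| ≤ κ)
    (u v : Fin n → ℝ) : |∑ a, u a * ∑ b, E a b * v b| ≤ n * (n * κ) * nrm u * nrm v := by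
  have h := abs_sum_mul_le_of_abs_le (h := fun a => ∑ b, E a b * v b) (v := u)
    (κ := n * κ * nrm v) fun a => abs_sum_mul_le_of_abs_le (hE a)
  simp only [mul_comm (u _)]
  linarith

variable {r q : ℝ → Fin n → ℝ} {H : ℝ → Fin n → Fin n → ℝ} {H₀ : Fin n → Fin n → ℝ} {c κ R : ℝ}

/-- Two linear systems with nearby coefficients and the same initial value, one of which is
exponentially stable. -/
theorem nrm_sub_le_of_linear_systems (hc : 0 < c) (hκ : 0 ≤ κ) (hR : 0 ≤ R)
    (hr : ∀ t, 0 ≤ t → ∀ a, HasDerivWithinAt (fun t => r t a) (-∑ b, H t a b * r t b) (Ici 0) t)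
    (hq : ∀ t, 0 ≤ t → ∀ a, HasDerivWithinAt (fun t => q t a) (-∑ b, H₀ a b * q t b) (Ici 0) t)
    (h0 : r 0 = q 0)
    (hpos : ∀ u : Fin n → ℝ, c * nrm u ^ 2 ≤ ∑ a, u a * ∑ b, H₀ a b * u b)
    (hclose : ∀ t, 0 ≤ t → ∀ a b, |H t a b - H₀ a b| ≤ κ)
    (hdecay : ∀ t, 0 ≤ t → nrm (r t) ≤ Real.exp (-(c * t)) * R) {t : ℝ} (ht : 0 ≤ t) :
    nrm (fun a => r t a - q t a) ≤ Real.exp (-(c / 2 * t)) * (n * (n * κ) * R / c) := by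
  set k := n * (n * κ) * R with hk
  have hk0 : 0 ≤ k := by positivity
  have hd : ∀ t, 0 ≤ t → ∀ a, HasDerivWithinAt (fun t => (r t a - q t a) ^ 2)
      (2 * (r t a - q t a) * (-∑ b, H t a b * r t b - -∑ b, H₀ a b * q t b)) (Ici 0) t :=
    fun t ht a => by simpa using ((hr t ht a).fun_sub (hq t ht a)).fun_pow 2
  have h := le_exp_of_deriv_le (S := fun t => ∑ a, (r t a - q t a) ^ 2)
    (S' := fun t => ∑ a, 2 * (r t a - q t a) * (-∑ b, H t a b * r t b - -∑ b, H₀ a b * q t b))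
    (b := c) (κ := k ^ 2 / c) (T := t) hc (by positivity)
    (continuousOn_finsetSum _ fun a _ s hs =>
      ((hd s hs.1 a).continuousWithinAt).mono Icc_subset_Ici_self)
    (fun s hs => HasDerivWithinAt.fun_sum fun a _ => (hd s hs.1 a).mono (Ici_subset_Ici.2 hs.1))
    (fun s hs => by
      have e : ∑ a, 2 * (r s a - q s a) * (-∑ b, H s a b * r s b - -∑ b, H₀ a b * q s b) =
          -2 * ∑ a, (r s a - q s a) * ∑ b, H₀ a b * (r s b - q s b) -
          2 * ∑ a, (r s a - q s a) * ∑ b, (H s a b - H₀ a b) * r s b := by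
        rw [Finset.mul_sum, Finset.mul_sum, ← Finset.sum_sub_distrib]
        refine Finset.sum_congr rfl fun a _ => ?_
        simp only [mul_sub, sub_mul, Finset.sum_sub_distrib]
        ring
      have h1 := hpos fun a => r s a - q s a
      have h2 := (abs_le.1 (abs_bilin_le_of_abs_le (hclose s hs.1)
        (fun a => r s a - q s a) (r s))).1
      have h3 := hdecay s hs.1
      have h4 : Real.exp (-(2 * c * s)) = Real.exp (-(c * s)) ^ 2 := by
        rw [← Real.exp_nat_mul]; congr 1; push_cast; ring
      rw [e, ← nrm_sq, h4]
      set N := nrm fun a => r s a - q s a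
      have hN : 0 ≤ N := nrm_nonneg _
      have h5 : n * (n * κ) * N * nrm (r s) ≤ k * N * Real.exp (-(c * s)) := by
        calc _ ≤ n * (n * κ) * N * (Real.exp (-(c * s)) * R) :=
              mul_le_mul_of_nonneg_left h3 (by positivity)
          _ = _ := by rw [hk]; ring
      -- Completing the square, half of the damping `2 * c` absorbs the perturbation. What remains
      -- is the rate `c` and a source of size `k ^ 2 / c`.
      have h6 : 2 * (k * N * Real.exp (-(c * s))) ≤
          c * N ^ 2 + k ^ 2 / c * Real.exp (-(c * s)) ^ 2 := by
        have : c * N ^ 2 + k ^ 2 / c * Real.exp (-(c * s)) ^ 2 - 2 * (k * N * Real.exp (-(c * s))) =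
            (c * N - k * Real.exp (-(c * s))) ^ 2 / c := by
          field_simp
          ring
        have h7 : 0 ≤ (c * N - k * Real.exp (-(c * s))) ^ 2 / c := by positivity
        linarith
      linarith) (t := t) ⟨ht, le_rfl⟩
  refine nrm_le_of_sq_le (by positivity) (h.trans (le_of_eq ?_))
  rw [h0, mul_pow (Real.exp _), ← Real.exp_nat_mul]
  have : ∑ a, (q 0 a - q 0 a) ^ 2 = 0 := by simp
  rw [this, zero_add]
  have e : ((2 : ℕ) : ℝ) * -(c / 2 * t) = -(c * t) := by push_cast; ring
  rw [e]
  field_simp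

/-- The deviation of a further output which is driven by two nearby linear systems. -/
theorem abs_sub_le_of_linear_systems (hc : 0 < c) (hκ : 0 ≤ κ) (hR : 0 ≤ R)
    (hr : ∀ t, 0 ≤ t → ∀ a, HasDerivWithinAt (fun t => r t a) (-∑ b, H t a b * r t b) (Ici 0) t)
    (hq : ∀ t, 0 ≤ t → ∀ a, HasDerivWithinAt (fun t => q t a) (-∑ b, H₀ a b * q t b) (Ici 0) t)
    (h0 : r 0 = q 0)
    (hpos : ∀ u : Fin n → ℝ, c * nrm u ^ 2 ≤ ∑ a, u a * ∑ b, H₀ a b * u b)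
    (hclose : ∀ t, 0 ≤ t → ∀ a b, |H t a b - H₀ a b| ≤ κ)
    (hdecay : ∀ t, 0 ≤ t → nrm (r t) ≤ Real.exp (-(c * t)) * R)
    {φ ψ : ℝ → ℝ} {w : ℝ → Fin n → ℝ} {w₀ : Fin n → ℝ} {K : ℝ} (hK : 0 ≤ K)
    (hφ : ∀ t, 0 ≤ t → HasDerivWithinAt φ (-∑ b, w t b * r t b) (Ici 0) t)
    (hψ : ∀ t, 0 ≤ t → HasDerivWithinAt ψ (-∑ b, w₀ b * q t b) (Ici 0) t) (hφψ : φ 0 = ψ 0)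
    (hw : ∀ t, 0 ≤ t → ∀ b, |w t b - w₀ b| ≤ κ) (hw₀ : ∀ b, |w₀ b| ≤ K) {t : ℝ} (ht : 0 ≤ t) :
    |φ t - ψ t| ≤ (n * κ * R + n * K * (n * (n * κ) * R / c)) / (c / 2) := by
  have hd : ∀ t, 0 ≤ t → HasDerivWithinAt (fun t => φ t - ψ t)
      (-∑ b, w t b * r t b - -∑ b, w₀ b * q t b) (Ici 0) t :=
    fun t ht => (hφ t ht).fun_sub (hψ t ht)
  refine norm_le_of_norm_deriv_le_exp (ψ := fun t => φ t - ψ t) (T := t) (by positivity)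
    (fun s hs => ((hd s hs.1).continuousWithinAt).mono Icc_subset_Ici_self)
    (fun s hs => (hd s hs.1).mono (Ici_subset_Ici.2 hs.1)) (by simp [hφψ]) (by positivity)
    (fun s hs => ?_) ⟨ht, le_rfl⟩
  -- The drifts differ by a change of coefficients acting on a decaying residual, and by fixed
  -- coefficients acting on the difference of the residuals, which decays at rate `c / 2`.
  have e : -∑ b, w s b * r s b - -∑ b, w₀ b * q s b =
      -∑ b, (w s b - w₀ b) * r s b - ∑ b, w₀ b * (r s b - q s b) := by
    simp only [mul_sub, sub_mul, Finset.sum_sub_distrib]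
    ring
  have h1 := abs_sum_mul_le_of_abs_le (v := r s) (hw s hs.1)
  have h2 := abs_sum_mul_le_of_abs_le (v := fun b => r s b - q s b) hw₀
  have h3 := nrm_sub_le_of_linear_systems hc hκ hR hr hq h0 hpos hclose hdecay hs.1
  have h4 : nrm (r s) ≤ Real.exp (-(c / 2 * s)) * R := (hdecay s hs.1).trans
    (mul_le_mul_of_nonneg_right (Real.exp_le_exp.2 (by nlinarith [hs.1])) hR)
  rw [e, Real.norm_eq_abs]
  refine (abs_sub _ _).trans ?_
  rw [abs_neg]
  have h5 := mul_le_mul_of_nonneg_left h4 (by positivity : 0 ≤ n * κ)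
  have h6 := mul_le_mul_of_nonneg_left h3 (by positivity : 0 ≤ n * K)
  linarith

end Comparison

/-! ### Lazy training of an abstract model -/

section AbstractLazy
open Topology Set

variable {n : ℕ} {ι 𝒳 : Type*} [Fintype ι]

/-- The linearization of a model at `θ₀`. -/
def linModel (f : 𝒳 → (ι → ℝ) → ℝ) (G : 𝒳 → (ι → ℝ) → ι → ℝ) (θ₀ : ι → ℝ) (z : 𝒳) (θ : ι → ℝ) : ℝ :=
  f z θ₀ + dotCLM (G z θ₀) (θ - θ₀)

theorem hasFDerivAt_linModel (f : 𝒳 → (ι → ℝ) → ℝ) (G : 𝒳 → (ι → ℝ) → ι → ℝ) (θ₀ : ι → ℝ) (z : 𝒳)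
    (θ : ι → ℝ) : HasFDerivAt (linModel f G θ₀ z) (dotCLM (G z θ₀)) θ := by
  have := ((dotCLM (G z θ₀)).hasFDerivAt.comp θ ((hasFDerivAt_id θ).sub_const θ₀)).const_add (f z θ₀)
  exact this

/-- The gradient flow trains the model exponentially fast and stays close to the flow of its
linearization, if the kernel varies little near the initial value. -/
theorem lazy_of_kern_close {f : 𝒳 → (ι → ℝ) → ℝ} {G : 𝒳 → (ι → ℝ) → ι → ℝ} {X : Fin n → 𝒳} {x : 𝒳}
    {α : ι → ℝ} {y : Fin n → ℝ} {θ₀ : ι → ℝ} {r c M κ K R : ℝ} (hc : 0 < c) (hM : 0 ≤ M)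
    (hκ : 0 ≤ κ) (hK : 0 ≤ K)
    (hG : ∀ z θ, HasFDerivAt (f z) (dotCLM (G z θ)) θ)
    (hpos : ∀ θ, nrm (fun p => θ p - θ₀ p) ≤ r → ∀ u : Fin n → ℝ,
      c * nrm u ^ 2 ≤ ∑ a, u a * ∑ b, kern α (G (X a) θ) (G (X b) θ) * u b)
    (hvel : ∀ θ, nrm (fun p => θ p - θ₀ p) ≤ r →
      nrm (velocity α (fun a => f (X a)) (fun a => G (X a)) y θ) ≤
        M * nrm fun a => f (X a) θ - y a)
    (hR : nrm (fun a => f (X a) θ₀ - y a) ≤ R) (hr : M * R / c < r)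
    (hclose : ∀ θ, nrm (fun p => θ p - θ₀ p) ≤ r → ∀ a b,
      |kern α (G (X a) θ) (G (X b) θ) - kern α (G (X a) θ₀) (G (X b) θ₀)| ≤ κ)
    (hclose' : ∀ θ, nrm (fun p => θ p - θ₀ p) ≤ r → ∀ b,
      |kern α (G x θ) (G (X b) θ) - kern α (G x θ₀) (G (X b) θ₀)| ≤ κ)
    (hx : ∀ b, |kern α (G x θ₀) (G (X b) θ₀)| ≤ K)
    {θ θ' : ℝ → ι → ℝ} (hθ0 : θ 0 = θ₀) (hθ'0 : θ' 0 = θ₀)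
    (hθ : ∀ t, 0 ≤ t → HasDerivWithinAt θ
      (velocity α (fun a => f (X a)) (fun a => G (X a)) y (θ t)) (Ici 0) t)
    (hθ' : ∀ t, 0 ≤ t → HasDerivWithinAt θ'
      (velocity α (fun a => linModel f G θ₀ (X a)) (fun a _ => G (X a) θ₀) y (θ' t)) (Ici 0) t)
    {t : ℝ} (ht : 0 ≤ t) :
    nrm (fun a => f (X a) (θ t) - linModel f G θ₀ (X a) (θ' t)) ≤ n * (n * κ) * R / c ∧
    |f x (θ t) - linModel f G θ₀ x (θ' t)| ≤
      (n * κ * R + n * K * (n * (n * κ) * R / c)) / (c / 2) := by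
  have hR0 : 0 ≤ R := (nrm_nonneg _).trans hR
  have hr0 : 0 ≤ r := (by positivity : 0 ≤ M * R / c).trans hr.le
  -- Confinement applies to every solution, so uniqueness of the flow is not needed.
  have htrap : ∀ t, 0 ≤ t → nrm (fun p => θ t p - θ₀ p) < r ∧
      nrm (fun a => f (X a) (θ t) - y a) ≤ Real.exp (-(c * t)) * R := fun t ht => by
    have h := flow_trapped hc hM (fun a => hG (X a)) hpos hvel
      (lt_of_le_of_lt (by gcongr) hr) (T := t) hθ0
      (fun s hs => (hθ s hs.1).continuousWithinAt.mono Icc_subset_Ici_self)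
      (fun s hs _ => (hθ s hs.1).mono (Ici_subset_Ici.2 hs.1)) t ⟨ht, le_rfl⟩
    exact ⟨h.1, h.2.trans (mul_le_mul_of_nonneg_left hR (Real.exp_pos _).le)⟩
  have hdr : ∀ z t, 0 ≤ t → HasDerivWithinAt (fun t => f z (θ t))
      (-∑ b, kern α (G z (θ t)) (G (X b) (θ t)) * (f (X b) (θ t) - y b)) (Ici 0) t :=
    fun z t ht => by
      have := (hG z (θ t)).comp_hasDerivWithinAt t (hθ t ht)
      rwa [dotCLM_velocity] at this
  have hdq : ∀ z t, 0 ≤ t → HasDerivWithinAt (fun t => linModel f G θ₀ z (θ' t))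
      (-∑ b, kern α (G z θ₀) (G (X b) θ₀) * (linModel f G θ₀ (X b) (θ' t) - y b)) (Ici 0) t :=
    fun z t ht => by
      have := (hasFDerivAt_linModel f G θ₀ z (θ' t)).comp_hasDerivWithinAt t (hθ' t ht)
      rwa [dotCLM_velocity] at this
  have hinit : ∀ z, f z (θ 0) = linModel f G θ₀ z (θ' 0) := fun z => by
    rw [hθ0, hθ'0, linModel, sub_self, map_zero, add_zero]
  have hpos₀ := hpos θ₀ (by simpa [nrm] using hr0)
  have hr' : ∀ t, 0 ≤ t → ∀ a, HasDerivWithinAt (fun t => f (X a) (θ t) - y a)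
      (-∑ b, kern α (G (X a) (θ t)) (G (X b) (θ t)) * (f (X b) (θ t) - y b)) (Ici 0) t :=
    fun t ht a => (hdr (X a) t ht).sub_const (y a)
  have hq' : ∀ t, 0 ≤ t → ∀ a, HasDerivWithinAt (fun t => linModel f G θ₀ (X a) (θ' t) - y a)
      (-∑ b, kern α (G (X a) θ₀) (G (X b) θ₀) * (linModel f G θ₀ (X b) (θ' t) - y b)) (Ici 0) t :=
    fun t ht a => (hdq (X a) t ht).sub_const (y a)
  have h0 : (fun a => f (X a) (θ 0) - y a) = fun a => linModel f G θ₀ (X a) (θ' 0) - y a :=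
    funext fun a => by rw [hinit]
  constructor
  · have h := nrm_sub_le_of_linear_systems (r := fun t a => f (X a) (θ t) - y a)
      (q := fun t a => linModel f G θ₀ (X a) (θ' t) - y a)
      (H := fun t a b => kern α (G (X a) (θ t)) (G (X b) (θ t)))
      (H₀ := fun a b => kern α (G (X a) θ₀) (G (X b) θ₀)) hc hκ hR0 hr' hq' h0 hpos₀
      (fun t ht => hclose _ (htrap t ht).1.le) (fun t ht => (htrap t ht).2) ht
    simp only [sub_sub_sub_cancel_right] at h
    refine h.trans (mul_le_of_le_one_left (by positivity) (Real.exp_le_one_iff.2 ?_))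
    have : 0 ≤ c / 2 * t := by positivity
    linarith
  · exact abs_sub_le_of_linear_systems (r := fun t a => f (X a) (θ t) - y a)
      (q := fun t a => linModel f G θ₀ (X a) (θ' t) - y a)
      (H := fun t a b => kern α (G (X a) (θ t)) (G (X b) (θ t)))
      (H₀ := fun a b => kern α (G (X a) θ₀) (G (X b) θ₀)) hc hκ hR0 hr' hq' h0 hpos₀
      (fun t ht => hclose _ (htrap t ht).1.le) (fun t ht => (htrap t ht).2) hK
      (hdr x) (hdq x) (hinit x) (fun t ht => hclose' _ (htrap t ht).1.le) hx ht

end AbstractLazy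

/-! ### Bounds on kernels and velocities -/

section KernelBounds

variable {n : ℕ} {ι : Type*} [Fintype ι] {α : ι → ℝ} {A : ℝ}

theorem abs_kern_le (hα : ∀ p, |α p| ≤ A) (hA : 0 ≤ A) (g g' : ι → ℝ) :
    |kern α g g'| ≤ A * nrm g * nrm g' := by
  refine (abs_sum_mul_le (fun p => α p * g p) g').trans ?_
  refine mul_le_mul_of_nonneg_right ((nrm_mul_le hα g).trans (le_of_eq ?_)) (nrm_nonneg _)
  rw [abs_of_nonneg hA]

theorem abs_kern_sub_le (hα : ∀ p, |α p| ≤ A) (hA : 0 ≤ A) (g g' h h' : ι → ℝ) :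
    |kern α g g' - kern α h h'| ≤
      A * nrm (fun p => g p - h p) * nrm g' + A * nrm h * nrm (fun p => g' p - h' p) := by
  have e : kern α g g' - kern α h h' =
      kern α (fun p => g p - h p) g' + kern α h fun p => g' p - h' p := by
    simp only [kern, ← Finset.sum_sub_distrib, ← Finset.sum_add_distrib]
    exact Finset.sum_congr rfl fun p _ => by ring
  rw [e]
  exact (abs_add_le _ _).trans (add_le_add (abs_kern_le hα hA _ _) (abs_kern_le hα hA _ _))

theorem nrm_velocity_le (hα : ∀ p, |α p| ≤ A) (hA : 0 ≤ A) {f : Fin n → (ι → ℝ) → ℝ}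
    {G : Fin n → (ι → ℝ) → ι → ℝ} {y : Fin n → ℝ} {θ : ι → ℝ} {g : ℝ}
    (hg : ∀ b, nrm (G b θ) ≤ g) :
    nrm (velocity α f G y θ) ≤ A * (n * g) * nrm fun b => f b θ - y b := by
  have h1 : nrm (velocity α f G y θ) ≤ A * nrm fun p => ∑ b, (f b θ - y b) * G b θ p := by
    have := nrm_mul_le (a := fun p => -α p) (A := A) (fun p => by rw [abs_neg]; exact hα p)
      fun p => ∑ b, (f b θ - y b) * G b θ p
    rwa [abs_of_nonneg hA] at this
  have h2 : nrm (fun q : Fin n × ι => G q.1 θ q.2) ≤ n * g :=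
    (nrm_prod_le _).trans ((Finset.sum_le_sum fun b _ => hg b).trans (by simp))
  have h3 := nrm_vecMul_le (fun b => f b θ - y b) fun b p => G b θ p
  calc _ ≤ A * (nrm (fun b => f b θ - y b) * (n * g)) := h1.trans (mul_le_mul_of_nonneg_left
        (h3.trans (mul_le_mul_of_nonneg_left h2 (nrm_nonneg _))) hA)
    _ = _ := by ring

/-- A matrix entrywise close to a uniformly positive one is uniformly positive. -/
theorem pos_of_close {A H : Fin n → Fin n → ℝ} {c₀ c κ : ℝ}
    (hA : ∀ u : Fin n → ℝ, c₀ * nrm u ^ 2 ≤ ∑ a, u a * ∑ b, A a b * u b)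
    (hH : ∀ a b, |H a b - A a b| ≤ κ) (hκ : n * (n * κ) ≤ c₀ - c) (u : Fin n → ℝ) :
    c * nrm u ^ 2 ≤ ∑ a, u a * ∑ b, H a b * u b := by
  have h1 := (abs_le.1 (abs_bilin_le_of_abs_le hH u u)).1
  have e : ∑ a, u a * ∑ b, H a b * u b =
      ∑ a, u a * ∑ b, A a b * u b + ∑ a, u a * ∑ b, (H a b - A a b) * u b := by
    rw [← Finset.sum_add_distrib]
    refine Finset.sum_congr rfl fun a _ => ?_
    simp only [sub_mul, Finset.sum_sub_distrib]
    ring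
  rw [e]
  have h2 := mul_le_mul_of_nonneg_right hκ (sq_nonneg (nrm u))
  have := hA u
  nlinarith

end KernelBounds

/-! ### Gradient flow of the squared loss -/

section LossGradient

variable {n : ℕ} {ι : Type} [Fintype ι] [DecidableEq ι]

theorem fderiv_half_sum_sq {f : Fin n → (ι → ℝ) → ℝ} {g : Fin n → ι → ℝ} {θ : ι → ℝ}
    (y : Fin n → ℝ) (hf : ∀ a, HasFDerivAt (f a) (dotCLM (g a)) θ) (p : ι) :
    fderiv ℝ (fun θ => (1 / 2 : ℝ) * ∑ a, (f a θ - y a) ^ 2) θ (Pi.single p 1) =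
      ∑ a, (f a θ - y a) * g a p := by
  have h : HasFDerivAt (fun θ => (1 / 2 : ℝ) * ∑ a, (f a θ - y a) ^ 2)
      ((1 / 2 : ℝ) • ∑ a, (2 * (f a θ - y a)) • dotCLM (g a)) θ :=
    (HasFDerivAt.fun_sum fun a _ => by
      have := (hasDerivAt_pow 2 (f a θ - y a)).comp_hasFDerivAt θ ((hf a).sub_const (y a))
      simpa [Function.comp_def] using this).const_mul _
  rw [h.fderiv]
  simp only [_root_.smul_apply, _root_.sum_apply, dotCLM_apply, smul_eq_mul, Finset.mul_sum]
  refine Finset.sum_congr rfl fun a _ => ?_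
  simp only [Pi.single_apply, mul_ite, mul_one, mul_zero, Finset.sum_ite_eq', Finset.mem_univ,
    if_true]
  ring

theorem isWeightedGradFlow_iff {f : Fin n → (ι → ℝ) → ℝ} {G : Fin n → (ι → ℝ) → ι → ℝ}
    {y : Fin n → ℝ} (hG : ∀ a θ, HasFDerivAt (f a) (dotCLM (G a θ)) θ) (η : ℝ) (a : ι → ℝ)
    (θ₀ : ι → ℝ) (θ : ℝ → ι → ℝ) :
    IsWeightedGradFlow η a (fun θ => (1 / 2 : ℝ) * ∑ b, (f b θ - y b) ^ 2) θ₀ θ ↔ θ 0 = θ₀ ∧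
      ∀ t, 0 ≤ t → HasDerivWithinAt θ (velocity (fun p => η * a p) f G y (θ t)) (Set.Ici 0) t := by
  unfold IsWeightedGradFlow
  refine and_congr_right fun _ => forall₂_congr fun t _ => ?_
  rw [hasDerivWithinAt_pi]
  refine forall_congr' fun p => ?_
  rw [fderiv_half_sum_sq y fun b => hG b (θ t)]
  rfl

end LossGradient

/-! ### Local Lipschitz continuity of the network and its gradient -/

section LocallyLipschitzNet

variable {d₀ m d n : ℕ} {σ : ℝ → ℝ} {C D Λ : ℝ}

theorem locallyLipschitz_of_abs_sub_le {φ : ℝ → ℝ} {K : ℝ} (h : ∀ z z', |φ z - φ z'| ≤ K * |z - z'|) :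
    LocallyLipschitz φ :=
  (LipschitzWith.of_dist_le' (K := K) fun z z' => by
    simpa [Real.dist_eq] using h z z').locallyLipschitz

theorem locallyLipschitz_hid (hσ : ActBounds σ C D Λ) (x : EuclideanSpace ℝ (Fin d₀)) (k : ℕ)
    (i : Fin d) : LocallyLipschitz fun θ : Params d₀ m d => hid σ θ x k i := by
  induction k generalizing i with
  | zero =>
    simp only [hid]
    exact locallyLipschitz_sum fun j _ =>
      locallyLipschitz_mul (LocallyLipschitz.const _) (locallyLipschitz_eval _)
  | succ k ih =>
    simp only [hid]
    exact locallyLipschitz_sum fun j _ => locallyLipschitz_mul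
      ((locallyLipschitz_of_abs_sub_le hσ.lip).comp (ih j)) (locallyLipschitz_eval _)

theorem locallyLipschitz_bmat (hσ : ActBounds σ C D Λ) (x : EuclideanSpace ℝ (Fin d₀)) (k s : ℕ)
    (j i : Fin d) : LocallyLipschitz fun θ : Params d₀ m d => bmat σ θ x k s j i := by
  induction s generalizing i with
  | zero =>
    simp only [bmat]
    exact locallyLipschitz_eval _
  | succ s ih =>
    simp only [bmat]
    exact locallyLipschitz_sum fun l _ => locallyLipschitz_mul (locallyLipschitz_mul (ih l)
      ((locallyLipschitz_of_abs_sub_le hσ.dlip).comp (locallyLipschitz_hid hσ x _ l)))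
      (locallyLipschitz_eval _)

theorem locallyLipschitz_delta (hσ : ActBounds σ C D Λ) (x : EuclideanSpace ℝ (Fin d₀)) (k : ℕ)
    (i : Fin d) : LocallyLipschitz fun θ : Params d₀ m d => delta σ θ x k i :=
  locallyLipschitz_mul
    ((locallyLipschitz_of_abs_sub_le hσ.dlip).comp (locallyLipschitz_hid hσ x k i))
    (locallyLipschitz_bmat hσ x k _ i i)

theorem locallyLipschitz_grad (hσ : ActBounds σ C D Λ) (x : EuclideanSpace ℝ (Fin d₀))
    (p : ParamIdx d₀ m d) : LocallyLipschitz fun θ : Params d₀ m d => grad σ θ x p := by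
  have hact := locallyLipschitz_of_abs_sub_le hσ.lip
  rcases p with q | q | i
  · exact locallyLipschitz_mul (LocallyLipschitz.const _) (locallyLipschitz_delta hσ x 0 q.2)
  · exact locallyLipschitz_mul (hact.comp (locallyLipschitz_hid hσ x _ _))
      (locallyLipschitz_delta hσ x _ _)
  · exact hact.comp (locallyLipschitz_hid hσ x m i)

theorem locallyLipschitz_net (hσ : ActBounds σ C D Λ) (x : EuclideanSpace ℝ (Fin d₀)) :
    LocallyLipschitz fun θ : Params d₀ m d => net σ θ x := by
  simp only [net, preact_eq_hid]
  exact locallyLipschitz_sum fun i _ => locallyLipschitz_mul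
    ((locallyLipschitz_of_abs_sub_le hσ.lip).comp (locallyLipschitz_hid hσ x m i))
    (locallyLipschitz_eval _)

theorem locallyLipschitz_velocity {ι : Type*} [Fintype ι] (α : ι → ℝ)
    {f : Fin n → (ι → ℝ) → ℝ} {G : Fin n → (ι → ℝ) → ι → ℝ} (y : Fin n → ℝ)
    (hf : ∀ b, LocallyLipschitz (f b)) (hG : ∀ b p, LocallyLipschitz fun θ => G b θ p) :
    LocallyLipschitz (velocity α f G y) := by
  refine locallyLipschitz_pi fun p => ?_
  simp only [velocity, sub_eq_add_neg]
  exact locallyLipschitz_mul (LocallyLipschitz.const _) (locallyLipschitz_sum fun b _ =>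
    locallyLipschitz_mul (locallyLipschitz_add (hf b) (LocallyLipschitz.const _)) (hG b p))

theorem locallyLipschitz_linModel {ι 𝒳 : Type*} [Fintype ι] (f : 𝒳 → (ι → ℝ) → ℝ)
    (G : 𝒳 → (ι → ℝ) → ι → ℝ) (θ₀ : ι → ℝ) (z : 𝒳) : LocallyLipschitz (linModel f G θ₀ z) := by
  have : ContDiff ℝ 1 (linModel f G θ₀ z) :=
    contDiff_const.add ((dotCLM (G z θ₀)).contDiff.comp (contDiff_id.sub contDiff_const))
  exact this.locallyLipschitz

end LocallyLipschitzNet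

/-! ### Training equations of the network and of its linearization -/

section LinearizedNet

variable {d₀ m d n : ℕ} {σ : ℝ → ℝ}

theorem linNet_eq_linModel (hσ : Differentiable ℝ σ) (θ₀ θ : Params d₀ m d)
    (x : EuclideanSpace ℝ (Fin d₀)) : linNet σ θ₀ θ x =
      linModel (fun z (θ : Params d₀ m d) => net σ θ z) (fun z θ => grad σ θ z) θ₀ x θ := by
  rw [linNet, (hasFDerivAt_net hσ θ₀ x).fderiv]
  rfl

theorem isNetTraining_iff (hσ : Differentiable ℝ σ) (X : Fin n → EuclideanSpace ℝ (Fin d₀))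
    (Y : Fin n → ℝ) (η : ℝ) (a θ₀ : Params d₀ m d) (θ : ℝ → Params d₀ m d) :
    IsNetTraining σ X Y η a θ₀ θ ↔ θ 0 = θ₀ ∧ ∀ t, 0 ≤ t → HasDerivWithinAt θ
      (velocity (fun p => η * a p) (fun b (θ : Params d₀ m d) => net σ θ (X b))
        (fun b θ => grad σ θ (X b)) Y (θ t)) (Set.Ici 0) t :=
  isWeightedGradFlow_iff (fun b θ => hasFDerivAt_net hσ θ (X b)) η a θ₀ θ

theorem isLinTraining_iff (hσ : Differentiable ℝ σ) (X : Fin n → EuclideanSpace ℝ (Fin d₀))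
    (Y : Fin n → ℝ) (η : ℝ) (a θ₀ : Params d₀ m d) (θ : ℝ → Params d₀ m d) :
    IsLinTraining σ X Y η a θ₀ θ ↔ θ 0 = θ₀ ∧ ∀ t, 0 ≤ t → HasDerivWithinAt θ
      (velocity (fun p => η * a p)
        (fun b => linModel (fun z (θ : Params d₀ m d) => net σ θ z) (fun z θ => grad σ θ z) θ₀ (X b))
        (fun b _ => grad σ θ₀ (X b)) Y (θ t)) (Set.Ici 0) t := by
  have e : (fun θ' : Params d₀ m d => loss X Y (linNet σ θ₀ θ')) = fun θ' => (1 / 2 : ℝ) * ∑ b,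
      (linModel (fun z (θ : Params d₀ m d) => net σ θ z) (fun z θ => grad σ θ z) θ₀ (X b) θ' -
        Y b) ^ 2 := by
    funext θ'
    simp only [loss, linNet_eq_linModel hσ]
  rw [IsLinTraining, e]
  exact isWeightedGradFlow_iff (fun b θ => hasFDerivAt_linModel _ _ θ₀ (X b) θ) η a θ₀ θ

end LinearizedNet

/-! ### Laziness from a good initialization -/

section DeterministicLazy
open Topology

variable {d₀ m n : ℕ} {σ : ℝ → ℝ} {C D Λ : ℝ}

set_option maxHeartbeats 400000 in
/-- Training is lazy from every initialization with bounded weights, small back-propagated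
derivatives and a kernel close to a positive definite matrix. -/
theorem exists_lazyUpTo (hσ : ActBounds σ C D Λ) (hσd : Differentiable ℝ σ)
    {B Xm R amax lam η₀ ε : ℝ} (hB : 0 ≤ B) (hXm : 0 ≤ Xm) (hR : 0 ≤ R) (hamax : 0 ≤ amax)
    (hlam : 0 < lam) (hη₀ : 0 < η₀) (hε : 0 < ε) {X : Fin n → EuclideanSpace ℝ (Fin d₀)}
    (hX : ∀ i, ‖X i‖ ≤ Xm) {x : EuclideanSpace ℝ (Fin d₀)} (hx : ‖x‖ ≤ Xm) (Y : Fin n → ℝ)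
    {A : Fin n → Fin n → ℝ}
    (hA : ∀ u : Fin n → ℝ, lam * nrm u ^ 2 ≤ ∑ a, u a * ∑ b, A a b * u b) :
    ∃ ζ > 0, ∃ τ > 0, ∀ᶠ d : ℕ in atTop, ∀ θ₀ a : Params d₀ m d, GoodWeights B θ₀ →
      (∀ p, |a p| ≤ amax) → (∀ i, ∀ k ≤ m, ∀ j, |back σ θ₀ (X i) k j| ≤ ζ) →
      (∀ k ≤ m, ∀ j, |back σ θ₀ x k j| ≤ ζ) → nrm (fun i => net σ θ₀ (X i) - Y i) ≤ R →
      (∀ i j, |(1 / d : ℝ) * ∑ p, a p * grad σ θ₀ (X i) p * grad σ θ₀ (X j) p - A i j| ≤ τ) →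
      LazyUpTo σ X Y (η₀ / d) x ε θ₀ a := by
  obtain ⟨g, hg, hgrad⟩ := exists_nrm_grad_le hσ d₀ m (add_nonneg hB zero_le_one) hXm
  -- Half of the limiting decay rate `η₀ * lam`; the other half absorbs the deviations of the
  -- kernel.
  set c := η₀ * lam / 2 with hc
  have hc0 : 0 < c := by positivity
  -- The confinement argument bounds the displacement by `(r - 1) / √d`; the added 1 makes the
  -- inequality strict.
  set r := η₀ * amax * (n * g) * R / c + 1 with hr
  have hr0 : 0 ≤ r := by positivity
  obtain ⟨g', hg', hgrad'⟩ := exists_nrm_grad_sub_le hσ d₀ m (add_nonneg hB zero_le_one) hXm hr0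
  set K := η₀ * amax * g * g with hK
  have hK0 : 0 ≤ K := by positivity
  set c₁ := 2 * (η₀ * amax * g * g') with hc₁
  have hc₁0 : 0 ≤ c₁ := by positivity
  -- `P * κ` dominates the loss of positivity `n * n * κ` and the errors on the training set and at
  -- `x`, so one choice of `κ` serves all three.
  set P := (n : ℝ) * n + n * n * R / c + (n * R + n * K * (n * n * R / c)) / (c / 2) with hP
  have hP0 : 0 ≤ P := by positivity
  set κ := min (c / 2) ε / (P + 1) with hκ
  have hκ0 : 0 < κ := by positivity
  have hPκ : P * κ ≤ min (c / 2) ε := by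
    rw [hκ, mul_div_assoc', div_le_iff₀ (by positivity)]
    nlinarith [lt_min (half_pos hc0) hε]
  -- For large `d` also `1 / √d ≤ ζ`, so the kernel moves by at most `c₁ * (ζ + ζ) ≤ κ`.
  set ζ := κ / (2 * (c₁ + 1)) with hζ
  have hζ0 : 0 < ζ := by positivity
  have hc₁ζ : c₁ * (ζ + ζ) ≤ κ := by
    have : ζ * (2 * (c₁ + 1)) = κ := by rw [hζ]; field_simp
    nlinarith
  -- This `τ` makes the initial kernel error cost at most `c / 2` of positivity, after the factors
  -- `η₀` and `n * n`.
  refine ⟨ζ, hζ0, c / 2 / (η₀ * (n * n + 1)), by positivity, ?_⟩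
  have hsqrt : Tendsto (fun d : ℕ => √(d : ℝ)) atTop atTop :=
    Real.tendsto_sqrt_atTop.comp tendsto_natCast_atTop_atTop
  filter_upwards [hsqrt.eventually_ge_atTop r, hsqrt.eventually_ge_atTop (1 / ζ),
    eventually_gt_atTop 0] with d hdr hdζ hd θ₀ a hgood ha hback hbackx hres hker
  have hd' : (0 : ℝ) < d := by exact_mod_cast hd
  have hsd : 0 < √(d : ℝ) := Real.sqrt_pos.2 hd'
  have hss : √(d : ℝ) * √(d : ℝ) = d := Real.mul_self_sqrt hd'.le
  have hζd : 1 / √(d : ℝ) ≤ ζ := by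
    rw [div_le_iff₀ hsd]
    rwa [div_le_iff₀ hζ0, mul_comm] at hdζ
  have hgood1 : GoodWeights (B + 1) θ₀ := hgood.perturb hd (by simp [nrm])
  have hball : ∀ θ : Params d₀ m d, nrm (fun p => θ p - θ₀ p) ≤ r / √d → GoodWeights (B + 1) θ :=
    fun θ h => hgood.perturb hd (h.trans ((div_le_one hsd).2 hdr))
  set α : Params d₀ m d := fun p => η₀ / d * a p with hα
  have hαA : ∀ p, |α p| ≤ η₀ * amax / d := fun p => by
    rw [hα, abs_mul, abs_of_nonneg (by positivity : 0 ≤ η₀ / d), mul_div_right_comm]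
    exact mul_le_mul_of_nonneg_left (ha p) (by positivity)
  have hA0 : 0 ≤ η₀ * amax / (d : ℝ) := by positivity
  -- variation of the kernel near the initialization
  have hclose : ∀ z z' : EuclideanSpace ℝ (Fin d₀), ‖z‖ ≤ Xm → ‖z'‖ ≤ Xm →
      (∀ k ≤ m, ∀ j, |back σ θ₀ z k j| ≤ ζ) → (∀ k ≤ m, ∀ j, |back σ θ₀ z' k j| ≤ ζ) →
      ∀ θ : Params d₀ m d, nrm (fun p => θ p - θ₀ p) ≤ r / √d →
        |kern α (grad σ θ z) (grad σ θ z') - kern α (grad σ θ₀ z) (grad σ θ₀ z')| ≤ κ := by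
    intro z z' hz hz' hb hb' θ hθ
    have h1 := hgrad' d θ₀ θ z ζ hd hgood1 (hball θ hθ) hθ hz hζ0.le hb
    have h2 := hgrad' d θ₀ θ z' ζ hd hgood1 (hball θ hθ) hθ hz' hζ0.le hb'
    have h3 := hgrad d θ z' hd (hball θ hθ) hz'
    have h4 := hgrad d θ₀ z hd hgood1 hz
    have h5 : ∀ {u : ℝ}, u ≤ g' * (1 / √d + ζ) * √d → u ≤ g' * (ζ + ζ) * √d := fun h =>
      h.trans (by gcongr)
    calc _ ≤ _ := abs_kern_sub_le hαA hA0 _ _ _ _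
      _ ≤ η₀ * amax / d * (g' * (ζ + ζ) * √d) * (g * √d) +
          η₀ * amax / d * (g * √d) * (g' * (ζ + ζ) * √d) := by
        refine add_le_add ?_ ?_
        · exact mul_le_mul (mul_le_mul_of_nonneg_left (h5 h1) hA0) h3 (nrm_nonneg _)
            (by positivity)
        · exact mul_le_mul (mul_le_mul_of_nonneg_left h4 hA0) (h5 h2) (nrm_nonneg _)
            (by positivity)
      -- The learning rate of order `1/d` cancels two gradient norms of order √d.
      _ = η₀ * amax / d * (√d * √d) * (2 * (g * g' * (ζ + ζ))) := by ring
      _ = c₁ * (ζ + ζ) := by rw [hss, div_mul_cancel₀ _ hd'.ne', hc₁]; ring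
      _ ≤ κ := hc₁ζ
  have hkern₀ : ∀ i j, |kern α (grad σ θ₀ (X i)) (grad σ θ₀ (X j)) - η₀ * A i j| ≤
      η₀ * (c / 2 / (η₀ * (n * n + 1))) := fun i j => by
    have e : kern α (grad σ θ₀ (X i)) (grad σ θ₀ (X j)) =
        η₀ * ((1 / d : ℝ) * ∑ p, a p * grad σ θ₀ (X i) p * grad σ θ₀ (X j) p) := by
      rw [kern, Finset.mul_sum, Finset.mul_sum]
      exact Finset.sum_congr rfl fun p _ => by rw [hα]; ring
    rw [e, ← mul_sub, abs_mul, abs_of_pos hη₀]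
    exact mul_le_mul_of_nonneg_left (hker i j) hη₀.le
  have hpos : ∀ θ : Params d₀ m d, nrm (fun p => θ p - θ₀ p) ≤ r / √d → ∀ u : Fin n → ℝ,
      c * nrm u ^ 2 ≤ ∑ i, u i * ∑ j, kern α (grad σ θ (X i)) (grad σ θ (X j)) * u j := by
    intro θ hθ
    -- The limit is coercive with constant `2 * c`; the motion and the initial deviation lose at
    -- most `c / 2` each.
    refine pos_of_close (A := fun i j => η₀ * A i j) (c₀ := 2 * c)
      (κ := κ + η₀ * (c / 2 / (η₀ * (n * n + 1)))) (fun u => ?_) (fun i j => ?_) ?_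
    · have := mul_le_mul_of_nonneg_left (hA u) hη₀.le
      calc _ = η₀ * (lam * nrm u ^ 2) := by rw [hc]; ring
        _ ≤ _ := this
        _ = _ := by
          simp only [Finset.mul_sum]
          exact Finset.sum_congr rfl fun i _ => Finset.sum_congr rfl fun j _ => by ring
    · exact (abs_sub_le _ _ _).trans (add_le_add
        (hclose _ _ (hX i) (hX j) (hback i) (hback j) θ hθ) (hkern₀ i j))
    · have h1 : (n : ℝ) * n * κ ≤ c / 2 := by
        refine le_trans (mul_le_mul_of_nonneg_right ?_ hκ0.le) (hPκ.trans (min_le_left _ _))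
        have : 0 ≤ n * n * R / c + (n * R + n * K * (n * n * R / c)) / (c / 2) := by positivity
        linarith
      have h2 : η₀ * (c / 2 / (η₀ * (n * n + 1))) * (n * n + 1) = c / 2 := by
        field_simp
      have h3 : 0 ≤ η₀ * (c / 2 / (η₀ * (n * n + 1))) := by positivity
      generalize η₀ * (c / 2 / (η₀ * (n * n + 1))) = T at h2 h3 ⊢
      linarith
  have hvel : ∀ (f : Fin n → Params d₀ m d → ℝ) (G : Fin n → Params d₀ m d → Params d₀ m d)
      (θ θ' : Params d₀ m d), (∀ b, G b θ' = grad σ θ (X b)) →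
      nrm (fun p => θ p - θ₀ p) ≤ r / √d → nrm (velocity α f G Y θ') ≤
        η₀ * amax / d * (n * (g * √d)) * nrm fun i => f i θ' - Y i := fun f G θ θ' hG hθ =>
    nrm_velocity_le hαA hA0 fun b => by
      rw [hG]
      exact hgrad d θ (X b) hd (hball θ hθ) (hX b)
  have hM : 0 ≤ η₀ * amax / d * (n * (g * √d)) := by positivity
  have hrR : η₀ * amax / d * (n * (g * √d)) * R / c < r / √d := by
    have e : η₀ * amax / d * (n * (g * √d)) * R / c = η₀ * amax * (n * g) * R / c / √d := by
      rw [show η₀ * amax / d * (n * (g * √d)) * R / c =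
        η₀ * amax * (n * g) * R / c * (√d / d) by ring, Real.sqrt_div_self', mul_one_div]
    rw [e, div_lt_div_iff_of_pos_right hsd, hr]
    linarith
  have hself : nrm (fun p => θ₀ p - θ₀ p) ≤ r / √d := by
    simp only [sub_self]
    have : nrm (fun _ : ParamIdx d₀ m d => (0 : ℝ)) = 0 := by simp [nrm]
    rw [this]
    positivity
  have hrR' : η₀ * amax / d * (n * (g * √d)) * nrm (fun i => net σ θ₀ (X i) - Y i) / c < r / √d :=
    lt_of_le_of_lt (by gcongr) hrR
  refine ⟨?_, ?_, ?_⟩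
  · obtain ⟨θ, h0, hθ⟩ := exists_flow (f := fun b (θ : Params d₀ m d) => net σ θ (X b))
      (G := fun b θ => grad σ θ (X b)) hc0 hM (fun b θ => hasFDerivAt_net hσd θ (X b)) hpos
      (fun θ hθ => hvel _ _ θ θ (fun _ => rfl) hθ) hrR' (locallyLipschitz_velocity α Y
        (fun b => locallyLipschitz_net hσ (X b)) fun b p => locallyLipschitz_grad hσ (X b) p)
    exact ⟨θ, (isNetTraining_iff hσd X Y _ a θ₀ θ).2 ⟨h0, hθ⟩⟩
  · obtain ⟨θ, h0, hθ⟩ := exists_flow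
      (f := fun b => linModel (fun z (θ : Params d₀ m d) => net σ θ z)
        (fun z θ => grad σ θ z) θ₀ (X b))
      (G := fun b _ => grad σ θ₀ (X b)) (α := α) (y := Y) (θ₀ := θ₀) (r := r / √d) hc0 hM
      (fun b θ => hasFDerivAt_linModel _ _ θ₀ (X b) θ) (fun _ _ => hpos θ₀ hself)
      (fun θ _ => hvel _ _ θ₀ θ (fun _ => rfl) hself) (by simpa [linModel] using hrR')
      (locallyLipschitz_velocity α Y (fun b => locallyLipschitz_linModel _ _ θ₀ (X b))
        fun b p => LocallyLipschitz.const _)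
    exact ⟨θ, (isLinTraining_iff hσd X Y _ a θ₀ θ).2 ⟨h0, hθ⟩⟩
  · intro θ θlin hθ hθlin t ht
    obtain ⟨h0, hθ⟩ := (isNetTraining_iff hσd X Y _ a θ₀ θ).1 hθ
    obtain ⟨h0', hθ'⟩ := (isLinTraining_iff hσd X Y _ a θ₀ θlin).1 hθlin
    have hx0 : ∀ b, |kern α (grad σ θ₀ x) (grad σ θ₀ (X b))| ≤ K := fun b => by
      refine (abs_kern_le hαA hA0 _ _).trans ?_
      calc _ ≤ η₀ * amax / d * (g * √d) * (g * √d) :=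
            mul_le_mul (mul_le_mul_of_nonneg_left (hgrad d θ₀ x hd hgood1 hx) hA0)
              (hgrad d θ₀ (X b) hd hgood1 (hX b)) (nrm_nonneg _) (by positivity)
        _ = η₀ * amax / d * (√d * √d) * (g * g) := by ring
        _ = K := by rw [hss, div_mul_cancel₀ _ hd'.ne', hK]; ring
    obtain ⟨h1, h2⟩ := lazy_of_kern_close (f := fun z (θ : Params d₀ m d) => net σ θ z)
      (G := fun z θ => grad σ θ z) (X := X) (x := x) (κ := κ) hc0 hM hκ0.le hK0
      (fun z θ => hasFDerivAt_net hσd θ z) hpos (fun θ hθ => hvel _ _ θ θ (fun _ => rfl) hθ) hres hrR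
      (fun θ hθ i j => hclose _ _ (hX i) (hX j) (hback i) (hback j) θ hθ)
      (fun θ hθ j => hclose _ _ hx (hX j) hbackx (hback j) θ hθ) hx0 h0 h0' hθ hθ' ht
    simp only [← linNet_eq_linModel hσd] at h1 h2
    have hPε := hPκ.trans (min_le_right _ _)
    constructor
    · have e : onTrain X (net σ (θ t)) - onTrain X (linNet σ θ₀ (θlin t)) =
          WithLp.toLp 2 fun i => net σ (θ t) (X i) - linNet σ θ₀ (θlin t) (X i) := rfl
      rw [e, norm_toLp]
      refine h1.trans (le_trans ?_ hPε)
      have : (n : ℝ) * (n * κ) * R / c = n * n * R / c * κ := by ring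
      rw [this]
      refine mul_le_mul_of_nonneg_right ?_ hκ0.le
      have : 0 ≤ (n : ℝ) * n + (n * R + n * K * (n * n * R / c)) / (c / 2) := by positivity
      linarith
    · rw [Real.norm_eq_abs]
      refine h2.trans (le_trans ?_ hPε)
      have : (n * κ * R + n * K * (n * (n * κ) * R / c)) / (c / 2) =
          (n * R + n * K * (n * n * R / c)) / (c / 2) * κ := by ring
      rw [this]
      refine mul_le_mul_of_nonneg_right ?_ hκ0.le
      have : 0 ≤ (n : ℝ) * n + n * n * R / c := by positivity
      linarith

end DeterministicLazy

/-! ### Coercivity of positive definite forms -/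

section Coercivity

variable {n : ℕ}

/-- The quadratic form of a positive definite matrix is coercive. -/
theorem exists_coercive_of_posDef {A : Matrix (Fin n) (Fin n) ℝ} (hA : A.PosDef) :
    ∃ lam > 0, ∀ u : Fin n → ℝ, lam * nrm u ^ 2 ≤ ∑ a, u a * ∑ b, A a b * u b := by
  have hpos : ∀ u : Fin n → ℝ, u ≠ 0 → 0 < ∑ a, u a * ∑ b, A a b * u b := fun u hu => by
    simpa [dotProduct, Matrix.mulVec] using hA.dotProduct_mulVec_pos hu
  set q : EuclideanSpace ℝ (Fin n) → ℝ := fun u => ∑ a, u a * ∑ b, A a b * u b with hq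
  have hqc : Continuous q := by fun_prop
  have hzero : ∀ u : Fin n → ℝ, nrm u = 0 → ∑ a, u a * ∑ b, A a b * u b = 0 := fun u hu =>
    Finset.sum_eq_zero fun a _ => by rw [nrm_eq_zero hu a, zero_mul]
  rcases (Metric.sphere (0 : EuclideanSpace ℝ (Fin n)) 1).eq_empty_or_nonempty with he | hne
  -- With an empty unit sphere every vector has norm zero, and any constant works.
  · refine ⟨1, one_pos, fun u => ?_⟩
    have hu : nrm u = 0 := by
      by_contra hu
      have : (nrm u)⁻¹ • (WithLp.toLp 2 u : EuclideanSpace ℝ (Fin n)) ∈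
          Metric.sphere (0 : EuclideanSpace ℝ (Fin n)) 1 := by
        rw [mem_sphere_zero_iff_norm, norm_smul, norm_toLp, norm_inv, Real.norm_eq_abs,
          abs_of_nonneg (nrm_nonneg u), inv_mul_cancel₀ hu]
      rw [he] at this
      exact this
    rw [hzero u hu, hu]
    simp
  · obtain ⟨w, hw, hmin⟩ := (isCompact_sphere _ _).exists_isMinOn hne hqc.continuousOn
    refine ⟨q w, hpos (fun a => w a) fun h => ?_, fun u => ?_⟩
    · have : w = 0 := by ext a; exact congrFun h a
      rw [mem_sphere_zero_iff_norm, this, norm_zero] at hw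
      exact zero_ne_one hw
    · rcases (nrm_nonneg u).eq_or_lt with hu | hu
      · rw [hzero u hu.symm, ← hu]
        simp
      · have hmem : (nrm u)⁻¹ • (WithLp.toLp 2 u : EuclideanSpace ℝ (Fin n)) ∈
            Metric.sphere (0 : EuclideanSpace ℝ (Fin n)) 1 := by
          rw [mem_sphere_zero_iff_norm, norm_smul, norm_toLp, norm_inv, Real.norm_eq_abs,
            abs_of_pos hu, inv_mul_cancel₀ hu.ne']
        have h1 := isMinOn_iff.1 hmin _ hmem
        have h2 : q ((nrm u)⁻¹ • (WithLp.toLp 2 u : EuclideanSpace ℝ (Fin n))) =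
            (∑ a, u a * ∑ b, A a b * u b) / nrm u ^ 2 := by
          simp only [hq, PiLp.smul_apply, smul_eq_mul, Finset.mul_sum, Finset.sum_div]
          refine Finset.sum_congr rfl fun a _ => Finset.sum_congr rfl fun b _ => ?_
          field_simp
        rwa [h2, le_div_iff₀ (by positivity)] at h1

end Coercivity

/-! ### Events of vanishing probability -/

section Negligible
open Topology

variable {Ω : ℕ → Type*} [∀ d, MeasurableSpace (Ω d)] {P : ∀ d, Measure (Ω d)}

/-- The probability of the events tends to zero. -/
def Negligible (P : ∀ d, Measure (Ω d)) (E : ∀ d, Ω d → Prop) : Prop :=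
  ∀ δ : ℝ, 0 < δ → ∀ᶠ d in atTop, P d {ω | E d ω} ≤ ENNReal.ofReal δ

theorem Negligible.or {E F : ∀ d, Ω d → Prop} (hE : Negligible P E) (hF : Negligible P F) :
    Negligible P fun d ω => E d ω ∨ F d ω := fun δ hδ => by
  filter_upwards [hE (δ / 2) (by positivity), hF (δ / 2) (by positivity)] with d h1 h2
  have : {ω | E d ω ∨ F d ω} = {ω | E d ω} ∪ {ω | F d ω} := rfl
  rw [this]
  refine (measure_union_le _ _).trans ((add_le_add h1 h2).trans ?_)
  rw [← ENNReal.ofReal_add (by positivity) (by positivity), add_halves]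

theorem Negligible.mono {E F : ∀ d, Ω d → Prop} (hE : Negligible P E)
    (h : ∀ᶠ d in atTop, ∀ ω, F d ω → E d ω) : Negligible P F := fun δ hδ => by
  filter_upwards [hE δ hδ, h] with d h1 h2
  exact (measure_mono fun ω hω => h2 ω hω).trans h1

theorem Negligible.exists {κ : Type*} [Finite κ] {E : κ → ∀ d, Ω d → Prop}
    (hE : ∀ a, Negligible P (E a)) : Negligible P fun d ω => ∃ a, E a d ω := by
  classical
  cases nonempty_fintype κ
  have key : ∀ s : Finset κ, Negligible P fun d ω => ∃ a ∈ s, E a d ω := fun s => by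
    induction s using Finset.induction_on with
    | empty => intro δ _; simp
    | insert a s ha ih =>
      exact ((hE a).or ih).mono (Eventually.of_forall fun d ω => by simp)
  exact (key Finset.univ).mono (Eventually.of_forall fun d ω => by simp)

theorem negligible_of_ae {E : ∀ d, Ω d → Prop} (h : ∀ d, ∀ᵐ ω ∂(P d), ¬ E d ω) :
    Negligible P E := fun δ _ => Eventually.of_forall fun d => by
  have := ae_iff.1 (h d)
  simp only [not_not] at this
  rw [this]
  exact zero_le

theorem VanishInMean.negligible {F : ∀ d, Ω d → ℝ} (hF : VanishInMean P F)
    (hm : ∀ d, Measurable (F d)) {ε : ℝ} (hε : 0 < ε) : Negligible P fun d ω => ε ≤ F d ω :=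
  fun _ hδ => hF.eventually_measure_le hm hε hδ

theorem BoundedInMean.sum {κ : Type*} {s : Finset κ} {F : κ → ∀ d, Ω d → ℝ}
    (hF : ∀ a ∈ s, BoundedInMean P (F a)) (hm : ∀ a d, Measurable (F a d)) :
    BoundedInMean P (fun d ω => ∑ a ∈ s, F a d ω) := by
  classical
  induction s using Finset.induction_on with
  | empty => exact ⟨0, by simp⟩
  | insert a s ha ih =>
    simp only [Finset.sum_insert ha]
    exact (hF a (by simp)).add (ih fun b hb => hF b (by simp [hb])) (hm a)

end Negligible

/-! ### High-probability bounds at initialization -/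

section InitializationBounds
open Topology

variable {d₀ m n : ℕ} (σw : ℝ) (ρ : ℕ → Measure ℝ) [∀ l, IsProbabilityMeasure (ρ l)]

theorem measurable_param {d : ℕ} (p : ParamIdx d₀ m d) :
    Measurable fun ω : Params d₀ m d × Params d₀ m d => ω.1 p :=
  (measurable_pi_apply p).comp measurable_fst

theorem lintegral_param_sq {d : ℕ} (p : ParamIdx d₀ m d) :
    ∫⁻ ω, ENNReal.ofReal (ω.1 p ^ 2) ∂(jointLaw σw ρ d₀ m d) =
      ENNReal.ofReal (σw ^ 2 / fanIn p) := by
  rw [lintegral_fst_jointLaw σw ρ (g := fun θ => ENNReal.ofReal (θ p ^ 2)) (by fun_prop),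
    initLaw_eq]
  have h1 := integral_eval_mul_two (initVar σw d₀ m d) p p
  have h2 := integrable_eval_mul_two (initVar σw d₀ m d) p p
  simp only [← sq, if_true] at h1 h2
  rw [← ofReal_integral_eq_lintegral_ofReal h2 (Eventually.of_forall fun θ => sq_nonneg _), h1,
    initVar, Real.coe_toNNReal _ (by positivity)]

theorem lintegral_sum_param_sq {d : ℕ} {κ : Type*} [Fintype κ] (e : κ → ParamIdx d₀ m d) {c : ℝ}
    (hc : ∀ q, σw ^ 2 / (fanIn (e q) : ℝ) = c) :
    ∫⁻ ω, ENNReal.ofReal (∑ q, ω.1 (e q) ^ 2) ∂(jointLaw σw ρ d₀ m d) =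
      ENNReal.ofReal (Fintype.card κ * c) := by
  simp only [ENNReal.ofReal_sum_of_nonneg fun q _ => sq_nonneg _]
  rw [lintegral_finsetSum _ fun q _ => by fun_prop]
  simp only [lintegral_param_sq, hc]
  rw [Finset.sum_const, nsmul_eq_mul, ENNReal.ofReal_mul (by positivity)]
  simp

theorem boundedInMean_input (hd₀ : 0 < d₀) : BoundedInMean (fun d => jointLaw σw ρ d₀ m d)
    fun d ω => (1 / d : ℝ) * ∑ q : Fin d₀ × Fin d, ω.1 (Sum.inl q) ^ 2 := by
  refine ⟨σw ^ 2, (eventually_gt_atTop 0).mono fun d hd => ?_⟩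
  rw [lintegral_ofReal_const_mul _ (by positivity), lintegral_sum_param_sq σw ρ
    (fun q : Fin d₀ × Fin d => Sum.inl q) (c := σw ^ 2 / d₀) fun q => rfl,
    ← ENNReal.ofReal_mul (by positivity)]
  refine ENNReal.ofReal_le_ofReal (le_of_eq ?_)
  simp only [Fintype.card_prod, Fintype.card_fin]
  push_cast
  have : (d : ℝ) ≠ 0 := by positivity
  field_simp

theorem boundedInMean_output : BoundedInMean (fun d => jointLaw σw ρ d₀ m d)
    fun d ω => ∑ i : Fin d, ω.1 (Sum.inr (Sum.inr i)) ^ 2 := by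
  refine ⟨σw ^ 2, (eventually_gt_atTop 0).mono fun d hd => ?_⟩
  rw [lintegral_sum_param_sq σw ρ (fun i : Fin d => Sum.inr (Sum.inr i)) (c := σw ^ 2 / d)
    fun q => rfl]
  refine ENNReal.ofReal_le_ofReal (le_of_eq ?_)
  have : (d : ℝ) ≠ 0 := by positivity
  simp only [Fintype.card_fin]
  field_simp

variable {σ : ℝ → ℝ}

theorem continuous_net (hσ : Continuous σ) {d : ℕ} (x : EuclideanSpace ℝ (Fin d₀)) :
    Continuous fun θ : Params d₀ m d => net σ θ x := by
  simp only [net, preact_eq_hid]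
  exact continuous_finsetSum _ fun i _ =>
    (hσ.comp (continuous_hid hσ x m i)).mul (continuous_apply _)

/-- With the hidden layers frozen, the output is a centred Gaussian of variance `empCov` at `m + 1`,
which stays bounded in mean since the covariances converge in mean square. -/
theorem boundedInMean_net_sq (hσ : Continuous σ) {C : ℝ} (hC : ∀ z, |σ z| ≤ C * (1 + |z|))
    (X : Fin n → EuclideanSpace ℝ (Fin d₀)) (a : Fin n) :
    BoundedInMean (fun d => jointLaw σw ρ d₀ m d) fun _ ω => net σ ω.1 (X a) ^ 2 := by
  have hcov := ((covConverges (σw := σw) (ρ := ρ) (m := m) hσ hC X (m + 1) le_rfl).bounded hσ a a).add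
    (boundedInMean_const (P := fun d => jointLaw σw ρ d₀ m d) 1)
    fun d => ((measurable_empCov σw hσ X (m + 1) a a).comp measurable_fst).pow_const 2
  refine hcov.mono ((eventually_gt_atTop 0).mono fun d hd => ?_)
  refine lintegral_le_of_resample σw ρ (m + 2)
    (((continuous_net hσ (X a)).measurable.comp measurable_fst).pow_const 2) fun ω => ?_
  have hnet : ∀ ω', net σ (resamplePair (m + 2) ω ω').1 (X a) =
      ∑ p, layerCoeff σ X ω.1 (m + 1) ⟨0, hd⟩ a p * ω'.1 p := fun ω' => by
    rw [net_eq_hid σ _ _ ⟨0, hd⟩, sum_layerCoeff σ X ω.1 ω'.1 le_rfl]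
    rfl
  simp only [hnet]
  rw [lintegral_fst_jointLaw σw ρ
    (g := fun θ => ENNReal.ofReal ((∑ p, layerCoeff σ X ω.1 (m + 1) ⟨0, hd⟩ a p * θ p) ^ 2))
    (by fun_prop), initLaw_eq, ← ofReal_integral_eq_lintegral_ofReal (integrable_linForm_pow _ _ 2)
    (Eventually.of_forall fun θ => sq_nonneg _), integral_linForm_sq]
  have hlc : linCov (initVar σw d₀ m d) (layerCoeff σ X ω.1 (m + 1) ⟨0, hd⟩ a)
      (layerCoeff σ X ω.1 (m + 1) ⟨0, hd⟩ a) = empCov σ σw X ω.1 (m + 1) a a :=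
    linCov_pushCoeff_self _ (pidx_injective m _) _ _ fun j => coe_initVar_pidx σw m j _
  rw [hlc]
  exact ENNReal.ofReal_le_ofReal (by nlinarith [sq_nonneg (empCov σ σw X ω.1 (m + 1) a a - 1)])

theorem boundedInMean_residual (hσ : Continuous σ) {C : ℝ} (hC : ∀ z, |σ z| ≤ C * (1 + |z|))
    (X : Fin n → EuclideanSpace ℝ (Fin d₀)) (Y : Fin n → ℝ) :
    BoundedInMean (fun d => jointLaw σw ρ d₀ m d)
      fun _ ω => ∑ a, (net σ ω.1 (X a) - Y a) ^ 2 := by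
  have hm : ∀ d a, Measurable fun ω : Params d₀ m d × Params d₀ m d => net σ ω.1 (X a) :=
    fun d a => (continuous_net hσ (X a)).measurable.comp measurable_fst
  refine BoundedInMean.sum (fun a _ => ?_) fun a d => ((hm d a).sub_const _).pow_const 2
  refine (((boundedInMean_net_sq σw ρ hσ hC X a).const_mul (c := 2) (by norm_num)).add
    (boundedInMean_const (2 * Y a ^ 2)) fun d => ((hm d a).pow_const 2).const_mul 2).mono
    (Eventually.of_forall fun d => lintegral_mono fun ω => ENNReal.ofReal_le_ofReal ?_)
  nlinarith [sq_nonneg (net σ ω.1 (X a) + Y a)]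

variable {σw ρ}

/-- The fourth power of the largest derivative is at most the sum of all fourth powers, which
vanishes in mean in each of the finitely many layers. -/
theorem negligible_back (hσ : Continuous σ) (hσ' : Continuous (deriv σ)) {D : ℝ}
    (hD : ∀ z, |deriv σ z| ≤ D) (x : EuclideanSpace ℝ (Fin d₀)) {ζ : ℝ} (hζ : 0 < ζ) :
    Negligible (fun d => jointLaw σw ρ d₀ m d)
      fun _ ω => ¬ ∀ k ≤ m, ∀ j, |back σ ω.1 x k j| ≤ ζ := by
  have h : Negligible (fun d => jointLaw σw ρ d₀ m d)
      fun _ ω => ∃ k : Fin (m + 1), ζ ^ 4 ≤ ∑ j, back σ ω.1 x k j ^ 4 :=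
    Negligible.exists fun k => (vanishInMean_sum_back_pow_four hσ hσ' hD x
      (Nat.lt_succ_iff.1 k.2)).negligible (fun d => Finset.measurable_fun_sum _ fun j _ =>
        (measurable_back hσ hσ' x k j).pow_const 4) (by positivity)
  refine h.mono (Eventually.of_forall fun d ω hω => ?_)
  push Not at hω
  obtain ⟨k, hk, j, hj⟩ := hω
  refine ⟨⟨k, Nat.lt_succ_iff.2 hk⟩, ?_⟩
  calc ζ ^ 4 ≤ |back σ ω.1 x k j| ^ 4 := pow_le_pow_left₀ hζ.le hj.le 4
    _ = back σ ω.1 x k j ^ 4 := Even.pow_abs (by decide) _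
    _ ≤ _ := Finset.single_le_sum (f := fun j => back σ ω.1 x k j ^ 4)
      (fun j _ => by positivity) (Finset.mem_univ j)

theorem measurable_grad {C D Λ : ℝ} (hσ : ActBounds σ C D Λ) {d : ℕ}
    (x : EuclideanSpace ℝ (Fin d₀)) (p : ParamIdx d₀ m d) :
    Measurable fun ω : Params d₀ m d × Params d₀ m d => grad σ ω.1 x p :=
  (locallyLipschitz_grad hσ x p).continuous.measurable.comp measurable_fst

/-- The weighted neural tangent kernel at initialization, in the normalization of its limit. -/
def normKer (σ : ℝ → ℝ) {d : ℕ} (ω : Params d₀ m d × Params d₀ m d)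
    (x x' : EuclideanSpace ℝ (Fin d₀)) : ℝ :=
  (1 / d : ℝ) * ∑ p, ω.2 p * grad σ ω.1 x p * grad σ ω.1 x' p

theorem measurable_normKer {C D Λ : ℝ} (hσ : ActBounds σ C D Λ) {d : ℕ}
    (x x' : EuclideanSpace ℝ (Fin d₀)) :
    Measurable fun ω : Params d₀ m d × Params d₀ m d => normKer σ ω x x' := by
  refine Measurable.const_mul (Finset.measurable_fun_sum _ fun p _ => ?_) _
  exact (((measurable_pi_apply p).comp measurable_snd).mul (measurable_grad hσ x p)).mul
    (measurable_grad hσ x' p)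

theorem vanishInMean_normKer_sub {C D Λ amax : ℝ} (hσ : ActBounds σ C D Λ)
    (hσd : Differentiable ℝ σ) (hamax : ∀ l, ∀ᵐ a ∂(ρ l), |a| ≤ amax)
    (X : Fin n → EuclideanSpace ℝ (Fin d₀)) (i j : Fin n) :
    VanishInMean (fun d => jointLaw σw ρ d₀ m d) fun _ ω => (normKer σ ω (X i) (X j) -
      analyticWNTK σ σw (fun l => ∫ a, a ∂(ρ l)) X (m + 1) i j) ^ 2 := by
  obtain ⟨c, hc, hle⟩ := diagConverges_output (σw := σw) (m := m) hσd.continuous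
    (locallyLipschitz_of_abs_sub_le hσ.dlip).continuous hσ.growth hσ.bdd hamax X i j
  unfold VanishInMean
  refine tendsto_of_tendsto_of_tendsto_of_le_of_le' tendsto_const_nhds hc
    (Eventually.of_forall fun _ => zero_le) ?_
  filter_upwards [hle, eventually_gt_atTop 0] with d hle hd
  refine le_trans (le_of_eq ?_) (hle ⟨0, hd⟩)
  refine lintegral_congr fun ω => ?_
  rw [normKer, sum_grad_mul_grad σ _ _ _ ⟨0, hd⟩]

theorem negligible_kernel {C D Λ amax : ℝ} (hσ : ActBounds σ C D Λ) (hσd : Differentiable ℝ σ)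
    (hamax : ∀ l, ∀ᵐ a ∂(ρ l), |a| ≤ amax) (X : Fin n → EuclideanSpace ℝ (Fin d₀)) {τ : ℝ}
    (hτ : 0 < τ) : Negligible (fun d => jointLaw σw ρ d₀ m d) fun _ ω => ¬ ∀ i j,
      |normKer σ ω (X i) (X j) - analyticWNTK σ σw (fun l => ∫ a, a ∂(ρ l)) X (m + 1) i j| ≤ τ := by
  have h := Negligible.exists fun q : Fin n × Fin n =>
    (vanishInMean_normKer_sub (σw := σw) (m := m) hσ hσd hamax X q.1 q.2).negligible
      (fun d => ((measurable_normKer hσ (X q.1) (X q.2)).sub_const _).pow_const 2)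
      (by positivity : 0 < τ ^ 2)
  refine h.mono (Eventually.of_forall fun d ω hω => ?_)
  push Not at hω
  obtain ⟨i, j, hij⟩ := hω
  refine ⟨(i, j), ?_⟩
  rw [← sq_abs (normKer σ ω _ _ - _)]
  exact pow_le_pow_left₀ hτ.le hij.le 2

variable (σw ρ)

theorem exists_nrm_input_measure_le (hd₀ : 0 < d₀) {δ : ℝ} (hδ : 0 < δ) :
    ∃ B₀ : ℝ, ∀ B ≥ B₀, ∀ᶠ d : ℕ in atTop, jointLaw σw ρ d₀ m d
      {ω | ¬ nrm (fun q : Fin d₀ × Fin d => ω.1 (Sum.inl q)) ≤ B * √d} ≤ ENNReal.ofReal δ := by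
  have hm : ∀ d : ℕ, Measurable fun ω : Params d₀ m d × Params d₀ m d =>
      (1 / d : ℝ) * ∑ q : Fin d₀ × Fin d, ω.1 (Sum.inl q) ^ 2 := fun d =>
    (Finset.measurable_fun_sum _ fun q _ => (measurable_param (Sum.inl q)).pow_const 2).const_mul _
  obtain ⟨B₀, h⟩ := (boundedInMean_input (m := m) σw ρ hd₀).exists_measure_le hm hδ
  -- Markov's inequality concerns the squared norm; `1 ≤ B` gives `B₀ ≤ B ≤ B ^ 2`.
  refine ⟨max 1 B₀, fun B hB => ?_⟩
  have hB1 : 1 ≤ B := (le_max_left _ _).trans hB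
  have hB2 : B₀ ≤ B ^ 2 := ((le_max_right _ _).trans hB).trans (by nlinarith)
  filter_upwards [h (B ^ 2) hB2, eventually_gt_atTop 0] with d e hd
  have hd' : (0 : ℝ) < d := by exact_mod_cast hd
  refine (measure_mono fun ω hω => ?_).trans e
  simp only [Set.mem_ofPred_eq] at hω ⊢
  by_contra hcon
  refine hω (nrm_le_of_sq_le (by positivity) ?_)
  rw [not_le, one_div, inv_mul_lt_iff₀ hd'] at hcon
  rw [mul_pow, Real.sq_sqrt hd'.le, mul_comm]
  exact hcon.le

theorem exists_nrm_output_measure_le {δ : ℝ} (hδ : 0 < δ) :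
    ∃ B₀ : ℝ, ∀ B ≥ B₀, ∀ᶠ d : ℕ in atTop, jointLaw σw ρ d₀ m d
      {ω | ¬ nrm (fun i : Fin d => ω.1 (Sum.inr (Sum.inr i))) ≤ B} ≤ ENNReal.ofReal δ := by
  have hm : ∀ d : ℕ, Measurable fun ω : Params d₀ m d × Params d₀ m d =>
      ∑ i : Fin d, ω.1 (Sum.inr (Sum.inr i)) ^ 2 := fun d =>
    Finset.measurable_fun_sum _ fun i _ => (measurable_param (Sum.inr (Sum.inr i))).pow_const 2
  obtain ⟨B₀, h⟩ := (boundedInMean_output (d₀ := d₀) (m := m) σw ρ).exists_measure_le hm hδ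
  refine ⟨max 1 B₀, fun B hB => ?_⟩
  have hB1 : 1 ≤ B := (le_max_left _ _).trans hB
  have hB2 : B₀ ≤ B ^ 2 := ((le_max_right _ _).trans hB).trans (by nlinarith)
  filter_upwards [h (B ^ 2) hB2] with d e
  refine (measure_mono fun ω hω => ?_).trans e
  simp only [Set.mem_ofPred_eq] at hω ⊢
  by_contra hcon
  exact hω (nrm_le_of_sq_le (by linarith) (not_le.1 hcon).le)

theorem exists_residual_measure_le (hσ : Continuous σ) {C : ℝ} (hC : ∀ z, |σ z| ≤ C * (1 + |z|))
    (X : Fin n → EuclideanSpace ℝ (Fin d₀)) (Y : Fin n → ℝ) {δ : ℝ} (hδ : 0 < δ) :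
    ∃ R ≥ 0, ∀ᶠ d : ℕ in atTop, jointLaw σw ρ d₀ m d
      {ω | ¬ nrm (fun i => net σ ω.1 (X i) - Y i) ≤ R} ≤ ENNReal.ofReal δ := by
  have hm : ∀ d : ℕ, Measurable fun ω : Params d₀ m d × Params d₀ m d =>
      ∑ a, (net σ ω.1 (X a) - Y a) ^ 2 := fun d => Finset.measurable_fun_sum _ fun a _ =>
    (((continuous_net hσ (X a)).measurable.comp measurable_fst).sub_const _).pow_const 2
  obtain ⟨B₀, h⟩ := (boundedInMean_residual (m := m) σw ρ hσ hC X Y).exists_measure_le hm hδ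
  have hB1 : 1 ≤ max 1 B₀ := le_max_left _ _
  refine ⟨max 1 B₀, by linarith, ?_⟩
  filter_upwards [h (max 1 B₀ ^ 2) ((le_max_right 1 B₀).trans (by nlinarith))] with d e
  refine (measure_mono fun ω hω => ?_).trans e
  simp only [Set.mem_ofPred_eq] at hω ⊢
  by_contra hcon
  exact hω (nrm_le_of_sq_le (by linarith) (not_le.1 hcon).le)

/-- The thresholds for the first and last layers come from Markov's inequality and depend on `δ`.
The one for the hidden matrices does not, since their bound fails with probability exponentially
small in `d`. -/
theorem exists_goodWeights_measure_le (hd₀ : 0 < d₀) (hσw : 0 < σw) {δ : ℝ} (hδ : 0 < δ) :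
    ∃ B ≥ 0, ∀ᶠ d : ℕ in atTop, jointLaw σw ρ d₀ m d {ω | ¬ GoodWeights B ω.1} ≤
      ENNReal.ofReal (δ + (δ + δ)) := by
  obtain ⟨B₁, h₁⟩ := exists_nrm_input_measure_le (m := m) σw ρ hd₀ hδ
  obtain ⟨B₂, h₂⟩ := exists_nrm_output_measure_le (d₀ := d₀) (m := m) σw ρ hδ
  obtain ⟨B₃, h₃⟩ := exists_opBound_initLaw (d₀ := d₀) (m := m) σw ρ hσw
  obtain ⟨B, hB0, hB₁, hB₂, hB₃⟩ : ∃ B, 0 ≤ B ∧ B₁ ≤ B ∧ B₂ ≤ B ∧ B₃ ≤ B :=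
    ⟨max 0 (max B₁ (max B₂ B₃)), by simp, by simp, by simp, by simp⟩
  have hop : Negligible (fun d => jointLaw σw ρ d₀ m d)
      fun d ω => ∃ k : Fin m, ¬ OpBound (fun j i : Fin d => ω.1 (pidx k j i)) B :=
    Negligible.exists fun k => h₃ B hB₃ k k.2
  refine ⟨B, hB0, ?_⟩
  filter_upwards [h₁ B hB₁, h₂ B hB₂, hop δ hδ] with d e₁ e₂ e₃
  rw [ENNReal.ofReal_add hδ.le (by positivity), ENNReal.ofReal_add hδ.le hδ.le]
  refine le_trans (measure_mono fun ω hω => ?_) ((measure_union_le _ _).trans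
    (add_le_add e₁ ((measure_union_le _ _).trans (add_le_add e₂ e₃))))
  simp only [Set.mem_union, Set.mem_ofPred_eq] at hω ⊢
  by_contra hcon
  push Not at hcon
  exact hω ⟨hcon.1, fun k hk => hcon.2.2 ⟨k, hk⟩, hcon.2.1⟩

end InitializationBounds

/-! ### Union bound over the exceptional events -/

section LazyRegime

variable {d₀ m n : ℕ} {σ : ℝ → ℝ} {C D Λ : ℝ}

/-- Training is lazy with high probability in the infinite-width limit. -/
theorem eventually_jointLaw_not_lazyUpTo_le (hσ : ActBounds σ C D Λ) (hσd : Differentiable ℝ σ)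
    (hd₀ : 0 < d₀) {σw : ℝ} (hσw : 0 < σw) {η₀ : ℝ} (hη₀ : 0 < η₀) {ρ : ℕ → Measure ℝ}
    [∀ l, IsProbabilityMeasure (ρ l)] {amax : ℝ} (hamax₀ : 0 ≤ amax)
    (hamax : ∀ l, ∀ᵐ a ∂(ρ l), |a| ≤ amax) {X : Fin n → EuclideanSpace ℝ (Fin d₀)}
    (Y : Fin n → ℝ) {lam : ℝ} (hlam : 0 < lam)
    (hcoer : ∀ u : Fin n → ℝ, lam * nrm u ^ 2 ≤ ∑ i, u i * ∑ j,
      analyticWNTK σ σw (fun l => ∫ a, a ∂(ρ l)) X (m + 1) i j * u j)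
    (x : EuclideanSpace ℝ (Fin d₀)) {ε : ℝ} (hε : 0 < ε) {δ : ℝ} (hδ : 0 < δ) :
    ∀ᶠ d : ℕ in atTop, jointLaw σw ρ d₀ m d
      {ω | ¬ LazyUpTo σ X Y (η₀ / (d : ℝ)) x ε ω.1 ω.2} ≤ ENNReal.ofReal δ := by
  have hσc := hσd.continuous
  have hσ' : Continuous (deriv σ) := (locallyLipschitz_of_abs_sub_le hσ.dlip).continuous
  -- Three fifths are spent on the weight matrices, one on the residuals and one on the remaining
  -- events together.
  have hδ5 : 0 < δ / 5 := by positivity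
  obtain ⟨B, hB, hgood⟩ := exists_goodWeights_measure_le (m := m) σw ρ hd₀ hσw hδ5
  obtain ⟨R, hR, hres⟩ := exists_residual_measure_le (m := m) σw ρ hσc hσ.growth X Y hδ5
  -- One radius has to serve the training inputs and the test input, as the constants of
  -- `exists_lazyUpTo` depend on it.
  have hXm : ∀ i, ‖X i‖ ≤ ‖x‖ + ∑ i, ‖X i‖ := fun i =>
    (Finset.single_le_sum (f := fun i => ‖X i‖) (fun _ _ => norm_nonneg _)
      (Finset.mem_univ i)).trans (le_add_of_nonneg_left (norm_nonneg x))
  have hxm : ‖x‖ ≤ ‖x‖ + ∑ i, ‖X i‖ :=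
    le_add_of_nonneg_right (Finset.sum_nonneg fun _ _ => norm_nonneg _)
  obtain ⟨ζ, hζ, τ, hτ, hlazy⟩ := exists_lazyUpTo (m := m) hσ hσd hB ((norm_nonneg x).trans hxm)
    hR hamax₀ hlam hη₀ hε hXm hxm Y hcoer
  have hneg := (((negligible_of_ae fun d => (ae_rate_le (d₀ := d₀) (m := m) (d := d) σw ρ
      hamax).mono fun ω hω => not_not.2 hω).or
    (Negligible.exists fun i => negligible_back (m := m) (σw := σw) (ρ := ρ) hσc hσ' hσ.bdd
      (X i) hζ)).or
    (negligible_back (m := m) hσc hσ' hσ.bdd x hζ)).or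
    (negligible_kernel (m := m) (σw := σw) hσ hσd hamax X hτ)
  filter_upwards [hgood, hres, hlazy, hneg (δ / 5) hδ5] with d h₁ h₂ h₃ h₄
  have hsum : ENNReal.ofReal δ = ENNReal.ofReal (δ / 5 + (δ / 5 + δ / 5)) +
      (ENNReal.ofReal (δ / 5) + ENNReal.ofReal (δ / 5)) := by
    rw [← ENNReal.ofReal_add (by positivity) (by positivity),
      ← ENNReal.ofReal_add (by positivity) (by positivity)]
    congr 1
    ring
  rw [hsum]
  refine le_trans (measure_mono fun ω hω => ?_) ((measure_union_le _ _).trans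
    (add_le_add h₁ ((measure_union_le _ _).trans (add_le_add h₂ h₄))))
  simp only [Set.mem_union, Set.mem_ofPred_eq] at hω ⊢
  by_contra hcon
  simp only [not_or, not_not, not_exists] at hcon
  obtain ⟨c₁, c₂, ⟨⟨c₃, c₄⟩, c₅⟩, c₆⟩ := hcon
  exact hω (h₃ ω.1 ω.2 c₁ c₃ c₄ c₅ c₂ c₆)

end LazyRegime

end WNTK

end

theorem theorem3 (d₀ m n : ℕ) (hd₀ : 0 < d₀)
    -- activation function: bounded and Lipschitz derivative
    (σ : ℝ → ℝ) (hσ : Differentiable ℝ σ) (hσ_bdd : ∃ C : ℝ, ∀ z, |deriv σ z| ≤ C)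
    (hσ_lip : ∃ C : ℝ, ∀ z z', |deriv σ z - deriv σ z'| ≤ C * |z - z'|)
    -- initialization scale and learning rate
    (σw : ℝ) (hσw : 0 < σw) (η₀ : ℝ) (hη₀ : 0 < η₀)
    -- layer-wise laws of the (bounded) weight terms
    (ρ : ℕ → Measure ℝ) (hρ : ∀ l, IsProbabilityMeasure (ρ l))
    (amax : ℝ) (hamax : ∀ l, ∀ᵐ a ∂(ρ l), |a| ≤ amax)
    -- training set of distinct inputs
    (X : Fin n → EuclideanSpace ℝ (Fin d₀)) (hX : Function.Injective X) (Y : Fin n → ℝ)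
    -- the analytic WNTK of the network of depth `m + 2` is positive definite
    (hK : (WNTK.analyticWNTK σ σw (fun l => ∫ a, a ∂(ρ l)) X (m + 1)).PosDef)
    -- test input
    (x : EuclideanSpace ℝ (Fin d₀)) (hx : ‖x‖ ≤ 1) :
    ∀ ε : ℝ, 0 < ε → ∀ δ : ℝ, 0 < δ → ∃ N : ℕ, ∀ d : ℕ, N ≤ d →
      WNTK.jointLaw σw ρ d₀ m d
        {ω | ¬ WNTK.LazyUpTo σ X Y (η₀ / (d : ℝ)) x ε ω.1 ω.2} ≤ ENNReal.ofReal δ := by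
  intro ε hε δ hδ
  obtain ⟨D, hD⟩ := hσ_bdd
  obtain ⟨Λ, hΛ⟩ := hσ_lip
  obtain ⟨C, hact⟩ := WNTK.exists_actBounds hσ hD hΛ
  obtain ⟨lam, hlam, hcoer⟩ := WNTK.exists_coercive_of_posDef hK
  -- An almost sure property of a probability measure holds at some point, so `amax` is nonnegative.
  obtain ⟨a₀, ha₀⟩ := (hamax 0).exists
  exact eventually_atTop.1 (WNTK.eventually_jointLaw_not_lazyUpTo_le hact hσ hd₀ hσw hη₀
    ((abs_nonneg a₀).trans ha₀) hamax Y hlam hcoer x hε hδ)
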